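/- Let $r,s\ge 0$ be integers. All algebras are over $\mathbb C$, and a superalgebra is a $\mathbb Z/2\mathbb Z$-graded associative unital algebra. **The algebra $\mathsf{BC}_{r,s}$.** The walled Brauer–Clifford superalgebra $\mathsf{BC}_{r,s}$ is the superalgebra generated by even elements $s_1,\dots,s_{r-1},s_{r+1},\dots,s_{r+s-1}$, $e=e_{r,r+1}$ (the last one only if $r,s\ge 1$) and odd elements $c_1,\dots,c_{r+s}$, with the following defining relations, for all indices for which the generators that occur exist: $s_i^2=1$; $s_is_{i+1}s_i=s_{i+1}s_is_{i+1}$; $s_is_j=s_js_i$ for $|i-j|>1$; $e^2=0$; $es_j=s_je$ for $j\ne r-1,r+1$; $e=es_{r-1}e=es_{r+1}e$; $s_{r-1}s_{r+1}es_{r+1}s_{r-1}e=es_{r-1}s_{r+1}es_{r+1}s_{r-1}$; $c_i^2=-1$ for $1\le i\le r$; $c_i^2=1$ for $r+1\le i\le r+s$; $c_ic_j=-c_jc_i$ for $i\neq j$; $s_ic_is_i=c_{i+1}$; $s_ic_j=c_js_i$ for $j\ne i,i+1$; $c_re=c_{r+1}e$; $ec_r=ec_{r+1}$; $ec_re=0$;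 $ec_j=c_je$ for $j\neq r,r+1$. **Bead diagrams.** An $(r,s)$-bead diagram has two rows of $r+s$ vertices, labelled $1,\dots,r+s$ from left to right, with a vertical wall between the vertices $r$ and $r+1$ of each row. Each vertex is connected by a strand to exactly one other vertex; a strand between the two rows does not cross the wall, and a strand within one row does cross it. There are finitely many beads on the strands, numbered $1,\dots,m$ without repetition. Two diagrams are equal if they have the same connections and the same beads in the same order along each strand. The diagram is even or odd according to the parity of $m$. Let $\widetilde{\mathsf{BD}}_{r,s}$ be the superspace with basis the set of $(r,s)$-bead diagrams. The product $d_1d_2$ of two diagrams is obtained by putting $d_1$ under $d_2$ and identifying the top vertices of $d_1$ with the bottom vertices of $d_2$; if this creates a closed loop, then $d_1d_2=0$, and otherwise $d_1d_2$ is the concatenated diagram, in which each bead number of $d_2$ is increased by the largest bead number of $d_1$ (by $0$ if $d_1$ has no beads). This makes $\widetilde{\mathsf{BD}}_{r,s}$ a superalgebra, whose identity is the diagram with straight vertical strands and no beads. **The algebra $\mathsf{BD}_{r,s}$.** Let $\mathsf{BD}'_{r,s}\subseteq\widetilde{\mathsf{BD}}_{r,s}$ be the subalgebra generated by the following diagrams: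 $\mathbf s_i$ for $1\le i\le r+s-1$, $i\ne r$ (the identity diagram with the strands at $i$ and $i+1$ crossed); $\mathbf e_{r,r+1}$ if $r,s\ge1$ (no beads, the vertices $r$ and $r+1$ are connected in each row, and all other strands are vertical and straight); and $\mathbf c_i$ for $1\le i\le r+s$ (the identity diagram with one bead on the $i$-th strand). Let $\mathsf L$ be the two-sided ideal of $\mathsf{BD}'_{r,s}$ generated by $\mathbf c_k^2+1$ for $1\le k\le r$, $\mathbf c_l^2-1$ for $r+1\le l\le r+s$, and $\mathbf c_i\mathbf c_j+\mathbf c_j\mathbf c_i$ for $1\le i\ne j\le r+s$. The $(r,s)$-bead diagram algebra is the quotient superalgebra $\mathsf{BD}_{r,s}=\mathsf{BD}'_{r,s}/\mathsf L$. **Theorem.** The walled Brauer–Clifford superalgebra $\mathsf{BC}_{r,s}$ and the $(r,s)$-bead diagram algebra $\mathsf{BD}_{r,s}$ are isomorphic as associative superalgebras: there is an isomorphism of unital $\mathbb C$-algebras $\mathsf{BC}_{r,s}\to\mathsf{BD}_{r,s}$ that maps the even part onto the even part and the odd part onto the odd part. -/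

import Mathlib

namespace WalledBrauerClifford

/-! ### Systems of glued strands -/

/-- A set `X` of strand ends. The end `x` belongs to a strand whose other end is `mate x`, and
`word x` lists the bead numbers met when walking from `x` to `mate x`. Some ends are glued in
pairs: `glue x = some y` if `x` is glued to `y`, and `glue x = none` if `x` is free.
The function `orient` separates the two ends of every strand, and the two ends of every gluing. -/
structure Net (X : Type) where
  mate : X → X
  glue : X → Option X
  word : X → List ℕ
  orient : X → Bool
  mate_mate : ∀ x, mate (mate x) = x
  word_mate : ∀ x, word (mate x) = (word x).reverse
  glue_symm : ∀ x y, glue x = some y → glue y = some x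
  orient_mate : ∀ x, orient (mate x) = !orient x
  orient_glue : ∀ x y, glue x = some y → orient y = !orient x

namespace Net

variable {X : Type}

/-- Walk along the strand starting at `x` and pass through the gluing at its other end. -/
def Step (N : Net X) (x y : X) : Prop := N.glue (N.mate x) = some y

/-- There is a closed curve. -/
def HasLoop (N : Net X) : Prop := ∃ x, Relation.TransGen N.Step x x

/-- `N.Trace x z l`: the walk that starts at `x` ends at the free end `z`, and the beads that it
meets are, in this order, those of `l`. -/
inductive Trace (N : Net X) : X → X → List ℕ → Prop
  | exit (x : X) (h : N.glue (N.mate x) = none) : Trace N x (N.mate x) (N.word x)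
  | step (x y z : X) (l : List ℕ) (h : N.Step x y) (t : Trace N y z l) :
      Trace N x z (N.word x ++ l)

theorem Trace.unique {N : Net X} {x z z' : X} {l l' : List ℕ} (h : N.Trace x z l)
    (h' : N.Trace x z' l') : z = z' ∧ l = l' := by
  induction h generalizing z' l' with
  | exit x h =>
    cases h' with
    | exit _ _ => exact ⟨rfl, rfl⟩
    | step _ y _ l hs t => simp [Step, h] at hs
  | step x y z l hs t ih =>
    cases h' with
    | exit _ h => simp [Step, h] at hs
    | step _ y' _ l' hs' t' =>
      have : y = y' := by
        unfold Step at hs hs'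
        rw [hs] at hs'
        exact Option.some.inj hs'
      subst this
      obtain ⟨h1, h2⟩ := ih t'
      exact ⟨h1, by rw [h2]⟩

theorem Trace.free {N : Net X} {x z : X} {l : List ℕ} (h : N.Trace x z l) :
    N.glue z = none := by
  induction h with
  | exit x h => exact h
  | step x y z l hs t ih => exact ih

theorem Trace.orient {N : Net X} {x z : X} {l : List ℕ} (h : N.Trace x z l) :
    N.orient z = !N.orient x := by
  induction h with
  | exit x h => exact N.orient_mate x
  | step x y z l hs t ih =>
    rw [ih, N.orient_glue _ _ hs, N.orient_mate]; simp

theorem Trace.no_cycle {N : Net X} {x z : X} {l : List ℕ} (h : N.Trace x z l) :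
    ¬ Relation.TransGen N.Step x x := by
  induction h with
  | exit x h =>
    intro hc
    obtain ⟨y, hy, -⟩ := Relation.TransGen.head'_iff.1 hc
    simp [Step, h] at hy
  | step x y z l hs t ih =>
    intro hc
    obtain ⟨y', hy', hr⟩ := Relation.TransGen.head'_iff.1 hc
    have : y = y' := by
      unfold Step at hs hy'
      rw [hs] at hy'
      exact Option.some.inj hy'
    subst this
    exact ih (Relation.TransGen.tail' hr hs)

theorem hasLoop_iff [Finite X] (N : Net X) : ¬ N.HasLoop ↔ ∀ x, ∃ z l, N.Trace x z l := by
  constructor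
  · intro h
    have : IsTrans X (fun a b => Relation.TransGen N.Step b a) :=
      ⟨fun a b c h1 h2 => h2.trans h1⟩
    have : Std.Irrefl (fun a b => Relation.TransGen N.Step b a) := ⟨fun a ha => h ⟨a, ha⟩⟩
    have wf := Finite.wellFounded_of_trans_of_irrefl
      (fun a b => Relation.TransGen N.Step b a)
    intro x
    induction x using wf.induction with
    | h x ih =>
      cases hg : N.glue (N.mate x) with
      | none => exact ⟨_, _, Trace.exit x hg⟩
      | some y =>
        obtain ⟨z, l, t⟩ := ih y (Relation.TransGen.single hg)
        exact ⟨_, _, Trace.step x y z l hg t⟩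
  · rintro h ⟨x, hx⟩
    obtain ⟨z, l, t⟩ := h x
    exact t.no_cycle hx

theorem Trace.reverse_aux {N : Net X} {x z : X} {l : List ℕ} (h : N.Trace x z l) :
    (N.glue x = none → N.Trace z x l.reverse) ∧
    (∀ y w k, N.glue x = some y → N.Trace y w k → N.Trace z w (l.reverse ++ k)) := by
  induction h with
  | exit x h =>
    refine ⟨fun hx => ?_, fun y w k hy t => ?_⟩
    · have := Trace.exit (N := N) (N.mate x) (by rw [N.mate_mate]; exact hx)
      rwa [N.mate_mate, N.word_mate] at this
    · have := Trace.step (N := N) (N.mate x) y w k (by unfold Step; rw [N.mate_mate]; exact hy) t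
      rwa [N.word_mate] at this
  | step x y z l hs t ih =>
    have hy := N.glue_symm _ _ hs
    refine ⟨fun hx => ?_, fun y' w k hy' t' => ?_⟩
    · have := Trace.exit (N := N) (N.mate x) (by rw [N.mate_mate]; exact hx)
      rw [N.mate_mate, N.word_mate] at this
      rw [List.reverse_append]
      exact ih.2 _ _ _ hy this
    · have := Trace.step (N := N) (N.mate x) y' w k
        (by unfold Step; rw [N.mate_mate]; exact hy') t'
      rw [N.word_mate] at this
      rw [List.reverse_append, List.append_assoc]
      exact ih.2 _ _ _ hy this

theorem Trace.reverse {N : Net X} {x z : X} {l : List ℕ} (h : N.Trace x z l)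
    (hx : N.glue x = none) : N.Trace z x l.reverse := h.reverse_aux.1 hx

theorem Trace.mem {N : Net X} {x z : X} {l : List ℕ} (h : N.Trace x z l) (k : ℕ) :
    k ∈ l ↔ ∃ y, Relation.ReflTransGen N.Step x y ∧ k ∈ N.word y := by
  induction h with
  | exit x h =>
    refine ⟨fun hk => ⟨x, .refl, hk⟩, ?_⟩
    rintro ⟨y, hy, hk⟩
    rcases Relation.ReflTransGen.cases_head hy with rfl | ⟨c, hc, -⟩
    · exact hk
    · simp [Step, h] at hc
  | step x y z l hs t ih =>
    rw [List.mem_append, ih]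
    constructor
    · rintro (hk | ⟨w, hw, hk⟩)
      · exact ⟨x, .refl, hk⟩
      · exact ⟨w, .head hs hw, hk⟩
    · rintro ⟨w, hw, hk⟩
      rcases Relation.ReflTransGen.cases_head hw with rfl | ⟨c, hc, hcw⟩
      · exact .inl hk
      · have : y = c := by
          unfold Step at hs hc
          rw [hs] at hc
          exact Option.some.inj hc
        subst this
        exact .inr ⟨w, hcw, hk⟩

theorem step_rev {N : Net X} {x y : X} (h : N.Step x y) : N.Step (N.mate y) (N.mate x) := by
  unfold Step
  rw [N.mate_mate]
  exact N.glue_symm _ _ h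

theorem reach_rev {N : Net X} {x y : X} (h : Relation.ReflTransGen N.Step x y) :
    Relation.ReflTransGen N.Step (N.mate y) (N.mate x) := by
  induction h with
  | refl => exact .refl
  | tail _ h ih => exact .head (step_rev h) ih

theorem reach_orient {N : Net X} {x y : X} (h : Relation.ReflTransGen N.Step x y) :
    N.orient y = N.orient x := by
  induction h with
  | refl => rfl
  | tail _ h ih => rw [N.orient_glue _ _ h, N.orient_mate, ih]; simp

theorem step_inj {N : Net X} {x x' y : X} (h : N.Step x y) (h' : N.Step x' y) : x = x' := by
  have h1 := N.glue_symm _ _ h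
  have h2 := N.glue_symm _ _ h'
  rw [h1] at h2
  have h3 := congrArg N.mate (Option.some.inj h2)
  rwa [N.mate_mate, N.mate_mate] at h3

theorem no_step_free {N : Net X} {x y : X} (h : N.Step x y) : N.glue y ≠ none := by
  rw [N.glue_symm _ _ h]; simp

theorem reach_source {N : Net X} {v w y : X} (hv : N.glue v = none) (hw : N.glue w = none)
    (h : Relation.ReflTransGen N.Step v y) (h' : Relation.ReflTransGen N.Step w y) : v = w := by
  induction h with
  | refl =>
    rcases Relation.ReflTransGen.cases_tail h' with rfl | ⟨c, -, hc⟩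
    · rfl
    · exact absurd hv (no_step_free hc)
  | tail _ hs ih =>
    rcases Relation.ReflTransGen.cases_tail h' with rfl | ⟨c, hc', hc⟩
    · exact absurd hw (no_step_free hs)
    · rw [← step_inj hs hc] at hc'
      exact ih hc'

theorem Trace.reach {N : Net X} {x z : X} {l : List ℕ} (h : N.Trace x z l) :
    Relation.ReflTransGen N.Step x (N.mate z) := by
  induction h with
  | exit x h => rw [N.mate_mate]
  | step x y z l hs t ih => exact .head hs ih

/-- Every end lies on the walk from some free end, if there are no loops. -/
theorem exists_source {N : Net X} (h : ∀ x, ∃ z l, N.Trace x z l) (x : X) :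
    ∃ v, N.glue v = none ∧ Relation.ReflTransGen N.Step v x := by
  obtain ⟨z, l, t⟩ := h (N.mate x)
  refine ⟨z, t.free, ?_⟩
  have := reach_rev t.reach
  rwa [N.mate_mate, N.mate_mate] at this

/-- Each bead number occurs at most once in the system. -/
def Distinct (N : Net X) : Prop :=
  (∀ x, (N.word x).Nodup) ∧
    ∀ x y k, k ∈ N.word x → k ∈ N.word y → y = x ∨ y = N.mate x

theorem Trace.nodup {N : Net X} (hN : N.Distinct) {x z : X} {l : List ℕ}
    (h : N.Trace x z l) : l.Nodup := by
  induction h with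
  | exit x h => exact hN.1 x
  | step x y z l hs t ih =>
    rw [List.nodup_append']
    refine ⟨hN.1 x, ih, ?_⟩
    intro k hk hk'
    obtain ⟨w, hw, hkw⟩ := (t.mem k).1 hk'
    rcases hN.2 x w k hk hkw with rfl | rfl
    · exact (Trace.step _ _ _ _ hs t).no_cycle (.head' hs hw)
    · have := reach_orient (Relation.ReflTransGen.head hs hw)
      rw [N.orient_mate] at this
      simp at this

theorem Trace.mem_unique {N : Net X} (hN : N.Distinct) {v w z z' : X} {l l' : List ℕ}
    (hv : N.glue v = none) (hw : N.glue w = none)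
    (h : N.Trace v z l) (h' : N.Trace w z' l') {k : ℕ} (hk : k ∈ l) (hk' : k ∈ l') :
    w = v ∨ w = z := by
  obtain ⟨x, hx, hkx⟩ := (h.mem k).1 hk
  obtain ⟨y, hy, hky⟩ := (h'.mem k).1 hk'
  rcases hN.2 x y k hkx hky with rfl | rfl
  · exact .inl (reach_source hw hv hy hx)
  · right
    have hk2 : k ∈ l.reverse := by simpa using hk
    obtain ⟨u, hu, hku⟩ := ((h.reverse hv).mem k).1 hk2
    rcases hN.2 x u k hkx hku with rfl | rfl
    · have h1 := reach_orient hu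
      have h2 := reach_orient hx
      rw [h.orient, h2] at h1
      simp at h1
    · exact reach_source hw h.free hy hu

theorem Trace.map {X' : Type} {M : Net X'} {N : Net X} (j : X' → X) (f : ℕ → ℕ)
    (hm : ∀ x, N.mate (j x) = j (M.mate x)) (hw : ∀ x, N.word (j x) = (M.word x).map f)
    (hg : ∀ x, N.glue (j x) = (M.glue x).map j) {x z : X'} {l : List ℕ} (h : M.Trace x z l) :
    N.Trace (j x) (j z) (l.map f) := by
  induction h with
  | exit x h =>
    have := Trace.exit (N := N) (j x) (by rw [hm, hg, h]; rfl)
    rwa [hm, hw] at this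
  | step x y z l hs t ih =>
    have := Trace.step (N := N) (j x) (j y) (j z) _
      (by unfold Step at hs ⊢; rw [hm, hg, hs]; rfl) ih
    rwa [hw, ← List.map_append] at this

theorem total_of_map {X' : Type} [Finite X'] {M : Net X'} {N : Net X} (j : X' → X)
    (hm : ∀ x, N.mate (j x) = j (M.mate x)) (hg : ∀ x, N.glue (j x) = (M.glue x).map j)
    (h : ∀ x, ∃ z l, N.Trace x z l) (x : X') : ∃ z l, M.Trace x z l := by
  refine (hasLoop_iff M).1 ?_ x
  rintro ⟨y, hy⟩
  have hs : ∀ u v, M.Step u v → N.Step (j u) (j v) := by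
    intro u v huv
    unfold Step at huv ⊢
    rw [hm, hg, huv]; rfl
  obtain ⟨z, l, t⟩ := h (j y)
  exact t.no_cycle (hy.lift j hs)

/-- Gluing in two stages: `N₀` has only some of the gluings of `N`, and `N'` is what one gets
from `N` by performing these. -/
structure Stage {X' : Type} (N₀ N : Net X) (N' : Net X') (ι : X' → X) : Prop where
  mate_eq : ∀ x, N₀.mate x = N.mate x
  word_eq : ∀ x, N₀.word x = N.word x
  glue_some : ∀ x y, N₀.glue x = some y → N.glue x = some y
  glue_none : ∀ x, N₀.glue x = none → ∃ x', ι x' = x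
  trace : ∀ x', N₀.Trace (ι x') (ι (N'.mate x')) (N'.word x')
  glue_eq : ∀ x', N.glue (ι x') = (N'.glue x').map ι

namespace Stage

variable {X' : Type} {N₀ N : Net X} {N' : Net X'} {ι : X' → X}

theorem lift_exit (hme : ∀ x, N₀.mate x = N.mate x) (hwo : ∀ x, N₀.word x = N.word x)
    (hgl : ∀ x y, N₀.glue x = some y → N.glue x = some y) {x z : X} {l : List ℕ}
    (h : N₀.Trace x z l) :
    (N.glue z = none → N.Trace x z l) ∧
    (∀ y w k, N.glue z = some y → N.Trace y w k → N.Trace x w (l ++ k)) := by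
  induction h with
  | exit x h =>
    rw [hme, hwo]
    exact ⟨fun hn => .exit x hn, fun y w k hy t => .step x y w k hy t⟩
  | step x y z l hs t ih =>
    have hs' : N.Step x y := by
      have := hgl _ _ hs
      rwa [hme] at this
    rw [hwo]
    refine ⟨fun hn => .step x y z l hs' (ih.1 hn), fun y' w k hy t' => ?_⟩
    rw [List.append_assoc]
    exact .step x y w _ hs' (ih.2 _ _ _ hy t')

theorem lift (S : Stage N₀ N N' ι) {x z : X'} {l : List ℕ} (h : N'.Trace x z l) :
    N.Trace (ι x) (ι z) l := by
  induction h with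
  | exit x h =>
    refine (lift_exit S.mate_eq S.word_eq S.glue_some (S.trace x)).1 ?_
    rw [S.glue_eq, h]; rfl
  | step x y z l hs t ih =>
    refine (lift_exit S.mate_eq S.word_eq S.glue_some (S.trace x)).2 (ι y) _ _ ?_ ih
    rw [S.glue_eq, hs]; rfl

theorem total_small (hme : ∀ x, N₀.mate x = N.mate x) 
    (hgl : ∀ x y, N₀.glue x = some y → N.glue x = some y)
    (h : ∀ x, ∃ z l, N.Trace x z l) (x : X) : ∃ z l, N₀.Trace x z l := by
  obtain ⟨z, l, t⟩ := h x
  induction t with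
  | exit x h =>
    refine ⟨_, _, .exit x ?_⟩
    cases hg : N₀.glue (N₀.mate x) with
    | none => rfl
    | some y =>
      have := hgl _ _ hg
      rw [hme, h] at this
      simp at this
  | step x y z l hs t ih =>
    cases hg : N₀.glue (N₀.mate x) with
    | none => exact ⟨_, _, .exit x hg⟩
    | some y' =>
      have := hgl _ _ hg
      rw [hme, hs] at this
      obtain rfl := Option.some.inj this
      obtain ⟨z', l', t'⟩ := ih
      exact ⟨_, _, .step x y z' l' hg t'⟩

theorem total_of (S : Stage N₀ N N' ι) (h₀ : ∀ x, ∃ z l, N₀.Trace x z l)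
    (h' : ∀ x, ∃ z l, N'.Trace x z l) (x : X) : ∃ z l, N.Trace x z l := by
  obtain ⟨z, l, t⟩ := h₀ x
  have key := lift_exit S.mate_eq S.word_eq S.glue_some t
  obtain ⟨z', rfl⟩ := S.glue_none _ t.free
  cases hg : N'.glue z' with
  | none => exact ⟨_, _, key.1 (by rw [S.glue_eq, hg]; rfl)⟩
  | some w =>
    obtain ⟨u, k, t'⟩ := h' w
    exact ⟨_, _, key.2 (ι w) _ _ (by rw [S.glue_eq, hg]; rfl) (S.lift t')⟩

theorem reach_lift (S : Stage N₀ N N' ι) {x y : X'} (h : N'.Step x y) :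
    Relation.TransGen N.Step (ι x) (ι y) := by
  have hg : N.glue (ι (N'.mate x)) = some (ι y) := by
    have : N'.glue (N'.mate x) = some y := h
    rw [S.glue_eq, this]; rfl
  have t := S.trace x
  generalize ι x = a at t
  generalize ι (N'.mate x) = b at t hg
  generalize N'.word x = l₀ at t
  induction t with
  | exit a ha => exact .single (by unfold Step; rw [← S.mate_eq]; exact hg)
  | step a c b l hs t ih =>
    refine .head ?_ (ih hg)
    have := S.glue_some _ _ hs
    rwa [S.mate_eq] at this

theorem total_quot [Finite X] [Finite X'] (S : Stage N₀ N N' ι)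
    (h : ∀ x, ∃ z l, N.Trace x z l) (x : X') : ∃ z l, N'.Trace x z l := by
  refine (hasLoop_iff N').1 ?_ x
  rintro ⟨y, hy⟩
  have : ∀ u v, Relation.TransGen N'.Step u v → Relation.TransGen N.Step (ι u) (ι v) := by
    intro u v huv
    induction huv with
    | single h => exact S.reach_lift h
    | tail _ h ih => exact ih.trans (S.reach_lift h)
  obtain ⟨z, l, t⟩ := h (ι y)
  exact t.no_cycle (this _ _ hy)

end Stage

end Net

/-! ### Bead diagrams -/

/-- The labels `1, …, r + s` of the vertices in a row. -/
abbrev Label (r s : ℕ) : Type := {i : ℕ // 1 ≤ i ∧ i ≤ r + s}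

instance (r s : ℕ) : Finite (Label r s) :=
  Finite.of_injective (fun i : Label r s => (⟨i.1, Nat.lt_succ_of_le i.2.2⟩ : Fin (r + s + 1)))
    (fun i j h => Subtype.ext (by simpa using h))

/-- The vertices: `(false, i)` is the `i`-th vertex of the bottom row and `(true, i)` is the `i`-th
vertex of the top row. -/
abbrev Vertex (r s : ℕ) : Type := Bool × Label r s

/-- The vertex is on the left of the wall. -/
def IsLeft {r s : ℕ} (v : Vertex r s) : Prop := (v.2 : ℕ) ≤ r

instance {r s : ℕ} (v : Vertex r s) : Decidable (IsLeft v) := by unfold IsLeft; infer_instance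

/-- An `(r, s)`-bead diagram. The vertex `v` is connected to the vertex `mate v`, the list `beads v`
contains the numbers of the beads on this strand in the order in which one meets them walking from
`v` to `mate v`, and `num` is the number of beads. Beads that slide along a strand without changing
their order give the same data. -/
@[ext]
structure BeadDiagram (r s : ℕ) where
  mate : Vertex r s → Vertex r s
  beads : Vertex r s → List ℕ
  num : ℕ
  mate_ne : ∀ v, mate v ≠ v
  mate_mate : ∀ v, mate (mate v) = v
  /-- A vertical strand does not cross the wall. -/
  vertical : ∀ v, (mate v).1 ≠ v.1 → (IsLeft (mate v) ↔ IsLeft v)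
  /-- A horizontal strand crosses the wall. -/
  horizontal : ∀ v, (mate v).1 = v.1 → (IsLeft (mate v) ↔ ¬ IsLeft v)
  beads_mate : ∀ v, beads (mate v) = (beads v).reverse
  /-- The bead numbers are `1, …, num`. -/
  mem_beads : ∀ k, (∃ v, k ∈ beads v) ↔ 1 ≤ k ∧ k ≤ num
  /-- Different beads have different numbers. -/
  beads_nodup : ∀ v, (beads v).Nodup
  beads_unique : ∀ v w k, k ∈ beads v → k ∈ beads w → w = v ∨ w = mate v

namespace BeadDiagram

variable {r s : ℕ}

/-- Distinguishes the two ends of every strand. -/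
def vertexOrient (v : Vertex r s) : Bool := xor v.1 (decide (IsLeft v))

theorem vertexOrient_mate (d : BeadDiagram r s) (v : Vertex r s) :
    vertexOrient (d.mate v) = !vertexOrient v := by
  unfold vertexOrient
  have h1 := d.vertical v
  have h2 := d.horizontal v
  generalize d.mate v = w at h1 h2
  by_cases hr : w.1 = v.1
  · have := h2 hr
    by_cases hv : IsLeft v <;> simp_all
  · have := h1 hr
    have hr' : w.1 = !v.1 := by revert hr; cases w.1 <;> cases v.1 <;> simp
    by_cases hv : IsLeft v <;> simp_all

theorem vertexOrient_flip (b : Bool) (n : Label r s) :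
    vertexOrient (r := r) (s := s) (!b, n) = !vertexOrient (b, n) := by
  unfold vertexOrient IsLeft
  cases b <;> simp

/-- The gluing of the top row of the lower diagram to the bottom row of the upper diagram. -/
def stackGlue : Vertex r s ⊕ Vertex r s → Option (Vertex r s ⊕ Vertex r s)
  | .inl (true, n) => some (.inr (false, n))
  | .inr (false, n) => some (.inl (true, n))
  | .inl (false, _) => none
  | .inr (true, _) => none

/-- The diagram `d₁` put under the diagram `d₂`, the top vertices of `d₁` being identified with the
bottom vertices of `d₂`, and the bead numbers of `d₂` being increased by the largest one of `d₁`. -/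
def stack (d₁ d₂ : BeadDiagram r s) : Net (Vertex r s ⊕ Vertex r s) where
  mate := Sum.map d₁.mate d₂.mate
  glue := stackGlue
  word := Sum.elim d₁.beads (fun v => (d₂.beads v).map (· + d₁.num))
  orient := Sum.elim vertexOrient vertexOrient
  mate_mate := by rintro (v | v) <;> simp [mate_mate]
  word_mate := by rintro (v | v) <;> simp [beads_mate, List.map_reverse]
  glue_symm := by
    rintro (⟨(_ | _), n⟩ | ⟨(_ | _), n⟩) y h <;> simp only [stackGlue, reduceCtorEq] at h <;>
      obtain rfl := Option.some.inj h <;> rfl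
  orient_mate := by rintro (v | v) <;> simp [vertexOrient_mate]
  orient_glue := by
    rintro (⟨(_ | _), n⟩ | ⟨(_ | _), n⟩) y h <;> simp only [stackGlue, reduceCtorEq] at h <;>
      obtain rfl := Option.some.inj h
    · exact vertexOrient_flip true n
    · exact vertexOrient_flip false n

/-- The vertices of the concatenated diagram: the bottom row of the lower diagram and the top row of
the upper one. -/
def outer : Vertex r s → Vertex r s ⊕ Vertex r s
  | (false, n) => .inl (false, n)
  | (true, n) => .inr (true, n)

/-- The vertex of the concatenated diagram that is given by a vertex of one of the two layers. -/
def layerVertex : Vertex r s ⊕ Vertex r s → Vertex r s := Sum.elim id id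

theorem layerVertex_outer (v : Vertex r s) : layerVertex (outer v) = v := by
  rcases v with ⟨(_ | _), n⟩ <;> rfl

theorem outer_free (v : Vertex r s) : stackGlue (outer v) = none := by
  rcases v with ⟨(_ | _), n⟩ <;> rfl

theorem outer_layerVertex {x : Vertex r s ⊕ Vertex r s} (h : stackGlue x = none) :
    outer (layerVertex x) = x := by
  rcases x with (⟨(_ | _), n⟩ | ⟨(_ | _), n⟩) <;> simp_all [stackGlue, outer, layerVertex]

theorem stack_distinct (d₁ d₂ : BeadDiagram r s) : (stack d₁ d₂).Distinct := by
  constructor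
  · rintro (v | v)
    · exact d₁.beads_nodup v
    · exact (d₂.beads_nodup v).map (add_left_injective _)
  · rintro (v | v) (w | w) k hk hk'
    · simpa [stack] using d₁.beads_unique v w k hk hk'
    · exfalso
      have h1 := (d₁.mem_beads k).1 ⟨v, hk⟩
      obtain ⟨i, hi, rfl⟩ := List.mem_map.1 (show k ∈ (d₂.beads w).map (· + d₁.num) from hk')
      have h2 := (d₂.mem_beads i).1 ⟨w, hi⟩
      lia
    · exfalso
      have h1 := (d₁.mem_beads k).1 ⟨w, hk'⟩
      obtain ⟨i, hi, rfl⟩ := List.mem_map.1 (show k ∈ (d₂.beads v).map (· + d₁.num) from hk)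
      have h2 := (d₂.mem_beads i).1 ⟨v, hi⟩
      lia
    · obtain ⟨i, hi, rfl⟩ := List.mem_map.1 (show k ∈ (d₂.beads v).map (· + d₁.num) from hk)
      obtain ⟨j, hj, hij⟩ := List.mem_map.1 (show _ ∈ (d₂.beads w).map (· + d₁.num) from hk')
      have : j = i := by simpa using hij
      subst this
      simpa [stack] using d₂.beads_unique v w j hi hj

theorem exists_trace (d₁ d₂ : BeadDiagram r s) (h : ¬ (stack d₁ d₂).HasLoop) (v : Vertex r s) :
    ∃ p : Vertex r s × List ℕ, (stack d₁ d₂).Trace (outer v) (outer p.1) p.2 := by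
  obtain ⟨z, l, t⟩ := (Net.hasLoop_iff _).1 h (outer v)
  refine ⟨(layerVertex z, l), ?_⟩
  rwa [outer_layerVertex t.free]

/-- The end and the bead word of the strand of the concatenated diagram that starts at `v`. -/
noncomputable def concatStrand (d₁ d₂ : BeadDiagram r s) (h : ¬ (stack d₁ d₂).HasLoop)
    (v : Vertex r s) : Vertex r s × List ℕ := (exists_trace d₁ d₂ h v).choose

theorem concatStrand_trace (d₁ d₂ : BeadDiagram r s) (h : ¬ (stack d₁ d₂).HasLoop)
    (v : Vertex r s) :
    (stack d₁ d₂).Trace (outer v) (outer (concatStrand d₁ d₂ h v).1) (concatStrand d₁ d₂ h v).2 :=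
  (exists_trace d₁ d₂ h v).choose_spec

theorem outer_injective : Function.Injective (outer (r := r) (s := s)) :=
  Function.LeftInverse.injective layerVertex_outer

theorem concatStrand_eq {d₁ d₂ : BeadDiagram r s} {h : ¬ (stack d₁ d₂).HasLoop}
    {v w : Vertex r s} {l : List ℕ} (t : (stack d₁ d₂).Trace (outer v) (outer w) l) :
    concatStrand d₁ d₂ h v = (w, l) := by
  obtain ⟨h1, h2⟩ := (concatStrand_trace d₁ d₂ h v).unique t
  exact Prod.ext (outer_injective h1) h2

theorem stack_orient_outer (d₁ d₂ : BeadDiagram r s) (v : Vertex r s) :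
    (stack d₁ d₂).orient (outer v) = vertexOrient v := by
  rcases v with ⟨(_ | _), n⟩ <;> rfl

theorem concatStrand_orient (d₁ d₂ : BeadDiagram r s) (h : ¬ (stack d₁ d₂).HasLoop)
    (v : Vertex r s) : vertexOrient (concatStrand d₁ d₂ h v).1 = !vertexOrient v := by
  have := (concatStrand_trace d₁ d₂ h v).orient
  rwa [stack_orient_outer, stack_orient_outer] at this

/-- The concatenation of two diagrams, provided that there is no loop. -/
noncomputable def concat (d₁ d₂ : BeadDiagram r s) (h : ¬ (stack d₁ d₂).HasLoop) :
    BeadDiagram r s where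
  mate v := (concatStrand d₁ d₂ h v).1
  beads v := (concatStrand d₁ d₂ h v).2
  num := d₁.num + d₂.num
  mate_ne v hv := by
    have := concatStrand_orient d₁ d₂ h v
    rw [hv] at this
    simp at this
  mate_mate v := by
    rw [concatStrand_eq ((concatStrand_trace d₁ d₂ h v).reverse (outer_free v))]
  vertical v hv := by
    have := concatStrand_orient d₁ d₂ h v
    generalize (concatStrand d₁ d₂ h v).1 = w at *
    unfold vertexOrient at this
    by_cases h1 : IsLeft v <;> by_cases h2 : IsLeft w <;> cases h3 : v.1 <;> cases h4 : w.1 <;>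
      simp_all
  horizontal v hv := by
    have := concatStrand_orient d₁ d₂ h v
    generalize (concatStrand d₁ d₂ h v).1 = w at *
    unfold vertexOrient at this
    by_cases h1 : IsLeft v <;> by_cases h2 : IsLeft w <;> cases h3 : v.1 <;> cases h4 : w.1 <;>
      simp_all
  beads_mate v := by
    rw [concatStrand_eq ((concatStrand_trace d₁ d₂ h v).reverse (outer_free v))]
  mem_beads k := by
    have key : (∃ v, k ∈ (concatStrand d₁ d₂ h v).2) ↔ ∃ x, k ∈ (stack d₁ d₂).word x := by
      constructor
      · rintro ⟨v, hk⟩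
        obtain ⟨x, -, hx⟩ := ((concatStrand_trace d₁ d₂ h v).mem k).1 hk
        exact ⟨x, hx⟩
      · rintro ⟨x, hx⟩
        obtain ⟨y, hy, hyx⟩ := Net.exists_source ((Net.hasLoop_iff _).1 h) x
        refine ⟨layerVertex y, ((concatStrand_trace d₁ d₂ h _).mem k).2 ⟨x, ?_, hx⟩⟩
        rwa [outer_layerVertex hy]
    rw [key]
    constructor
    · rintro ⟨v | v, hv⟩
      · have := (d₁.mem_beads k).1 ⟨v, hv⟩
        lia
      · obtain ⟨i, hi, rfl⟩ := List.mem_map.1 (show k ∈ (d₂.beads v).map (· + d₁.num) from hv)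
        have := (d₂.mem_beads i).1 ⟨v, hi⟩
        lia
    · intro hk
      by_cases hk' : k ≤ d₁.num
      · obtain ⟨v, hv⟩ := (d₁.mem_beads k).2 ⟨hk.1, hk'⟩
        exact ⟨.inl v, hv⟩
      · obtain ⟨v, hv⟩ := (d₂.mem_beads (k - d₁.num)).2 (by lia)
        exact ⟨.inr v, List.mem_map.2 ⟨_, hv, by lia⟩⟩
  beads_nodup v := (concatStrand_trace d₁ d₂ h v).nodup (stack_distinct d₁ d₂)
  beads_unique v w k hk hk' := by
    rcases (concatStrand_trace d₁ d₂ h v).mem_unique (stack_distinct d₁ d₂) (outer_free v)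
      (outer_free w) (concatStrand_trace d₁ d₂ h w) hk hk' with h1 | h1
    · exact .inl (outer_injective h1)
    · exact .inr (outer_injective h1)

open Classical in
/-- The product of two diagrams; `none` stands for zero, the result when there is a loop. -/
noncomputable def comp (d₁ d₂ : BeadDiagram r s) : Option (BeadDiagram r s) :=
  if h : (stack d₁ d₂).HasLoop then none else some (concat d₁ d₂ h)

theorem comp_eq_some_iff {d₁ d₂ d : BeadDiagram r s} :
    comp d₁ d₂ = some d ↔ (∀ x, ∃ z l, (stack d₁ d₂).Trace x z l) ∧
      (∀ v, (stack d₁ d₂).Trace (outer v) (outer (d.mate v)) (d.beads v)) ∧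
      d.num = d₁.num + d₂.num := by
  rw [← Net.hasLoop_iff]
  unfold comp
  constructor
  · intro h
    split_ifs at h with hl
    obtain rfl := Option.some.inj h
    exact ⟨hl, concatStrand_trace d₁ d₂ hl, rfl⟩
  · rintro ⟨hl, ht, hn⟩
    rw [dif_neg hl]
    congr 1
    ext1
    · funext v
      exact congrArg Prod.fst (concatStrand_eq (ht v))
    · funext v
      exact congrArg Prod.snd (concatStrand_eq (ht v))
    · exact hn.symm

/-! Associativity -/

/-- Three diagrams on top of each other; `a` and `b` tell whether the two middle rows are glued. -/
def glue₃ (a b : Bool) : Vertex r s ⊕ Vertex r s ⊕ Vertex r s →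
    Option (Vertex r s ⊕ Vertex r s ⊕ Vertex r s)
  | .inl (true, n) => if a then some (.inr (.inl (false, n))) else none
  | .inr (.inl (false, n)) => if a then some (.inl (true, n)) else none
  | .inr (.inl (true, n)) => if b then some (.inr (.inr (false, n))) else none
  | .inr (.inr (false, n)) => if b then some (.inr (.inl (true, n))) else none
  | .inl (false, _) => none
  | .inr (.inr (true, _)) => none

def stack₃ (a b : Bool) (d₁ d₂ d₃ : BeadDiagram r s) :
    Net (Vertex r s ⊕ Vertex r s ⊕ Vertex r s) where
  mate := Sum.map d₁.mate (Sum.map d₂.mate d₃.mate)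
  glue := glue₃ a b
  word := Sum.elim d₁.beads (Sum.elim (fun v => (d₂.beads v).map (· + d₁.num))
    (fun v => (d₃.beads v).map (· + (d₁.num + d₂.num))))
  orient := Sum.elim vertexOrient (Sum.elim vertexOrient vertexOrient)
  mate_mate := by rintro (v | v | v) <;> simp [mate_mate]
  word_mate := by rintro (v | v | v) <;> simp [beads_mate, List.map_reverse]
  glue_symm := by
    rintro (⟨(_ | _), n⟩ | ⟨(_ | _), n⟩ | ⟨(_ | _), n⟩) y h <;> cases a <;> cases b <;>
      simp [glue₃] at h <;> subst h <;> rfl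
  orient_mate := by rintro (v | v | v) <;> simp [vertexOrient_mate]
  orient_glue := by
    rintro (⟨(_ | _), n⟩ | ⟨(_ | _), n⟩ | ⟨(_ | _), n⟩) y h <;> cases a <;> cases b <;>
      simp [glue₃] at h <;> subst h <;>
      first
        | exact vertexOrient_flip true n
        | exact vertexOrient_flip false n

def outer₃ : Vertex r s → Vertex r s ⊕ Vertex r s ⊕ Vertex r s
  | (false, n) => .inl (false, n)
  | (true, n) => .inr (.inr (true, n))

def lower₂ : Vertex r s ⊕ Vertex r s → Vertex r s ⊕ Vertex r s ⊕ Vertex r s :=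
  Sum.elim .inl (fun v => .inr (.inl v))

def leftEmb : Vertex r s ⊕ Vertex r s → Vertex r s ⊕ Vertex r s ⊕ Vertex r s :=
  Sum.elim (fun v => lower₂ (outer v)) (fun v => .inr (.inr v))

def rightEmb : Vertex r s ⊕ Vertex r s → Vertex r s ⊕ Vertex r s ⊕ Vertex r s :=
  Sum.elim .inl (fun v => .inr (outer v))

def IsTriple (d₁ d₂ d₃ d : BeadDiagram r s) : Prop :=
  (∀ x, ∃ z l, (stack₃ true true d₁ d₂ d₃).Trace x z l) ∧
    (∀ v, (stack₃ true true d₁ d₂ d₃).Trace (outer₃ v) (outer₃ (d.mate v)) (d.beads v)) ∧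
    d.num = d₁.num + d₂.num + d₃.num

theorem outer₃_injective : Function.Injective (outer₃ (r := r) (s := s)) := by
  rintro ⟨(_ | _), n⟩ ⟨(_ | _), m⟩ h <;> simp_all [outer₃]

theorem IsTriple.unique {d₁ d₂ d₃ d d' : BeadDiagram r s} (h : IsTriple d₁ d₂ d₃ d)
    (h' : IsTriple d₁ d₂ d₃ d') : d = d' := by
  ext1
  · funext v
    exact outer₃_injective ((h.2.1 v).unique (h'.2.1 v)).1
  · funext v
    exact ((h.2.1 v).unique (h'.2.1 v)).2
  · rw [h.2.2, h'.2.2]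

theorem stack₃_glue_le (a b : Bool) (d₁ d₂ d₃ : BeadDiagram r s) (x y)
    (h : (stack₃ a b d₁ d₂ d₃).glue x = some y) :
    (stack₃ true true d₁ d₂ d₃).glue x = some y := by
  rcases x with (⟨(_ | _), n⟩ | ⟨(_ | _), n⟩ | ⟨(_ | _), n⟩) <;> cases a <;> cases b <;>
    simp [stack₃, glue₃] at h ⊢ <;> exact h

theorem lower_word (b : Bool) (d₁ d₂ d₃ : BeadDiagram r s) (x) :
    (stack₃ true b d₁ d₂ d₃).word (lower₂ x) = ((stack d₁ d₂).word x).map id := by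
  rcases x with v | v <;> simp [stack₃, stack, lower₂]

theorem lower_mate (b : Bool) (d₁ d₂ d₃ : BeadDiagram r s) (x) :
    (stack₃ true b d₁ d₂ d₃).mate (lower₂ x) = lower₂ ((stack d₁ d₂).mate x) := by
  rcases x with v | v <;> simp [stack₃, stack, lower₂]

theorem lower_glue (d₁ d₂ d₃ : BeadDiagram r s) (x) :
    (stack₃ true false d₁ d₂ d₃).glue (lower₂ x) = ((stack d₁ d₂).glue x).map lower₂ := by
  rcases x with (⟨(_ | _), n⟩ | ⟨(_ | _), n⟩) <;>
    simp [stack₃, stack, lower₂, glue₃, stackGlue]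

theorem upper_word (a : Bool) (d₁ d₂ d₃ : BeadDiagram r s) (x) :
    (stack₃ a true d₁ d₂ d₃).word (.inr x) = ((stack d₂ d₃).word x).map (· + d₁.num) := by
  rcases x with v | v <;> simp [stack₃, stack]
  intro k _
  lia

theorem upper_mate (a : Bool) (d₁ d₂ d₃ : BeadDiagram r s) (x) :
    (stack₃ a true d₁ d₂ d₃).mate (.inr x) = .inr ((stack d₂ d₃).mate x) := by
  rcases x with v | v <;> simp [stack₃, stack]

theorem upper_glue (d₁ d₂ d₃ : BeadDiagram r s) (x) :
    (stack₃ false true d₁ d₂ d₃).glue (.inr x) = ((stack d₂ d₃).glue x).map .inr := by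
  rcases x with (⟨(_ | _), n⟩ | ⟨(_ | _), n⟩) <;> simp [stack₃, stack, glue₃, stackGlue]

theorem lower_total {d₁ d₂ : BeadDiagram r s} (d₃ : BeadDiagram r s)
    (h : ∀ x, ∃ z l, (stack d₁ d₂).Trace x z l) (x) :
    ∃ z l, (stack₃ true false d₁ d₂ d₃).Trace x z l := by
  have key : ∀ y, ∃ z l, (stack₃ true false d₁ d₂ d₃).Trace (lower₂ y) z l := by
    intro y
    obtain ⟨z, l, t⟩ := h y
    exact ⟨_, _, t.map lower₂ id (lower_mate _ _ _ _) (lower_word _ _ _ _) (lower_glue _ _ _)⟩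
  rcases x with v | v | v
  · exact key (.inl v)
  · exact key (.inr v)
  · refine ⟨_, _, .exit _ ?_⟩
    simp only [stack₃, Sum.map_inr]
    generalize d₃.mate v = w
    rcases w with ⟨(_ | _), n⟩ <;> simp [glue₃]

theorem upper_total {d₂ d₃ : BeadDiagram r s} (d₁ : BeadDiagram r s)
    (h : ∀ x, ∃ z l, (stack d₂ d₃).Trace x z l) (x) :
    ∃ z l, (stack₃ false true d₁ d₂ d₃).Trace x z l := by
  rcases x with v | y
  · refine ⟨_, _, .exit _ ?_⟩
    simp only [stack₃, Sum.map_inl]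
    generalize d₁.mate v = w
    rcases w with ⟨(_ | _), n⟩ <;> simp [glue₃]
  · obtain ⟨z, l, t⟩ := h y
    exact ⟨_, _, t.map Sum.inr (· + d₁.num) (upper_mate _ _ _ _) (upper_word _ _ _ _)
      (upper_glue _ _ _)⟩

theorem left_stage {d₁ d₂ d₁₂ : BeadDiagram r s} (d₃ : BeadDiagram r s)
    (h : comp d₁ d₂ = some d₁₂) :
    Net.Stage (stack₃ true false d₁ d₂ d₃) (stack₃ true true d₁ d₂ d₃) (stack d₁₂ d₃) leftEmb := by
  obtain ⟨-, ht, hn⟩ := comp_eq_some_iff.1 h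
  refine ⟨fun _ => rfl, fun _ => rfl, stack₃_glue_le _ _ _ _ _, ?_, ?_, ?_⟩
  · rintro (⟨(_ | _), n⟩ | ⟨(_ | _), n⟩ | v) hx <;> simp [stack₃, glue₃] at hx
    · exact ⟨.inl (false, n), rfl⟩
    · exact ⟨.inl (true, n), rfl⟩
    · exact ⟨.inr v, rfl⟩
  · rintro (v | v)
    · have := (ht v).map lower₂ id (lower_mate false d₁ d₂ d₃) (lower_word _ _ _ _)
        (lower_glue _ _ _)
      rwa [List.map_id] at this
    · have := Net.Trace.exit (N := stack₃ true false d₁ d₂ d₃) (.inr (.inr v)) (by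
        simp only [stack₃, Sum.map_inr]
        generalize d₃.mate v = w
        rcases w with ⟨(_ | _), n⟩ <;> simp [glue₃])
      simpa [stack₃, stack, leftEmb, hn] using this
  · rintro (⟨(_ | _), n⟩ | ⟨(_ | _), n⟩) <;> rfl

theorem right_stage {d₂ d₃ d₂₃ : BeadDiagram r s} (d₁ : BeadDiagram r s)
    (h : comp d₂ d₃ = some d₂₃) :
    Net.Stage (stack₃ false true d₁ d₂ d₃) (stack₃ true true d₁ d₂ d₃) (stack d₁ d₂₃) rightEmb := by
  obtain ⟨-, ht, hn⟩ := comp_eq_some_iff.1 h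
  refine ⟨fun _ => rfl, fun _ => rfl, stack₃_glue_le _ _ _ _ _, ?_, ?_, ?_⟩
  · rintro (v | ⟨(_ | _), n⟩ | ⟨(_ | _), n⟩) hx <;> simp [stack₃, glue₃] at hx
    · exact ⟨.inl v, rfl⟩
    · exact ⟨.inr (false, n), rfl⟩
    · exact ⟨.inr (true, n), rfl⟩
  · rintro (v | v)
    · have := Net.Trace.exit (N := stack₃ false true d₁ d₂ d₃) (.inl v) (by
        simp only [stack₃, Sum.map_inl]
        generalize d₁.mate v = w
        rcases w with ⟨(_ | _), n⟩ <;> simp [glue₃])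
      simpa [stack₃, stack, rightEmb] using this
    · exact (ht v).map Sum.inr (· + d₁.num) (upper_mate false d₁ d₂ d₃) (upper_word _ _ _ _)
        (upper_glue _ _ _)
  · rintro (⟨(_ | _), n⟩ | ⟨(_ | _), n⟩) <;> rfl

theorem exists_comp {d₁ d₂ : BeadDiagram r s} (h : ∀ x, ∃ z l, (stack d₁ d₂).Trace x z l) :
    ∃ d, comp d₁ d₂ = some d := by
  have hl := (Net.hasLoop_iff _).2 h
  exact ⟨concat d₁ d₂ hl, by unfold comp; rw [dif_neg hl]⟩

theorem leftEmb_outer (v : Vertex r s) : leftEmb (outer v) = outer₃ v := by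
  rcases v with ⟨(_ | _), n⟩ <;> rfl

theorem rightEmb_outer (v : Vertex r s) : rightEmb (outer v) = outer₃ v := by
  rcases v with ⟨(_ | _), n⟩ <;> rfl

theorem left_triple {d₁ d₂ d₃ d₁₂ d : BeadDiagram r s} (h : comp d₁ d₂ = some d₁₂)
    (h' : comp d₁₂ d₃ = some d) : IsTriple d₁ d₂ d₃ d := by
  have S := left_stage d₃ h
  have h1 := comp_eq_some_iff.1 h
  have h2 := comp_eq_some_iff.1 h'
  refine ⟨S.total_of (lower_total d₃ h1.1) h2.1, fun v => ?_, by rw [h2.2.2, h1.2.2]⟩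
  have := S.lift (h2.2.1 v)
  rwa [leftEmb_outer, leftEmb_outer] at this

theorem right_triple {d₁ d₂ d₃ d₂₃ d : BeadDiagram r s} (h : comp d₂ d₃ = some d₂₃)
    (h' : comp d₁ d₂₃ = some d) : IsTriple d₁ d₂ d₃ d := by
  have S := right_stage d₁ h
  have h1 := comp_eq_some_iff.1 h
  have h2 := comp_eq_some_iff.1 h'
  refine ⟨S.total_of (upper_total d₁ h1.1) h2.1, fun v => ?_, by rw [h2.2.2, h1.2.2, add_assoc]⟩
  have := S.lift (h2.2.1 v)
  rwa [rightEmb_outer, rightEmb_outer] at this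

theorem left_iff {d₁ d₂ d₃ d : BeadDiagram r s} :
    (comp d₁ d₂).bind (fun x => comp x d₃) = some d ↔ IsTriple d₁ d₂ d₃ d := by
  rw [Option.bind_eq_some_iff]
  constructor
  · rintro ⟨d₁₂, h, h'⟩
    exact left_triple h h'
  · intro h
    obtain ⟨d₁₂, h1⟩ := exists_comp (Net.total_of_map lower₂ (lower_mate false d₁ d₂ d₃)
      (lower_glue _ _ _)
      (Net.Stage.total_small (N := stack₃ true true d₁ d₂ d₃) (fun _ => rfl)
        (stack₃_glue_le true false d₁ d₂ d₃) h.1))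
    obtain ⟨d', h2⟩ := exists_comp ((left_stage d₃ h1).total_quot h.1)
    refine ⟨d₁₂, h1, ?_⟩
    rw [h2, (left_triple h1 h2).unique h]

theorem right_iff {d₁ d₂ d₃ d : BeadDiagram r s} :
    (comp d₂ d₃).bind (fun x => comp d₁ x) = some d ↔ IsTriple d₁ d₂ d₃ d := by
  rw [Option.bind_eq_some_iff]
  constructor
  · rintro ⟨d₂₃, h, h'⟩
    exact right_triple h h'
  · intro h
    obtain ⟨d₂₃, h1⟩ := exists_comp (Net.total_of_map Sum.inr (upper_mate false d₁ d₂ d₃)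
      (upper_glue _ _ _)
      (Net.Stage.total_small (N := stack₃ true true d₁ d₂ d₃) (fun _ => rfl)
        (stack₃_glue_le false true d₁ d₂ d₃) h.1))
    obtain ⟨d', h2⟩ := exists_comp ((right_stage d₁ h1).total_quot h.1)
    refine ⟨d₂₃, h1, ?_⟩
    rw [h2, (right_triple h1 h2).unique h]

theorem comp_assoc (d₁ d₂ d₃ : BeadDiagram r s) :
    (comp d₁ d₂).bind (fun x => comp x d₃) = (comp d₂ d₃).bind (fun x => comp d₁ x) := by
  ext d
  rw [left_iff, right_iff]

/-! The diagrams that generate the algebra -/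

/-- The identity diagram. -/
def one (r s : ℕ) : BeadDiagram r s where
  mate v := (!v.1, v.2)
  beads _ := []
  num := 0
  mate_ne v h := by simpa using congrArg Prod.fst h
  mate_mate v := by simp
  vertical v _ := Iff.rfl
  horizontal v h := by simp at h
  beads_mate v := rfl
  mem_beads k := by simp; lia
  beads_nodup v := List.nodup_nil
  beads_unique v w k h := by simp at h

/-- The diagram with a crossing of the strands at `i` and `i + 1`, where both are on the same
side of the wall, and no beads. -/
def crossing (i : ℕ) (h : 1 ≤ i ∧ i < r + s ∧ i ≠ r) : BeadDiagram r s where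
  mate v := (!v.1, Equiv.swap ⟨i, h.1, h.2.1.le⟩ ⟨i + 1, Nat.le_add_left 1 i, h.2.1⟩ v.2)
  beads _ := []
  num := 0
  mate_ne v h := by simpa using congrArg Prod.fst h
  mate_mate v := by simp
  vertical v _ := by
    unfold IsLeft
    simp only [Equiv.swap_apply_def]
    split_ifs with h1 h2
    · rw [h1]; simp only; lia
    · rw [h2]; simp only; lia
    · rfl
  horizontal v h := by simp at h
  beads_mate v := rfl
  mem_beads k := by simp; lia
  beads_nodup v := List.nodup_nil
  beads_unique v w k h := by simp at h

/-- The diagram without beads in which the vertices `r` and `r + 1` of each row are connected,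
and all other strands are vertical and straight. -/
def cupCap (h : 1 ≤ r ∧ 1 ≤ s) : BeadDiagram r s where
  mate v := if (v.2 : ℕ) = r then (v.1, ⟨r + 1, by lia⟩)
    else if (v.2 : ℕ) = r + 1 then (v.1, ⟨r, by lia⟩) else (!v.1, v.2)
  beads _ := []
  num := 0
  mate_ne v := by
    intro hv
    split_ifs at hv with h1 h2
    · have := congrArg (fun u : Vertex r s => (u.2 : ℕ)) hv
      simp only at this; lia
    · have := congrArg (fun u : Vertex r s => (u.2 : ℕ)) hv
      simp only at this; lia
    · simpa using congrArg Prod.fst hv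
  mate_mate v := by
    rcases v with ⟨b, n, hn⟩
    by_cases h1 : n = r
    · subst h1; simp
    · by_cases h2 : n = r + 1
      · subst h2; simp
      · simp [h1, h2]
  vertical v hv := by
    split_ifs at hv ⊢ with h1 h2
    · simp at hv
    · simp at hv
    · rfl
  horizontal v hv := by
    split_ifs at hv ⊢ with h1 h2
    · simp [IsLeft, h1]
    · simp [IsLeft, h2]
    · simp at hv
  beads_mate v := rfl
  mem_beads k := by simp; lia
  beads_nodup v := List.nodup_nil
  beads_unique v w k h := by simp at h

/-- The identity diagram with one bead on the strand at `k`. -/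
def bead (k : ℕ) (hk : 1 ≤ k ∧ k ≤ r + s) : BeadDiagram r s where
  mate v := (!v.1, v.2)
  beads v := if (v.2 : ℕ) = k then [1] else []
  num := 1
  mate_ne v h := by simpa using congrArg Prod.fst h
  mate_mate v := by simp
  vertical v _ := Iff.rfl
  horizontal v h := by simp at h
  beads_mate v := by simp only; split_ifs <;> rfl
  mem_beads j := by
    constructor
    · rintro ⟨v, hv⟩
      split_ifs at hv
      · simp at hv; lia
      · simp at hv
    · intro hj
      exact ⟨(false, ⟨k, hk⟩), by simp; lia⟩
  beads_nodup v := by split_ifs <;> simp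
  beads_unique v w j hv hw := by
    split_ifs at hv hw with h1 h2
    · have : w.2 = v.2 := Subtype.ext (h2.trans h1.symm)
      rcases v with ⟨b, n⟩
      rcases w with ⟨b', n'⟩
      simp only at this
      subst this
      cases b <;> cases b' <;> simp
    all_goals simp at hv hw

theorem one_comp (d : BeadDiagram r s) : comp (one r s) d = some d := by
  have hr : ∀ v, (stack (one r s) d).Trace (.inr v) (outer (d.mate v)) (d.beads v) := by
    intro v
    cases hm : d.mate v with
    | mk b n =>
      cases b
      · have := Net.Trace.step (N := stack (one r s) d) (.inr v) (.inl (true, n)) _ _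
          (by simp [Net.Step, stack, hm, stackGlue]) (.exit _ (by simp [stack, one, stackGlue]))
        simpa [stack, one, outer] using this
      · have := Net.Trace.exit (N := stack (one r s) d) (.inr v) (by simp [stack, hm, stackGlue])
        simpa [stack, one, outer, hm] using this
  have hl : ∀ n, (stack (one r s) d).Trace (.inl (false, n)) (outer (d.mate (false, n)))
      (d.beads (false, n)) := by
    intro n
    have := Net.Trace.step (N := stack (one r s) d) (.inl (false, n)) (.inr (false, n)) _ _
      (by simp [Net.Step, stack, one, stackGlue]) (hr (false, n))
    simpa [stack, one] using this
  refine comp_eq_some_iff.2 ⟨?_, ?_, by simp [one]⟩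
  · rintro (⟨(_ | _), n⟩ | v)
    · exact ⟨_, _, hl n⟩
    · exact ⟨_, _, .exit _ (by simp [stack, one, stackGlue])⟩
    · exact ⟨_, _, hr v⟩
  · rintro ⟨(_ | _), n⟩
    · exact hl n
    · exact hr (true, n)

theorem comp_one (d : BeadDiagram r s) : comp d (one r s) = some d := by
  have hr : ∀ v, (stack d (one r s)).Trace (.inl v) (outer (d.mate v)) (d.beads v) := by
    intro v
    cases hm : d.mate v with
    | mk b n =>
      cases b
      · have := Net.Trace.exit (N := stack d (one r s)) (.inl v) (by simp [stack, hm, stackGlue])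
        simpa [stack, one, outer, hm] using this
      · have := Net.Trace.step (N := stack d (one r s)) (.inl v) (.inr (false, n)) _ _
          (by simp [Net.Step, stack, hm, stackGlue]) (.exit _ (by simp [stack, one, stackGlue]))
        simpa [stack, one, outer] using this
  have hl : ∀ n, (stack d (one r s)).Trace (.inr (true, n)) (outer (d.mate (true, n)))
      (d.beads (true, n)) := by
    intro n
    have := Net.Trace.step (N := stack d (one r s)) (.inr (true, n)) (.inl (true, n)) _ _
      (by simp [Net.Step, stack, one, stackGlue]) (hr (true, n))
    simpa [stack, one] using this
  refine comp_eq_some_iff.2 ⟨?_, ?_, by simp [one]⟩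
  · rintro (v | ⟨(_ | _), n⟩)
    · exact ⟨_, _, hr v⟩
    · exact ⟨_, _, .exit _ (by simp [stack, one, stackGlue])⟩
    · exact ⟨_, _, hl n⟩
  · rintro ⟨(_ | _), n⟩
    · exact hr (false, n)
    · exact hl n

end BeadDiagram

/-! ### Superalgebras -/

section Super

variable {A : Type} [Ring A] [Algebra ℂ A]

theorem graded_one_mem {𝒜 : ZMod 2 → Submodule ℂ A} {σ : A →ₐ[ℂ] A}
    (h : ∀ i x, x ∈ 𝒜 i ↔ σ x = (-1 : ℂ) ^ i.val • x) : (1 : A) ∈ 𝒜 0 := by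
  rw [h]; simp

theorem neg_one_pow_val_add (i j : ZMod 2) :
    (-1 : ℂ) ^ (i + j).val = (-1 : ℂ) ^ i.val * (-1 : ℂ) ^ j.val := by
  rw [ZMod.val_add, ← pow_add, ← neg_one_pow_eq_pow_mod_two]

theorem isInternal_of_involution {𝒜 : ZMod 2 → Submodule ℂ A} (σ : A →ₐ[ℂ] A)
    (hσ : ∀ x, σ (σ x) = x) (h : ∀ i x, x ∈ 𝒜 i ↔ σ x = (-1 : ℂ) ^ i.val • x) :
    DirectSum.IsInternal 𝒜 := by
  have h0 : ∀ x, x ∈ 𝒜 0 ↔ σ x = x := fun x => by rw [h]; simp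
  have h1 : ∀ x, x ∈ 𝒜 1 ↔ σ x = -x := fun x => by rw [h]; simp [ZMod.val_one]
  rw [DirectSum.isInternal_submodule_iff_isCompl 𝒜 (i := 0) (j := 1) (by decide)
    (by
      ext i
      simp only [Set.mem_univ, Set.mem_insert_iff, Set.mem_singleton_iff, true_iff]
      revert i; decide)]
  constructor
  · rw [Submodule.disjoint_def]
    intro x hx hx'
    rw [h0] at hx
    rw [h1, hx] at hx'
    have h2 : (2 : ℂ) • x = 0 := by
      rw [two_smul]; nth_rewrite 1 [hx']; simp
    simpa using h2
  · rw [codisjoint_iff, eq_top_iff]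
    intro x _
    refine Submodule.mem_sup.2 ⟨(1 / 2 : ℂ) • (x + σ x), ?_, (1 / 2 : ℂ) • (x - σ x), ?_, ?_⟩
    · rw [h0, map_smul, map_add, hσ, add_comm]
    · rw [h1, map_smul, map_sub, hσ]; module
    · module

/-- The eigenspaces of an involutive automorphism form a superalgebra. -/
@[reducible]
noncomputable def gradedOfInvolution {𝒜 : ZMod 2 → Submodule ℂ A} (σ : A →ₐ[ℂ] A)
    (hσ : ∀ x, σ (σ x) = x) (h : ∀ i x, x ∈ 𝒜 i ↔ σ x = (-1 : ℂ) ^ i.val • x) :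
    GradedAlgebra 𝒜 where
  one_mem := graded_one_mem h
  mul_mem {i j} x y hx hy := by
    rw [h] at hx hy ⊢
    rw [map_mul, hx, hy, smul_mul_smul_comm, neg_one_pow_val_add]
  toDecomposition := (isInternal_of_involution σ hσ h).chooseDecomposition

end Super

/-! ### The walled Brauer–Clifford superalgebra -/

/-- The generators of the walled Brauer–Clifford superalgebra. There is a generator `e` only if
both sides of the wall are nonempty. -/
inductive Gen (r s : ℕ) : Type
  | s (i : ℕ) (h : 1 ≤ i ∧ i < r + s ∧ i ≠ r)
  | e (h : 1 ≤ r ∧ 1 ≤ s)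
  | c (i : ℕ) (h : 1 ≤ i ∧ i ≤ r + s)

/-- The parity of a generator. -/
def Gen.parity {r s : ℕ} : Gen r s → ZMod 2
  | .s _ _ => 0
  | .e _ => 0
  | .c _ _ => 1

section Free

variable {r s : ℕ}

/-- The generator `s_i` of the free algebra. -/
def fs (i : ℕ) (h : 1 ≤ i ∧ i < r + s ∧ i ≠ r) : FreeAlgebra ℂ (Gen r s) :=
  FreeAlgebra.ι ℂ (.s i h)

/-- The generator `e_{r,r+1}` of the free algebra. -/
def fe (h : 1 ≤ r ∧ 1 ≤ s) : FreeAlgebra ℂ (Gen r s) := FreeAlgebra.ι ℂ (.e h)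

/-- The generator `c_i` of the free algebra. -/
def fc (i : ℕ) (h : 1 ≤ i ∧ i ≤ r + s) : FreeAlgebra ℂ (Gen r s) := FreeAlgebra.ι ℂ (.c i h)

/-- The defining relations of the walled Brauer–Clifford superalgebra. Here `r - 1` is written as
`i` with `i + 1 = r`. -/
inductive BCRel (r s : ℕ) : FreeAlgebra ℂ (Gen r s) → FreeAlgebra ℂ (Gen r s) → Prop
  | s_sq (i hi) : BCRel r s (fs i hi * fs i hi) 1
  | braid (i hi hi') :
      BCRel r s (fs i hi * fs (i + 1) hi' * fs i hi) (fs (i + 1) hi' * fs i hi * fs (i + 1) hi')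
  | s_comm (i j hi hj) (hij : i + 1 < j ∨ j + 1 < i) :
      BCRel r s (fs i hi * fs j hj) (fs j hj * fs i hi)
  | e_sq (h) : BCRel r s (fe h * fe h) 0
  | e_s_comm (h j hj) (h1 : j + 1 ≠ r) (h2 : j ≠ r + 1) :
      BCRel r s (fe h * fs j hj) (fs j hj * fe h)
  | e_s_e_left (h i hi) (hir : i + 1 = r) : BCRel r s (fe h) (fe h * fs i hi * fe h)
  | e_s_e_right (h hr) : BCRel r s (fe h) (fe h * fs (r + 1) hr * fe h)
  | e_e (h i hi hr) (hir : i + 1 = r) :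
      BCRel r s (fs i hi * fs (r + 1) hr * fe h * fs (r + 1) hr * fs i hi * fe h)
        (fe h * fs i hi * fs (r + 1) hr * fe h * fs (r + 1) hr * fs i hi)
  | c_sq_left (i hi) (hir : i ≤ r) : BCRel r s (fc i hi * fc i hi) (-1)
  | c_sq_right (i hi) (hir : r + 1 ≤ i) : BCRel r s (fc i hi * fc i hi) 1
  | c_anticomm (i j hi hj) (hij : i ≠ j) : BCRel r s (fc i hi * fc j hj) (-(fc j hj * fc i hi))
  | s_c_s (i hi hc hc') : BCRel r s (fs i hi * fc i hc * fs i hi) (fc (i + 1) hc')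
  | s_c_comm (i j hi hj) (h1 : j ≠ i) (h2 : j ≠ i + 1) :
      BCRel r s (fs i hi * fc j hj) (fc j hj * fs i hi)
  | c_e (h h1 h2) : BCRel r s (fc r h1 * fe h) (fc (r + 1) h2 * fe h)
  | e_c (h h1 h2) : BCRel r s (fe h * fc r h1) (fe h * fc (r + 1) h2)
  | e_c_e (h h1) : BCRel r s (fe h * fc r h1 * fe h) 0
  | e_c_comm (h j hj) (h1 : j ≠ r) (h2 : j ≠ r + 1) :
      BCRel r s (fe h * fc j hj) (fc j hj * fe h)

end Free

/-- The walled Brauer–Clifford superalgebra. -/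
def BC (r s : ℕ) : Type := RingQuot (BCRel r s)

namespace BC

variable {r s : ℕ}

noncomputable instance : Ring (BC r s) := inferInstanceAs (Ring (RingQuot (BCRel r s)))

noncomputable instance : Algebra ℂ (BC r s) := inferInstanceAs (Algebra ℂ (RingQuot (BCRel r s)))

variable (r s) in
/-- The quotient map. -/
noncomputable def mk : FreeAlgebra ℂ (Gen r s) →ₐ[ℂ] BC r s := RingQuot.mkAlgHom ℂ (BCRel r s)

theorem mk_rel {x y : FreeAlgebra ℂ (Gen r s)} (h : BCRel r s x y) : mk r s x = mk r s y :=
  RingQuot.mkAlgHom_rel ℂ h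

theorem mk_surjective : Function.Surjective (mk r s) :=
  RingQuot.mkAlgHom_surjective ℂ (BCRel r s)

/-- The universal property of the algebra given by generators and relations. -/
noncomputable def lift {B : Type} [Ring B] [Algebra ℂ B] (f : FreeAlgebra ℂ (Gen r s) →ₐ[ℂ] B)
    (h : ∀ ⦃x y⦄, BCRel r s x y → f x = f y) : BC r s →ₐ[ℂ] B :=
  RingQuot.liftAlgHom ℂ ⟨f, h⟩

theorem lift_mk {B : Type} [Ring B] [Algebra ℂ B] (f : FreeAlgebra ℂ (Gen r s) →ₐ[ℂ] B)
    (h : ∀ ⦃x y⦄, BCRel r s x y → f x = f y) (x : FreeAlgebra ℂ (Gen r s)) :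
    lift f h (mk r s x) = f x :=
  RingQuot.liftAlgHom_mkAlgHom_apply ℂ f h x

/-- The generators, as elements of the walled Brauer–Clifford superalgebra. -/
noncomputable def gen (g : Gen r s) : BC r s := mk r s (FreeAlgebra.ι ℂ g)

variable (r s) in
/-- The homogeneous components of the walled Brauer–Clifford superalgebra: the component of degree
`i` is spanned by the products of generators whose parities add up to `i`. -/
noncomputable def grading (i : ZMod 2) : Submodule ℂ (BC r s) :=
  Submodule.span ℂ {x | ∃ w : List (Gen r s), (w.map Gen.parity).sum = i ∧ (w.map gen).prod = x}

/-- The parity automorphism of the free algebra. -/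
noncomputable def freeSign : FreeAlgebra ℂ (Gen r s) →ₐ[ℂ] FreeAlgebra ℂ (Gen r s) :=
  FreeAlgebra.lift ℂ fun g => (-1 : ℂ) ^ g.parity.val • FreeAlgebra.ι ℂ g

theorem freeSign_s (i h) : freeSign (fs (r := r) (s := s) i h) = fs i h := by
  simp [freeSign, fs, Gen.parity]

theorem freeSign_e (h) : freeSign (fe (r := r) (s := s) h) = fe h := by
  simp [freeSign, fe, Gen.parity]

theorem freeSign_c (i h) : freeSign (fc (r := r) (s := s) i h) = -fc i h := by
  simp [freeSign, fc, Gen.parity, ZMod.val_one]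

/-- The parity automorphism. -/
noncomputable def sign : BC r s →ₐ[ℂ] BC r s :=
  lift ((mk r s).comp freeSign) (by
    intro x y h
    have key := mk_rel h
    cases h <;>
      simp only [AlgHom.comp_apply, map_mul, map_neg, map_one, map_zero, freeSign_s, freeSign_e,
        freeSign_c, mul_neg, neg_mul, neg_neg] at key ⊢ <;>
      first
        | exact key
        | rw [key, neg_zero]
        | rw [key])

theorem sign_gen (g : Gen r s) : sign (gen g) = (-1 : ℂ) ^ g.parity.val • gen g := by
  simp [sign, gen, freeSign, lift_mk]

theorem sign_word (w : List (Gen r s)) :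
    sign (w.map gen).prod = (-1 : ℂ) ^ ((w.map Gen.parity).sum).val • (w.map gen).prod := by
  induction w with
  | nil => simp
  | cons g w ih =>
    simp only [List.map_cons, List.prod_cons, List.sum_cons, map_mul, ih, sign_gen,
      smul_mul_smul_comm, neg_one_pow_val_add]

theorem sign_of_mem {i : ZMod 2} {x : BC r s} (hx : x ∈ grading r s i) :
    sign x = (-1 : ℂ) ^ i.val • x := by
  induction hx using Submodule.span_induction with
  | mem x hx =>
    obtain ⟨w, rfl, rfl⟩ := hx
    exact sign_word w
  | zero => simp
  | add x y _ _ hx hy => rw [map_add, hx, hy, smul_add]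
  | smul a x _ hx => rw [map_smul, hx, smul_comm]

theorem mem_span_words (x : BC r s) :
    x ∈ Submodule.span ℂ {x | ∃ w : List (Gen r s), (w.map gen).prod = x} := by
  obtain ⟨x, rfl⟩ := mk_surjective x
  induction x using FreeAlgebra.induction with
  | grade0 a =>
    rw [AlgHom.commutes, Algebra.algebraMap_eq_smul_one]
    exact Submodule.smul_mem _ _ (Submodule.subset_span ⟨[], rfl⟩)
  | grade1 g => exact Submodule.subset_span ⟨[g], by simp [gen]⟩
  | mul x y hx hy =>
    rw [map_mul]
    have := Submodule.mul_mem_mul hx hy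
    rw [Submodule.span_mul_span] at this
    refine Submodule.span_mono ?_ this
    rintro _ ⟨_, ⟨w, rfl⟩, _, ⟨w', rfl⟩, rfl⟩
    exact ⟨w ++ w', by simp⟩
  | add x y hx hy => rw [map_add]; exact Submodule.add_mem _ hx hy

theorem sign_sign (x : BC r s) : sign (sign x) = x := by
  have hx := mem_span_words x
  induction hx using Submodule.span_induction with
  | mem x hx =>
    obtain ⟨w, rfl⟩ := hx
    rw [sign_word, map_smul, sign_word, smul_smul, ← mul_pow]
    simp
  | zero => simp
  | add x y _ _ hx hy => rw [map_add, map_add, hx, hy]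
  | smul a x _ hx => rw [map_smul, map_smul, hx]

theorem mem_grading_iff (i : ZMod 2) (x : BC r s) :
    x ∈ grading r s i ↔ sign x = (-1 : ℂ) ^ i.val • x := by
  refine ⟨sign_of_mem, fun h => ?_⟩
  have key : ∀ y : BC r s, y + (-1 : ℂ) ^ i.val • sign y ∈ grading r s i := by
    intro y
    have hy := mem_span_words y
    induction hy using Submodule.span_induction with
    | mem y hy =>
      obtain ⟨w, rfl⟩ := hy
      rw [sign_word, smul_smul, ← neg_one_pow_val_add]
      by_cases hw : (w.map Gen.parity).sum = i
      · refine Submodule.add_mem _ ?_ (Submodule.smul_mem _ _ ?_) <;>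
          exact Submodule.subset_span ⟨w, hw, rfl⟩
      · have h1 : i + (w.map Gen.parity).sum = 1 := by
          generalize (w.map Gen.parity).sum = j at hw
          clear h
          revert i j; decide
        rw [h1, ZMod.val_one, pow_one, neg_one_smul, add_neg_cancel]
        exact Submodule.zero_mem _
    | zero => simp
    | add x y _ _ hx hy =>
      have := Submodule.add_mem _ hx hy
      rw [map_add, smul_add]
      rwa [add_add_add_comm] at this
    | smul a x _ hx =>
      have := Submodule.smul_mem _ a hx
      rw [map_smul, smul_comm]
      rwa [smul_add] at this
  have h2 := Submodule.smul_mem _ (1 / 2 : ℂ) (key x)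
  rw [h, smul_smul, ← mul_pow] at h2
  have h3 : (1 / 2 : ℂ) • (x + ((-1 : ℂ) * -1) ^ i.val • x) = x := by
    rw [neg_mul_neg, one_mul, one_pow]; module
  rwa [h3] at h2

/-- The walled Brauer–Clifford superalgebra is a superalgebra. -/
noncomputable instance : GradedAlgebra (grading r s) :=
  gradedOfInvolution sign sign_sign mem_grading_iff

end BC

/-! ### The bead diagram algebra -/

/-- The space with basis the set of `(r, s)`-bead diagrams. -/
def DiagramAlgebra (r s : ℕ) : Type := BeadDiagram r s →₀ ℂ

namespace DiagramAlgebra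

variable {r s : ℕ}

noncomputable instance : AddCommGroup (DiagramAlgebra r s) :=
  inferInstanceAs (AddCommGroup (BeadDiagram r s →₀ ℂ))

noncomputable instance : Module ℂ (DiagramAlgebra r s) :=
  inferInstanceAs (Module ℂ (BeadDiagram r s →₀ ℂ))

/-- A diagram as an element of the algebra. -/
noncomputable def ofDiagram (d : BeadDiagram r s) : DiagramAlgebra r s := Finsupp.single d 1

/-- A diagram, or zero, as an element of the algebra. -/
noncomputable def ofOption : Option (BeadDiagram r s) → DiagramAlgebra r s
  | none => 0
  | some d => ofDiagram d

/-- The linear extension of a function on the set of diagrams. -/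
noncomputable def extend {M : Type} [AddCommGroup M] [Module ℂ M] (f : BeadDiagram r s → M) :
    DiagramAlgebra r s →ₗ[ℂ] M :=
  (Finsupp.linearCombination ℂ f : (BeadDiagram r s →₀ ℂ) →ₗ[ℂ] M)

theorem extend_ofDiagram {M : Type} [AddCommGroup M] [Module ℂ M] (f : BeadDiagram r s → M)
    (d : BeadDiagram r s) : extend f (ofDiagram d) = f d := by
  have := Finsupp.linearCombination_single ℂ (v := f) 1 d
  rw [one_smul] at this
  exact this

theorem hom_ext {M : Type} [AddCommGroup M] [Module ℂ M] {f g : DiagramAlgebra r s →ₗ[ℂ] M}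
    (h : ∀ d, f (ofDiagram d) = g (ofDiagram d)) : f = g :=
  Finsupp.lhom_ext' (M := ℂ) (R := ℂ) (α := BeadDiagram r s) fun d => LinearMap.ext_ring (h d)

/-- The bilinear multiplication that extends the product of diagrams. -/
noncomputable def mulMap : DiagramAlgebra r s →ₗ[ℂ] DiagramAlgebra r s →ₗ[ℂ] DiagramAlgebra r s :=
  extend fun d₁ => extend fun d₂ => ofOption (d₁.comp d₂)

theorem mulMap_ofDiagram (d₁ d₂ : BeadDiagram r s) :
    mulMap (ofDiagram d₁) (ofDiagram d₂) = ofOption (d₁.comp d₂) := by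
  unfold mulMap
  rw [extend_ofDiagram, extend_ofDiagram]

theorem mulMap_ofOption_left (o : Option (BeadDiagram r s)) (d : BeadDiagram r s) :
    mulMap (ofOption o) (ofDiagram d) = ofOption (o.bind fun x => x.comp d) := by
  cases o with
  | none => simp [ofOption]
  | some d' => exact mulMap_ofDiagram d' d

theorem mulMap_ofOption_right (o : Option (BeadDiagram r s)) (d : BeadDiagram r s) :
    mulMap (ofDiagram d) (ofOption o) = ofOption (o.bind fun x => d.comp x) := by
  cases o with
  | none => simp [ofOption]
  | some d' => exact mulMap_ofDiagram d d'

theorem mulMap_assoc (x y z : DiagramAlgebra r s) :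
    mulMap (mulMap x y) z = mulMap x (mulMap y z) := by
  let f : DiagramAlgebra r s →ₗ[ℂ] DiagramAlgebra r s →ₗ[ℂ] DiagramAlgebra r s →ₗ[ℂ]
    DiagramAlgebra r s := mulMap.compr₂ mulMap
  let g : DiagramAlgebra r s →ₗ[ℂ] DiagramAlgebra r s →ₗ[ℂ] DiagramAlgebra r s →ₗ[ℂ]
    DiagramAlgebra r s :=
      ((LinearMap.llcomp ℂ (DiagramAlgebra r s) (DiagramAlgebra r s) (DiagramAlgebra r s)).comp
        mulMap).compl₂ mulMap
  have hfg : f = g := by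
    refine hom_ext fun a => hom_ext fun b => hom_ext fun c => ?_
    change mulMap (mulMap _ _) _ = mulMap _ (mulMap _ _)
    rw [mulMap_ofDiagram, mulMap_ofDiagram, mulMap_ofOption_left, mulMap_ofOption_right,
      BeadDiagram.comp_assoc]
  exact congrArg (fun k => k x y z) hfg

theorem one_mulMap (x : DiagramAlgebra r s) : mulMap (ofDiagram (BeadDiagram.one r s)) x = x := by
  have : mulMap (ofDiagram (BeadDiagram.one r s)) = LinearMap.id := hom_ext fun d => by
    rw [mulMap_ofDiagram, BeadDiagram.one_comp]; rfl
  rw [this]; rfl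

theorem mulMap_one (x : DiagramAlgebra r s) : mulMap x (ofDiagram (BeadDiagram.one r s)) = x := by
  have : mulMap.flip (ofDiagram (BeadDiagram.one r s)) = LinearMap.id := hom_ext fun d => by
    rw [LinearMap.flip_apply, mulMap_ofDiagram, BeadDiagram.comp_one]; rfl
  exact congrArg (fun k => k x) this

noncomputable instance : Ring (DiagramAlgebra r s) where
  __ := (inferInstance : AddCommGroup (DiagramAlgebra r s))
  mul x y := mulMap x y
  one := ofDiagram (BeadDiagram.one r s)
  mul_assoc := mulMap_assoc
  one_mul := one_mulMap
  mul_one := mulMap_one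
  left_distrib x y z := map_add (mulMap x) y z
  right_distrib x y z := by
    change mulMap (x + y) z = mulMap x z + mulMap y z
    rw [map_add]; rfl
  zero_mul x := by
    change mulMap 0 x = 0
    rw [map_zero]; rfl
  mul_zero x := map_zero (mulMap x)

noncomputable instance : Algebra ℂ (DiagramAlgebra r s) :=
  Algebra.ofModule
    (fun a x y => by
      change mulMap (a • x) y = a • mulMap x y
      rw [map_smul]; rfl)
    (fun a x y => map_smul (mulMap x) a y)

theorem ofDiagram_mul (d₁ d₂ : BeadDiagram r s) :
    ofDiagram d₁ * ofDiagram d₂ = ofOption (d₁.comp d₂) := mulMap_ofDiagram d₁ d₂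

variable (r s) in
/-- The homogeneous components: the component of degree `i` is spanned by the diagrams whose number
of beads is congruent to `i` modulo `2`. -/
noncomputable def grading (i : ZMod 2) : Submodule ℂ (DiagramAlgebra r s) :=
  Submodule.span ℂ {x | ∃ d : BeadDiagram r s, (d.num : ZMod 2) = i ∧ ofDiagram d = x}

/-- The parity automorphism, as a linear map. -/
noncomputable def signLin : DiagramAlgebra r s →ₗ[ℂ] DiagramAlgebra r s :=
  extend fun d => (-1 : ℂ) ^ d.num • ofDiagram d

theorem signLin_ofDiagram (d : BeadDiagram r s) :
    signLin (ofDiagram d) = (-1 : ℂ) ^ d.num • ofDiagram d := extend_ofDiagram _ d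

/-- The parity automorphism. -/
noncomputable def sign : DiagramAlgebra r s →ₐ[ℂ] DiagramAlgebra r s :=
  AlgHom.ofLinearMap signLin
    (by
      change signLin (ofDiagram (BeadDiagram.one r s)) = ofDiagram (BeadDiagram.one r s)
      rw [signLin_ofDiagram]
      simp [BeadDiagram.one])
    (by
      intro x y
      have : (mulMap (r := r) (s := s)).compr₂ signLin = mulMap.compl₁₂ signLin signLin := by
        refine hom_ext fun a => hom_ext fun b => ?_
        rw [LinearMap.compr₂_apply, LinearMap.compl₁₂_apply, signLin_ofDiagram, signLin_ofDiagram,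
          map_smul, map_smul, LinearMap.smul_apply, mulMap_ofDiagram]
        cases h : a.comp b with
        | none => simp [ofOption]
        | some d =>
          change signLin (ofDiagram d) = _ • _ • ofDiagram d
          rw [signLin_ofDiagram, (BeadDiagram.comp_eq_some_iff.1 h).2.2, smul_smul, pow_add, mul_comm]
      exact congrArg (fun k => k x y) this)

theorem sign_ofDiagram (d : BeadDiagram r s) :
    sign (ofDiagram d) = (-1 : ℂ) ^ d.num • ofDiagram d := signLin_ofDiagram d

theorem sign_sign (x : DiagramAlgebra r s) : sign (sign x) = x := by
  have : (sign.comp sign).toLinearMap = (AlgHom.id ℂ (DiagramAlgebra r s)).toLinearMap := by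
    refine hom_ext fun d => ?_
    change sign (sign (ofDiagram d)) = ofDiagram d
    rw [sign_ofDiagram, map_smul, sign_ofDiagram, smul_smul, ← mul_pow]
    simp
  exact congrArg (fun k => k x) this

theorem neg_one_pow_cast (n : ℕ) : (-1 : ℂ) ^ (n : ZMod 2).val = (-1 : ℂ) ^ n := by
  rw [ZMod.val_natCast, ← neg_one_pow_eq_pow_mod_two]

theorem mem_grading_iff (i : ZMod 2) (x : DiagramAlgebra r s) :
    x ∈ grading r s i ↔ sign x = (-1 : ℂ) ^ i.val • x := by
  constructor
  · intro hx
    induction hx using Submodule.span_induction with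
    | mem x hx =>
      obtain ⟨d, rfl, rfl⟩ := hx
      rw [sign_ofDiagram, neg_one_pow_cast]
    | zero => simp
    | add x y _ _ hx hy => rw [map_add, hx, hy, smul_add]
    | smul a x _ hx => rw [map_smul, hx, smul_comm]
  · intro h
    let p : DiagramAlgebra r s →ₗ[ℂ] DiagramAlgebra r s :=
      LinearMap.id + (-1 : ℂ) ^ i.val • signLin
    have key : ∀ y, p y ∈ grading r s i := by
      have : (grading r s i).mkQ ∘ₗ p = 0 := by
        refine hom_ext fun d => ?_
        rw [LinearMap.comp_apply, LinearMap.zero_apply, Submodule.mkQ_apply,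
          Submodule.Quotient.mk_eq_zero]
        change ofDiagram d + (-1 : ℂ) ^ i.val • signLin (ofDiagram d) ∈ _
        rw [signLin_ofDiagram, smul_smul, ← neg_one_pow_cast d.num, ← neg_one_pow_val_add]
        by_cases hd : (d.num : ZMod 2) = i
        · refine Submodule.add_mem _ ?_ (Submodule.smul_mem _ _ ?_) <;>
            exact Submodule.subset_span ⟨d, hd, rfl⟩
        · have h1 : i + (d.num : ZMod 2) = 1 := by
            generalize (d.num : ZMod 2) = j at hd
            clear h p
            revert i j; decide
          rw [h1, ZMod.val_one, pow_one, neg_one_smul, add_neg_cancel]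
          exact Submodule.zero_mem _
      intro y
      rw [← Submodule.Quotient.mk_eq_zero, ← Submodule.mkQ_apply]
      exact congrArg (fun k => k y) this
    have h2 := Submodule.smul_mem _ (1 / 2 : ℂ) (key x)
    have h3 : (1 / 2 : ℂ) • p x = x := by
      change (1 / 2 : ℂ) • (x + (-1 : ℂ) ^ i.val • sign x) = x
      rw [h, smul_smul, ← mul_pow, neg_mul_neg, one_mul, one_pow]; module
    rwa [h3] at h2

noncomputable instance : GradedAlgebra (grading r s) :=
  gradedOfInvolution sign sign_sign mem_grading_iff

end DiagramAlgebra

namespace Gen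

variable {r s : ℕ}

/-- The diagrams that correspond to the generators. -/
def diagram : Gen r s → BeadDiagram r s
  | .s i h => BeadDiagram.crossing i h
  | .e h => BeadDiagram.cupCap h
  | .c i h => BeadDiagram.bead i h

end Gen

/-- The subalgebra generated by the crossings, the cup-cap diagram and the one-bead diagrams. -/
noncomputable def BDSub (r s : ℕ) : Subalgebra ℂ (DiagramAlgebra r s) :=
  Algebra.adjoin ℂ (Set.range fun g : Gen r s => DiagramAlgebra.ofDiagram g.diagram)

namespace BDSub

variable {r s : ℕ}

/-- The generators of the subalgebra. -/
noncomputable def gen (g : Gen r s) : BDSub r s :=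
  ⟨DiagramAlgebra.ofDiagram g.diagram, Algebra.subset_adjoin ⟨g, rfl⟩⟩

/-- The diagram `c_i`, as an element of the subalgebra. -/
noncomputable def c (i : ℕ) (hi : 1 ≤ i ∧ i ≤ r + s) : BDSub r s := gen (.c i hi)

variable (r s) in
/-- The Clifford relations. -/
inductive CliffordElement : BDSub r s → Prop
  | sq_left (k hk) (hkr : k ≤ r) : CliffordElement (c k hk ^ 2 + 1)
  | sq_right (l hl) (hlr : r + 1 ≤ l) : CliffordElement (c l hl ^ 2 - 1)
  | anticomm (i j hi hj) (hij : i ≠ j) : CliffordElement (c i hi * c j hj + c j hj * c i hi)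

variable (r s) in
/-- The two-sided ideal generated by the Clifford relations. -/
noncomputable def cliffordIdeal : TwoSidedIdeal (BDSub r s) :=
  TwoSidedIdeal.span {x | CliffordElement r s x}

/-- The parity automorphism. -/
noncomputable def sign : BDSub r s →ₐ[ℂ] BDSub r s :=
  (DiagramAlgebra.sign.comp (BDSub r s).val).codRestrict (BDSub r s) (by
    intro x
    have h : (BDSub r s).map DiagramAlgebra.sign ≤ BDSub r s := by
      unfold BDSub
      rw [AlgHom.map_adjoin, Algebra.adjoin_le_iff]
      rintro _ ⟨_, ⟨g, rfl⟩, rfl⟩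
      simp only [SetLike.mem_coe]
      rw [DiagramAlgebra.sign_ofDiagram]
      exact Subalgebra.smul_mem _ (Algebra.subset_adjoin (Set.mem_range_self g)) _
    exact h (Subalgebra.mem_map.2 ⟨x, x.2, rfl⟩))

theorem coe_sign (x : BDSub r s) : (sign x : DiagramAlgebra r s) = DiagramAlgebra.sign x := rfl

theorem sign_sign (x : BDSub r s) : sign (sign x) = x :=
  Subtype.ext (by rw [coe_sign, coe_sign, DiagramAlgebra.sign_sign])

theorem sign_c (i hi) : sign (c (r := r) (s := s) i hi) = -c i hi := by
  apply Subtype.ext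
  change DiagramAlgebra.sign (DiagramAlgebra.ofDiagram (BeadDiagram.bead i hi)) =
    -DiagramAlgebra.ofDiagram (BeadDiagram.bead i hi)
  rw [DiagramAlgebra.sign_ofDiagram]
  simp [BeadDiagram.bead]

theorem sign_clifford {x : BDSub r s} (hx : CliffordElement r s x) : sign x = x := by
  cases hx <;> simp [sign_c]

end BDSub

/-- The `(r, s)`-bead diagram algebra. -/
def BD (r s : ℕ) : Type := (BDSub.cliffordIdeal r s).ringCon.Quotient

namespace BD

variable {r s : ℕ}

noncomputable instance : Ring (BD r s) :=
  inferInstanceAs (Ring (BDSub.cliffordIdeal r s).ringCon.Quotient)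

noncomputable instance : Algebra ℂ (BD r s) :=
  inferInstanceAs (Algebra ℂ (BDSub.cliffordIdeal r s).ringCon.Quotient)

variable (r s) in
/-- The quotient map. -/
noncomputable def mk : BDSub r s →ₐ[ℂ] BD r s :=
  { (BDSub.cliffordIdeal r s).ringCon.mk' with commutes' := fun _ => rfl }

theorem mk_surjective : Function.Surjective (mk r s) := Quotient.mk_surjective

variable (r s) in
/-- The homogeneous components: the component of degree `i` consists of the classes of those
elements of the subalgebra that are combinations of diagrams whose number of beads is congruent to
`i` modulo `2`. -/
noncomputable def grading (i : ZMod 2) : Submodule ℂ (BD r s) :=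
  ((DiagramAlgebra.grading r s i).comap (BDSub r s).val.toLinearMap).map (mk r s).toLinearMap

theorem mk_eq_iff (x y : BDSub r s) : mk r s x = mk r s y ↔ x - y ∈ BDSub.cliffordIdeal r s := by
  rw [← TwoSidedIdeal.rel_iff]
  exact RingCon.eq _

theorem sign_mem {x : BDSub r s} (hx : x ∈ BDSub.cliffordIdeal r s) :
    BDSub.sign x ∈ BDSub.cliffordIdeal r s := by
  have h : BDSub.cliffordIdeal r s ≤ (BDSub.cliffordIdeal r s).comap BDSub.sign := by
    unfold BDSub.cliffordIdeal
    rw [TwoSidedIdeal.span_le]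
    intro y hy
    rw [SetLike.mem_coe, TwoSidedIdeal.mem_comap, BDSub.sign_clifford hy]
    exact TwoSidedIdeal.subset_span hy
  exact (TwoSidedIdeal.mem_comap _).1 (h hx)

/-- The parity automorphism. -/
noncomputable def sign : BD r s →ₐ[ℂ] BD r s :=
  { (BDSub.cliffordIdeal r s).ringCon.lift ((mk r s).comp BDSub.sign).toRingHom (by
      intro x y h
      rw [TwoSidedIdeal.rel_iff] at h
      change mk r s (BDSub.sign x) = mk r s (BDSub.sign y)
      rw [mk_eq_iff, ← map_sub]
      exact sign_mem h) with
    commutes' := fun a => by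
      change mk r s (BDSub.sign (algebraMap ℂ _ a)) = _
      rw [AlgHom.commutes, AlgHom.commutes] }

theorem sign_mk (x : BDSub r s) : sign (mk r s x) = mk r s (BDSub.sign x) := rfl

theorem sign_sign (x : BD r s) : sign (sign x) = x := by
  obtain ⟨x, rfl⟩ := mk_surjective x
  rw [sign_mk, sign_mk, BDSub.sign_sign]

theorem mem_grading_iff (i : ZMod 2) (x : BD r s) :
    x ∈ grading r s i ↔ sign x = (-1 : ℂ) ^ i.val • x := by
  constructor
  · rintro ⟨y, hy, rfl⟩
    have h := (DiagramAlgebra.mem_grading_iff i (y : DiagramAlgebra r s)).1 hy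
    have h' : BDSub.sign y = (-1 : ℂ) ^ i.val • y := Subtype.ext h
    change sign (mk r s y) = _ • mk r s y
    rw [sign_mk, h', map_smul]
  · intro h
    obtain ⟨y, rfl⟩ := mk_surjective x
    refine ⟨(1 / 2 : ℂ) • (y + (-1 : ℂ) ^ i.val • BDSub.sign y), ?_, ?_⟩
    · refine (DiagramAlgebra.mem_grading_iff i _).2 ?_
      have : BDSub.sign ((1 / 2 : ℂ) • (y + (-1 : ℂ) ^ i.val • BDSub.sign y)) =
          (-1 : ℂ) ^ i.val • ((1 / 2 : ℂ) • (y + (-1 : ℂ) ^ i.val • BDSub.sign y)) := by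
        rw [map_smul, map_add, map_smul, BDSub.sign_sign, smul_comm ((-1 : ℂ) ^ i.val) (1 / 2 : ℂ),
          smul_add ((-1 : ℂ) ^ i.val), smul_smul ((-1 : ℂ) ^ i.val), ← mul_pow,
          neg_mul_neg, one_mul, one_pow, one_smul, add_comm]
      exact congrArg Subtype.val this
    · change mk r s _ = mk r s y
      rw [map_smul, map_add, map_smul, ← sign_mk, h, smul_smul, ← mul_pow, neg_mul_neg, one_mul,
        one_pow]
      module

/-- The bead diagram algebra is a superalgebra. -/
noncomputable instance : GradedAlgebra (grading r s) :=
  gradedOfInvolution sign sign_sign mem_grading_iff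

end BD

end WalledBrauerClifford

/-! The map sends every generator to its diagram. All relations except the Clifford ones hold
between the diagrams themselves, and the Clifford ones hold modulo the ideal `L`, so a homomorphism
exists (`BD.freeMap_rel`). It is onto because these diagrams generate. It intertwines the parity
automorphisms, whose eigenspaces are the homogeneous components; once it is bijective, it therefore
matches the gradings. What needs work is injectivity, and it comes from two independent
constructions.

On the diagram side, forget everything about a diagram except its shape: the connections and the
parity of the number of beads on each strand. Orient the strands so that vertical ones point upwards
on the left of the wall and downwards on its right, and horizontal ones run from left to right in
the bottom row and from right to left in the top row; these orientations fit together under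
concatenation. Reading the bead numbers along all strands gives a word. Send the diagram to its
shape, multiplied by the inversion sign of the word and by `I` to the number of beads. Exchanging
two consecutive numbers reverses the sign. Two neighbouring beads on a strand contribute `I ^ 2 =
-1`, and their mutual order contributes 1 on the left of the wall, where they are read in increasing
order, and -1 on the right, where they are read in decreasing order. So all Clifford elements are
killed, even between arbitrary factors (`DiagramAlgebra.shapeMap_clifford`), and a linear map from
`BD` to combinations of shapes results.

On the algebra side, work up to sign. In the monoid with zero `SignQuot` the Clifford generators are
commuting involutions. The Coxeter presentation (`Coxeter.exists_hom`) gives permutations of both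
sides, and the conjugates of `e` under them are arcs between arbitrary strands; together they form
an `ArcSystem`. Every word in the generators is zero or has the form permutation, beads, disjoint
arcs, beads (`SignQuot.isNormal_word`). The ambiguity of this form is controlled by
`ArcSystem.normalForm_eq`, and the data that matter can be read off from the shape of the
corresponding diagram (`SignQuot.Describes.normalForm_eq`).

Hence a nonzero word of `BC` is sent to a nonzero multiple of a single shape, and two such words
with the same shape agree up to sign, the sign being visible in the coefficient. So words can be
recovered linearly from their images (`SignQuot.exists_basis_vector`), which gives a left inverse
without a dimension count or a proof that normal forms are independent. -/

namespace WalledBrauerClifford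

/-! ### The inversion sign of a list -/

/-- The sign that an unordered pair contributes. -/
def pairSign (a b : ℕ) : ℂ := if b < a then -1 else 1

/-- The inversion sign of a list of numbers. -/
def inversionSign : List ℕ → ℂ
  | [] => 1
  | a :: l => (l.map (pairSign a)).prod * inversionSign l

theorem pairSign_ne_zero (a b : ℕ) : pairSign a b ≠ 0 := by
  unfold pairSign; split_ifs <;> simp

theorem pairSign_mul_self (a b : ℕ) : pairSign a b * pairSign a b = 1 := by
  unfold pairSign; split_ifs <;> simp

theorem inversionSign_ne_zero (l : List ℕ) : inversionSign l ≠ 0 := by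
  induction l with
  | nil => simp [inversionSign]
  | cons a l ih =>
    refine mul_ne_zero (List.prod_ne_zero ?_) ih
    simp [pairSign_ne_zero]

/-- No number lies strictly between `n` and `n + 1`, so exchanging them can only affect the
comparison of these two with each other. -/
theorem pairSign_swap {n a b : ℕ} (h : ¬ (a = n ∧ b = n + 1)) (h' : ¬ (a = n + 1 ∧ b = n)) :
    pairSign (Equiv.swap n (n + 1) a) (Equiv.swap n (n + 1) b) = pairSign a b := by
  unfold pairSign
  have : Equiv.swap n (n + 1) b < Equiv.swap n (n + 1) a ↔ b < a := by
    simp only [Equiv.swap_apply_def]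
    split_ifs <;> lia
  simp only [this]

theorem prod_pairSign_swap {n a : ℕ} {l : List ℕ} (h : ∀ b ∈ l, ¬ (a = n ∧ b = n + 1))
    (h' : ∀ b ∈ l, ¬ (a = n + 1 ∧ b = n)) :
    ((l.map (Equiv.swap n (n + 1))).map (pairSign (Equiv.swap n (n + 1) a))).prod =
      (l.map (pairSign a)).prod := by
  rw [List.map_map]
  congr 1
  exact List.map_congr_left fun b hb => pairSign_swap (h b hb) (h' b hb)

theorem inversionSign_map_swap_of_not_mem {n : ℕ} {l : List ℕ} (h : n ∉ l ∨ n + 1 ∉ l) :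
    inversionSign (l.map (Equiv.swap n (n + 1))) = inversionSign l := by
  induction l with
  | nil => rfl
  | cons a l ih =>
    simp only [List.mem_cons, not_or] at h
    rw [List.map_cons, inversionSign, inversionSign, ih (h.imp And.right And.right),
      prod_pairSign_swap] <;>
      · rintro b hb ⟨rfl, rfl⟩
        tauto

/-- This is the case of `inversionSign_map_swap` in which the head of the list is one of the two
exchanged numbers. The head is replaced by its partner, and the only comparison that changes is the
one with the partner inside `l`. -/
theorem prod_pairSign_swap_neg {n : ℕ} {l : List ℕ} (hl : l.Nodup) :
    (n + 1 ∈ l → n ∉ l → ((l.map (Equiv.swap n (n + 1))).map (pairSign (n + 1))).prod =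
      -(l.map (pairSign n)).prod) ∧
    (n ∈ l → n + 1 ∉ l → ((l.map (Equiv.swap n (n + 1))).map (pairSign n)).prod =
      -(l.map (pairSign (n + 1))).prod) := by
  induction l with
  | nil => simp
  | cons a l ih =>
    rw [List.nodup_cons] at hl
    have h1 := ih hl.2
    have e1 := Equiv.swap_apply_left n (n + 1)
    have e2 := Equiv.swap_apply_right n (n + 1)
    constructor
    · intro h h'
      simp only [List.map_cons, List.prod_cons, List.mem_cons, not_or] at *
      rcases eq_or_ne (n + 1) a with rfl | ha
      · have := prod_pairSign_swap (n := n) (a := n) (l := l) (by rintro b hb ⟨-, rfl⟩; tauto)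
          (by rintro b hb ⟨h, -⟩; lia)
        rw [e1] at this
        rw [this, e2]
        simp [pairSign]
      · rw [h1.1 (by tauto) h'.2]
        have := pairSign_swap (n := n) (a := n) (b := a) (by lia) (by lia)
        rw [e1] at this
        rw [this, mul_neg]
    · intro h h'
      simp only [List.map_cons, List.prod_cons, List.mem_cons, not_or] at *
      rcases eq_or_ne n a with rfl | ha
      · have := prod_pairSign_swap (n := n) (a := n + 1) (l := l) (by rintro b hb ⟨h, -⟩; lia)
          (by rintro b hb ⟨-, rfl⟩; tauto)
        rw [e2] at this
        rw [this, e1]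
        simp [pairSign]
      · rw [h1.2 (by tauto) h'.2]
        have := pairSign_swap (n := n) (a := n + 1) (b := a) (by lia) (by lia)
        rw [e2] at this
        rw [this, mul_neg]

/-- Exchanging two consecutive numbers changes the sign. -/
theorem inversionSign_map_swap {n : ℕ} {l : List ℕ} (hl : l.Nodup) (h : n ∈ l) (h' : n + 1 ∈ l) :
    inversionSign (l.map (Equiv.swap n (n + 1))) = -inversionSign l := by
  induction l with
  | nil => simp at h
  | cons a l ih =>
    rw [List.nodup_cons] at hl
    have e1 := Equiv.swap_apply_left n (n + 1)
    have e2 := Equiv.swap_apply_right n (n + 1)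
    rw [List.map_cons, inversionSign, inversionSign]
    rw [List.mem_cons] at h h'
    rcases eq_or_ne n a with rfl | ha
    · rw [inversionSign_map_swap_of_not_mem (.inl hl.1), e1,
        (prod_pairSign_swap_neg hl.2).1 (h'.resolve_left (by lia)) hl.1, neg_mul]
    · rcases eq_or_ne (n + 1) a with rfl | ha'
      · rw [inversionSign_map_swap_of_not_mem (.inr hl.1), e2,
          (prod_pairSign_swap_neg hl.2).2 (h.resolve_left ha) hl.1, neg_mul]
      · rw [ih hl.2 (h.resolve_left ha) (h'.resolve_left ha'), prod_pairSign_swap, mul_neg] <;>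
          · rintro b - ⟨h, -⟩; lia

/-! ### Doubling and erasing a letter of a word -/

/-- Remove the number `n` and close the gap between the numbers below `n` and those above `n`. -/
def eraseNum (n k : ℕ) : List ℕ := if k = n then [] else if k < n then [k] else [k - 1]

/-- Replace the number `n` by `n`, `n + 1`, and shift the numbers above `n`. -/
def doubleNum (n k : ℕ) : List ℕ := if k = n then [n, n + 1] else if k < n then [k] else [k + 1]

/-- Replace the number `n` by `n + 1`, `n`, and shift the numbers above `n`. -/
def doubleNumRev (n k : ℕ) : List ℕ :=
  if k = n then [n + 1, n] else if k < n then [k] else [k + 1]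

/-- A number `a ≠ n` compares in the same way with both members of the inserted pair, so the pair
contributes a square, that is 1, as if it were absent. Here `a'` and `a''` are what becomes of `a`
after doubling and after erasing `n`. -/
theorem prod_pairSign_flatMap {n a a' a'' : ℕ} (h : a < n ∧ a' = a ∧ a'' = a ∨
    n < a ∧ a' = a + 1 ∧ a'' = a - 1) (l : List ℕ) :
    ((l.flatMap (doubleNum n)).map (pairSign a')).prod =
      ((l.flatMap (eraseNum n)).map (pairSign a'')).prod ∧
    ((l.flatMap (doubleNumRev n)).map (pairSign a')).prod =
      ((l.flatMap (eraseNum n)).map (pairSign a'')).prod := by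
  induction l with
  | nil => simp
  | cons b l ih =>
    simp only [List.flatMap_cons, List.map_append, List.prod_append]
    rw [ih.1, ih.2]
    constructor <;> congr 1 <;>
      simp only [doubleNum, doubleNumRev, eraseNum] <;> split_ifs <;>
      simp [pairSign] <;> split_ifs <;> first | lia | simp

/-- After doubling, the letters other than the inserted pair avoid both `n` and `n + 1`, so they
cannot tell these two numbers apart. -/
theorem prod_pairSign_succ {n : ℕ} {l : List ℕ} (h : n ∉ l) :
    ((l.flatMap (doubleNum n)).map (pairSign n)).prod =
      ((l.flatMap (doubleNum n)).map (pairSign (n + 1))).prod ∧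
    l.flatMap (doubleNumRev n) = l.flatMap (doubleNum n) := by
  induction l with
  | nil => simp
  | cons b l ih =>
    rw [List.mem_cons, not_or] at h
    simp only [List.flatMap_cons, List.map_append, List.prod_append]
    rw [(ih h.2).1, (ih h.2).2]
    constructor <;> congr 1 <;> unfold doubleNum <;> try unfold doubleNumRev
    all_goals
      rw [if_neg (Ne.symm h.1)]
    · unfold pairSign; split_ifs <;> simp <;> split_ifs <;> lia
    · rw [if_neg (Ne.symm h.1)]

/-- This is the sign in the squares of the Clifford generators. A pair of neighbouring letters with
consecutive numbers has no net effect on the other letters; only its internal order counts, which is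
no inversion for `doubleNum` and one for `doubleNumRev`. -/
theorem inversionSign_flatMap {n : ℕ} {l : List ℕ} (hl : l.Nodup) :
    inversionSign (l.flatMap (doubleNum n)) = inversionSign (l.flatMap (eraseNum n)) ∧
    inversionSign (l.flatMap (doubleNumRev n)) =
      if n ∈ l then -inversionSign (l.flatMap (eraseNum n))
      else inversionSign (l.flatMap (eraseNum n)) := by
  induction l with
  | nil => simp
  | cons a l ih =>
    rw [List.nodup_cons] at hl
    obtain ⟨ih1, ih2⟩ := ih hl.2
    rcases lt_trichotomy a n with ha | rfl | ha
    · have := prod_pairSign_flatMap (.inl ⟨ha, rfl, rfl⟩) l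
      have hd : doubleNum n a = [a] := by simp [doubleNum, ha, ha.ne]
      have hd' : doubleNumRev n a = [a] := by simp [doubleNumRev, ha, ha.ne]
      have he : eraseNum n a = [a] := by simp [eraseNum, ha, ha.ne]
      simp only [List.flatMap_cons, hd, hd', he, List.cons_append, List.nil_append, inversionSign,
        this.1, this.2, ih1, ih2, List.mem_cons, ha.ne', false_or, true_and]
      split_ifs <;> simp
    · have hp := prod_pairSign_succ hl.1
      have hd : doubleNum a a = [a, a + 1] := by simp [doubleNum]
      have hd' : doubleNumRev a a = [a + 1, a] := by simp [doubleNumRev]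
      have he : eraseNum a a = [] := by simp [eraseNum]
      -- Both members of the pair contribute the same product against the tail, so together they
      -- contribute its square.
      have hs : ((l.flatMap (doubleNum a)).map (pairSign (a + 1))).prod *
          ((l.flatMap (doubleNum a)).map (pairSign (a + 1))).prod = 1 := by
        rw [← List.prod_map_mul]
        simp [pairSign_mul_self]
      have p1 : pairSign a (a + 1) = 1 := by simp [pairSign]
      have p2 : pairSign (a + 1) a = -1 := by simp [pairSign]
      simp only [List.flatMap_cons, hd, hd', he, List.cons_append, List.nil_append, inversionSign,
        List.map_cons, List.prod_cons, hp.1, hp.2, List.mem_cons, true_or, if_true, p1, p2, ← ih1]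
      constructor
      · linear_combination inversionSign (l.flatMap (doubleNum a)) * hs
      · linear_combination -inversionSign (l.flatMap (doubleNum a)) * hs
    · have := prod_pairSign_flatMap (.inr ⟨ha, rfl, rfl⟩) l
      have hd : doubleNum n a = [a + 1] := by simp [doubleNum, ha.not_gt, ha.ne']
      have hd' : doubleNumRev n a = [a + 1] := by simp [doubleNumRev, ha.not_gt, ha.ne']
      have he : eraseNum n a = [a - 1] := by simp [eraseNum, ha.not_gt, ha.ne']
      simp only [List.flatMap_cons, hd, hd', he, List.cons_append, List.nil_append, inversionSign,
        this.1, this.2, ih1, ih2, List.mem_cons, ha.ne, false_or, true_and]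
      split_ifs <;> simp

/-- It will be applied to doubling against erasing: a letter is replaced by two letters or by none,
or else by one letter in both cases, so the parities of bead numbers agree. -/
theorem length_flatMap_cast {g h : ℕ → List ℕ}
    (hgh : ∀ k, ((g k).length : ZMod 2) = (h k).length) (l : List ℕ) :
    ((l.flatMap g).length : ZMod 2) = (l.flatMap h).length := by
  induction l with
  | nil => rfl
  | cons a l ih => simp only [List.flatMap_cons, List.length_append, Nat.cast_add, ih, hgh]

theorem length_doubleNum_cast (n k : ℕ) :
    ((doubleNum n k).length : ZMod 2) = (eraseNum n k).length := by
  unfold doubleNum eraseNum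
  split_ifs <;> simp
  rfl

theorem length_doubleNumRev_cast (n k : ℕ) :
    ((doubleNumRev n k).length : ZMod 2) = (eraseNum n k).length := by
  unfold doubleNumRev eraseNum
  split_ifs <;> simp
  rfl

end WalledBrauerClifford

/-! ### Reading words, shapes and substitution of beads -/

namespace WalledBrauerClifford

namespace Net

variable {X : Type}

/-- Two systems with the same strands and gluings; the bead words of `N` arise from those of `M` by
substitution, at least along the strands that are walked in the positive direction. -/
theorem Trace.substitute {M N : Net X} (g : ℕ → List ℕ) (hm : N.mate = M.mate)
    (hg : N.glue = M.glue) (hw : ∀ x, M.orient x = true → N.word x = (M.word x).flatMap g)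
    {x z : X} {l : List ℕ} (h : M.Trace x z l) (hx : M.orient x = true) :
    N.Trace x z (l.flatMap g) := by
  induction h with
  | exit x h =>
    have := Trace.exit (N := N) x (by rw [hm, hg, h])
    rwa [hm, hw x hx] at this
  | step x y z l hs t ih =>
    -- A walk that starts positively stays positive. This matters because a substitution such as `n
    -- ↦ [n, n + 1]` does not commute with reversal, so it is only available in one direction of
    -- each strand.
    have hy : M.orient y = true := by
      rw [M.orient_glue _ _ hs, M.orient_mate, hx]; rfl
    have := Trace.step (N := N) x y z _ (by unfold Step at hs ⊢; rw [hm, hg, hs]) (ih hy)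
    rwa [hw x hx, ← List.flatMap_append] at this

theorem hasLoop_congr {M N : Net X} (hm : N.mate = M.mate) (hg : N.glue = M.glue) :
    N.HasLoop ↔ M.HasLoop := by
  have : N.Step = M.Step := by
    funext x y
    unfold Step
    rw [hm, hg]
  unfold HasLoop
  rw [this]

end Net

namespace BeadDiagram

variable {r s : ℕ}

variable (r s) in
/-- The vertices at which the positively oriented strands start. -/
noncomputable def starts : List (Vertex r s) :=
  (Set.toFinite {v : Vertex r s | vertexOrient v = true}).toFinset.toList

theorem mem_starts {v : Vertex r s} : v ∈ starts r s ↔ vertexOrient v = true := by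
  simp [starts]

/-- The numbers of all beads, strand by strand. -/
noncomputable def readingWord (d : BeadDiagram r s) : List ℕ := (starts r s).flatMap d.beads

theorem readingWord_nodup (d : BeadDiagram r s) : d.readingWord.Nodup := by
  unfold readingWord
  rw [List.nodup_flatMap]
  refine ⟨fun v _ => d.beads_nodup v, ?_⟩
  have hn : (starts r s).Nodup := Finset.nodup_toList _
  refine hn.pairwise_of_forall_ne ?_
  intro v hv w hw hne k hk hk'
  rcases d.beads_unique v w k hk hk' with h | h
  · exact hne h.symm
  -- The two ends of a strand have opposite orientations, so each strand is listed once.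
  · rw [mem_starts] at hv hw
    rw [h, vertexOrient_mate, hv] at hw
    simp at hw

theorem mem_readingWord (d : BeadDiagram r s) (k : ℕ) :
    k ∈ d.readingWord ↔ 1 ≤ k ∧ k ≤ d.num := by
  unfold readingWord
  rw [List.mem_flatMap, ← d.mem_beads]
  constructor
  · rintro ⟨v, -, h⟩
    exact ⟨v, h⟩
  · rintro ⟨v, h⟩
    by_cases hv : vertexOrient v = true
    · exact ⟨v, mem_starts.2 hv, h⟩
    · refine ⟨d.mate v, mem_starts.2 ?_, by rw [d.beads_mate]; simpa using h⟩
      rw [vertexOrient_mate]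
      simpa using hv

variable (r s) in
/-- The data that remain when beads are counted modulo two. -/
abbrev Shape : Type := (Vertex r s → Vertex r s) × (Vertex r s → ZMod 2)

/-- The connections, and the parities of the numbers of beads on the strands. -/
def shape (d : BeadDiagram r s) : Shape r s := (d.mate, fun v => (d.beads v).length)

/-- The coefficient of the shape of a diagram. -/
noncomputable def coeff (d : BeadDiagram r s) : ℂ :=
  inversionSign d.readingWord * Complex.I ^ d.num

theorem coeff_ne_zero (d : BeadDiagram r s) : d.coeff ≠ 0 :=
  mul_ne_zero (inversionSign_ne_zero _) (pow_ne_zero _ Complex.I_ne_zero)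

theorem IsTriple.total {d₁ d₂ d₃ d : BeadDiagram r s} (h : IsTriple d₁ d₂ d₃ d) :
    ¬ (stack₃ true true d₁ d₂ d₃).HasLoop := (Net.hasLoop_iff _).2 h.1

theorem exists_triple {d₁ d₂ d₃ : BeadDiagram r s}
    (h : ¬ (stack₃ true true d₁ d₂ d₃).HasLoop) : ∃ d, IsTriple d₁ d₂ d₃ d := by
  have h0 := (Net.hasLoop_iff _).1 h
  obtain ⟨d₁₂, h1⟩ := exists_comp (Net.total_of_map lower₂ (lower_mate false d₁ d₂ d₃)
      (lower_glue _ _ _)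
      (Net.Stage.total_small (N := stack₃ true true d₁ d₂ d₃) (fun _ => rfl)
        (stack₃_glue_le true false d₁ d₂ d₃) h0))
  obtain ⟨d', h2⟩ := exists_comp ((left_stage d₃ h1).total_quot h0)
  exact ⟨d', left_triple h1 h2⟩

theorem stack₃_orient_outer (a b : Bool) (d₁ d₂ d₃ : BeadDiagram r s) (v : Vertex r s) :
    (stack₃ a b d₁ d₂ d₃).orient (outer₃ v) = vertexOrient v := by
  rcases v with ⟨(_ | _), n⟩ <;> rfl

/-- The effect of a change of the middle layer that only affects its beads. -/
theorem IsTriple.substitute {a b m m' d d' : BeadDiagram r s} (h : IsTriple a m b d)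
    (h' : IsTriple a m' b d') (g : ℕ → List ℕ) (hm : m'.mate = m.mate)
    (h1 : ∀ k, k ≤ a.num → g k = [k])
    (h2 : ∀ v, vertexOrient v = true →
      (m'.beads v).map (· + a.num) = ((m.beads v).map (· + a.num)).flatMap g)
    (h3 : ∀ k, 1 ≤ k → g (k + (a.num + m.num)) = [k + (a.num + m'.num)]) :
    d'.mate = d.mate ∧ ∀ v, vertexOrient v = true → d'.beads v = (d.beads v).flatMap g := by
  have key : ∀ v, vertexOrient v = true →
      d'.mate v = d.mate v ∧ d'.beads v = (d.beads v).flatMap g := by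
    intro v hv
    have t := (h.2.1 v).substitute (M := stack₃ true true a m b) (N := stack₃ true true a m' b) g
      (by simp only [stack₃, hm]) rfl ?_ (by rw [stack₃_orient_outer, hv])
    · obtain ⟨e1, e2⟩ := (h'.2.1 v).unique t
      exact ⟨outer₃_injective e1, e2⟩
    -- The three hypotheses on `g` match the three layers: numbers of the lower layer are kept,
    -- those of the middle layer are replaced, and those of the upper layer are shifted by the
    -- change in the number of beads below them.
    · rintro (w | w | w) hw
      · change a.beads w = (a.beads w).flatMap g
        have : ∀ k ∈ a.beads w, g k = [k] := fun k hk =>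
          h1 k ((a.mem_beads k).1 ⟨w, hk⟩).2
        rw [List.flatMap_congr this, List.flatMap_singleton']
      · exact h2 w hw
      · change (b.beads w).map (· + (a.num + m'.num)) =
          ((b.beads w).map (· + (a.num + m.num))).flatMap g
        rw [List.flatMap_map]
        have : ∀ k ∈ b.beads w, g (k + (a.num + m.num)) = [k + (a.num + m'.num)] := fun k hk =>
          h3 k ((b.mem_beads k).1 ⟨w, hk⟩).1
        rw [List.flatMap_congr this, List.map_eq_flatMap]
  refine ⟨?_, fun v hv => (key v hv).2⟩
  funext v
  by_cases hv : vertexOrient v = true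
  · exact (key v hv).1
  · have hd : vertexOrient (d.mate v) = true := by
      rw [vertexOrient_mate]; simpa using hv
    have := (key _ hd).1
    rw [d.mate_mate] at this
    exact (congrArg d'.mate this).symm.trans (d'.mate_mate _)

theorem readingWord_substitute {d d' : BeadDiagram r s} {g : ℕ → List ℕ}
    (h : ∀ v, vertexOrient v = true → d'.beads v = (d.beads v).flatMap g) :
    d'.readingWord = d.readingWord.flatMap g := by
  unfold readingWord
  rw [List.flatMap_assoc]
  exact List.flatMap_congr fun v hv => h v (mem_starts.1 hv)

/-- Positive ends suffice, because reversing a word does not change its length. -/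
theorem shape_eq {d d' : BeadDiagram r s} (hm : d'.mate = d.mate)
    (h : ∀ v, vertexOrient v = true → ((d'.beads v).length : ZMod 2) = (d.beads v).length) :
    d'.shape = d.shape := by
  refine Prod.ext hm ?_
  funext v
  by_cases hv : vertexOrient v = true
  · exact h v hv
  · have hd : vertexOrient (d.mate v) = true := by
      rw [vertexOrient_mate]; simpa using hv
    have := h _ hd
    rw [d.beads_mate, ← hm, d'.beads_mate, List.length_reverse, List.length_reverse] at this
    exact this

end BeadDiagram

end WalledBrauerClifford

namespace WalledBrauerClifford

namespace BeadDiagram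

variable {r s : ℕ}

/-! ### Products with diagrams without horizontal strands -/

/-- All strands connect the two rows. -/
def IsVertical (x : BeadDiagram r s) : Prop := ∀ v, (x.mate v).1 = !v.1

section Below

variable (x : BeadDiagram r s)

/-- The vertex of the upper layer that is reached from an outer vertex. -/
def belowIn (v : Vertex r s) : Vertex r s := bif v.1 then v else (false, (x.mate v).2)

/-- The beads that are met before the upper layer is reached. -/
def belowHead (v : Vertex r s) : List ℕ := bif v.1 then [] else x.beads v

/-- The outer vertex that is reached from a vertex of the upper layer. -/
def belowOut (v : Vertex r s) : Vertex r s := bif v.1 then v else x.mate (true, v.2)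

/-- The beads that are met after the upper layer is left. -/
def belowTail (v : Vertex r s) : List ℕ := bif v.1 then [] else x.beads (true, v.2)

/-- A vertical layer is crossed from one row to the other, so every walk uses at most one strand of
`d`, preceded and followed by at most one strand of `x`. Hence no loop occurs, whatever `d` is, and
the product has a closed formula. -/
theorem exists_below {x : BeadDiagram r s} (hx : x.IsVertical) (d : BeadDiagram r s) :
    ∃ d', comp x d = some d' ∧
      (∀ v, d'.mate v = x.belowOut (d.mate (x.belowIn v))) ∧
      (∀ v, d'.beads v = x.belowHead v ++ ((d.beads (x.belowIn v)).map (· + x.num) ++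
        x.belowTail (d.mate (x.belowIn v)))) := by
  have h1 : ∀ w, (stack x d).Trace (.inr w) (outer (x.belowOut (d.mate w)))
      ((d.beads w).map (· + x.num) ++ x.belowTail (d.mate w)) := by
    intro w
    cases hm : d.mate w with
    | mk b n =>
      cases b
      · have hb : x.mate (true, n) = (false, (x.mate (true, n)).2) :=
          Prod.ext (hx (true, n)) rfl
        have h2 : (stack x d).Trace (.inl (true, n)) (.inl (x.mate (true, n)))
            (x.beads (true, n)) := .exit _ (by
          change stackGlue (.inl (x.mate (true, n))) = none
          rw [hb]; rfl)
        have := Net.Trace.step (N := stack x d) (.inr w) (.inl (true, n)) _ _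
          (by simp [Net.Step, stack, hm, stackGlue]) h2
        have h3 : outer (x.belowOut (false, n)) = .inl (x.mate (true, n)) := by
          change outer (x.mate (true, n)) = _
          rw [hb]; rfl
        rw [h3]
        exact this
      · have := Net.Trace.exit (N := stack x d) (.inr w) (by simp [stack, hm, stackGlue])
        simpa [stack, outer, hm, belowOut, belowTail] using this
  have h2 : ∀ n, (stack x d).Trace (.inl (false, n))
      (outer (x.belowOut (d.mate (x.belowIn (false, n)))))
      (x.beads (false, n) ++ ((d.beads (x.belowIn (false, n))).map (· + x.num) ++
        x.belowTail (d.mate (x.belowIn (false, n))))) := by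
    intro n
    have hb : x.mate (false, n) = (true, (x.mate (false, n)).2) := Prod.ext (hx (false, n)) rfl
    refine Net.Trace.step (N := stack x d) (.inl (false, n)) (.inr (x.belowIn (false, n))) _ _ ?_
      (h1 _)
    change stackGlue (.inl (x.mate (false, n))) = _
    rw [hb]; rfl
  have hl : ∀ y, ∃ z l, (stack x d).Trace y z l := by
    rintro (⟨(_ | _), n⟩ | v)
    · exact ⟨_, _, h2 n⟩
    · refine ⟨_, _, .exit _ ?_⟩
      have hb : x.mate (true, n) = (false, (x.mate (true, n)).2) :=
          Prod.ext (hx (true, n)) rfl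
      change stackGlue (.inl (x.mate (true, n))) = none
      rw [hb]; rfl
    · exact ⟨_, _, h1 v⟩
  obtain ⟨d', hd⟩ := exists_comp hl
  have ht := (comp_eq_some_iff.1 hd).2.1
  have key : ∀ v, (stack x d).Trace (outer v) (outer (x.belowOut (d.mate (x.belowIn v))))
      (x.belowHead v ++ ((d.beads (x.belowIn v)).map (· + x.num) ++
        x.belowTail (d.mate (x.belowIn v)))) := by
    rintro ⟨(_ | _), n⟩
    · exact h2 n
    · exact h1 (true, n)
  refine ⟨d', hd, fun v => ?_, fun v => ?_⟩
  · exact outer_injective ((ht v).unique (key v)).1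
  · exact ((ht v).unique (key v)).2

end Below

/-- The product of a diagram without horizontal strands and an arbitrary diagram. -/
noncomputable def below (x : BeadDiagram r s) (hx : x.IsVertical) (d : BeadDiagram r s) :
    BeadDiagram r s := (exists_below hx d).choose

section

variable {x : BeadDiagram r s} (hx : x.IsVertical) (d : BeadDiagram r s)

theorem comp_below : comp x d = some (below x hx d) := (exists_below hx d).choose_spec.1

theorem below_mate (v : Vertex r s) :
    (below x hx d).mate v = x.belowOut (d.mate (x.belowIn v)) :=
  (exists_below hx d).choose_spec.2.1 v

theorem below_beads (v : Vertex r s) :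
    (below x hx d).beads v = x.belowHead v ++ ((d.beads (x.belowIn v)).map (· + x.num) ++
        x.belowTail (d.mate (x.belowIn v))) :=
  (exists_below hx d).choose_spec.2.2 v

theorem below_num : (below x hx d).num = x.num + d.num :=
  (comp_eq_some_iff.1 (comp_below hx d)).2.2

end

section Above

variable (x : BeadDiagram r s)

/-- The vertex of the lower layer that is reached from an outer vertex. -/
def aboveIn (v : Vertex r s) : Vertex r s := bif v.1 then (true, (x.mate v).2) else v

/-- The beads that are met before the lower layer is reached. -/
def aboveHead (v : Vertex r s) : List ℕ := bif v.1 then x.beads v else []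

/-- The outer vertex that is reached from a vertex of the lower layer. -/
def aboveOut (v : Vertex r s) : Vertex r s := bif v.1 then x.mate (false, v.2) else v

/-- The beads that are met after the lower layer is left. -/
def aboveTail (v : Vertex r s) : List ℕ := bif v.1 then x.beads (false, v.2) else []

theorem exists_above {x : BeadDiagram r s} (hx : x.IsVertical) (d : BeadDiagram r s) :
    ∃ d', comp d x = some d' ∧
      (∀ v, d'.mate v = x.aboveOut (d.mate (x.aboveIn v))) ∧
      (∀ v, d'.beads v = (x.aboveHead v).map (· + d.num) ++ (d.beads (x.aboveIn v) ++
        (x.aboveTail (d.mate (x.aboveIn v))).map (· + d.num))) := by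
  have h1 : ∀ w, (stack d x).Trace (.inl w) (outer (x.aboveOut (d.mate w)))
      (d.beads w ++ (x.aboveTail (d.mate w)).map (· + d.num)) := by
    intro w
    cases hm : d.mate w with
    | mk b n =>
      cases b
      · have := Net.Trace.exit (N := stack d x) (.inl w) (by simp [stack, hm, stackGlue])
        simpa [stack, outer, hm, aboveOut, aboveTail] using this
      · have hb : x.mate (false, n) = (true, (x.mate (false, n)).2) :=
          Prod.ext (hx (false, n)) rfl
        have h2 : (stack d x).Trace (.inr (false, n)) (.inr (x.mate (false, n)))
            ((x.beads (false, n)).map (· + d.num)) := .exit _ (by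
          change stackGlue (.inr (x.mate (false, n))) = none
          rw [hb]; rfl)
        have := Net.Trace.step (N := stack d x) (.inl w) (.inr (false, n)) _ _
          (by simp [Net.Step, stack, hm, stackGlue]) h2
        have h3 : outer (x.aboveOut (true, n)) = .inr (x.mate (false, n)) := by
          change outer (x.mate (false, n)) = _
          rw [hb]; rfl
        rw [h3]
        exact this
  have h2 : ∀ n, (stack d x).Trace (.inr (true, n))
      (outer (x.aboveOut (d.mate (x.aboveIn (true, n)))))
      ((x.beads (true, n)).map (· + d.num) ++ (d.beads (x.aboveIn (true, n)) ++
        (x.aboveTail (d.mate (x.aboveIn (true, n)))).map (· + d.num))) := by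
    intro n
    have hb : x.mate (true, n) = (false, (x.mate (true, n)).2) := Prod.ext (hx (true, n)) rfl
    refine Net.Trace.step (N := stack d x) (.inr (true, n)) (.inl (x.aboveIn (true, n))) _ _ ?_
      (h1 _)
    change stackGlue (.inr (x.mate (true, n))) = _
    rw [hb]; rfl
  have hl : ∀ y, ∃ z l, (stack d x).Trace y z l := by
    rintro (v | ⟨(_ | _), n⟩)
    · exact ⟨_, _, h1 v⟩
    · refine ⟨_, _, .exit _ ?_⟩
      have hb : x.mate (false, n) = (true, (x.mate (false, n)).2) :=
          Prod.ext (hx (false, n)) rfl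
      change stackGlue (.inr (x.mate (false, n))) = none
      rw [hb]; rfl
    · exact ⟨_, _, h2 n⟩
  obtain ⟨d', hd⟩ := exists_comp hl
  have ht := (comp_eq_some_iff.1 hd).2.1
  have key : ∀ v, (stack d x).Trace (outer v) (outer (x.aboveOut (d.mate (x.aboveIn v))))
      ((x.aboveHead v).map (· + d.num) ++ (d.beads (x.aboveIn v) ++
        (x.aboveTail (d.mate (x.aboveIn v))).map (· + d.num))) := by
    rintro ⟨(_ | _), n⟩
    · exact h1 (false, n)
    · exact h2 n
  refine ⟨d', hd, fun v => ?_, fun v => ?_⟩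
  · exact outer_injective ((ht v).unique (key v)).1
  · exact ((ht v).unique (key v)).2

end Above

/-- The product of an arbitrary diagram and a diagram without horizontal strands. -/
noncomputable def above (x : BeadDiagram r s) (hx : x.IsVertical) (d : BeadDiagram r s) :
    BeadDiagram r s := (exists_above hx d).choose

section

variable {x : BeadDiagram r s} (hx : x.IsVertical) (d : BeadDiagram r s)

theorem comp_above : comp d x = some (above x hx d) := (exists_above hx d).choose_spec.1

theorem above_mate (v : Vertex r s) :
    (above x hx d).mate v = x.aboveOut (d.mate (x.aboveIn v)) :=
  (exists_above hx d).choose_spec.2.1 v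

theorem above_beads (v : Vertex r s) :
    (above x hx d).beads v = (x.aboveHead v).map (· + d.num) ++ (d.beads (x.aboveIn v) ++
        (x.aboveTail (d.mate (x.aboveIn v))).map (· + d.num)) :=
  (exists_above hx d).choose_spec.2.2 v

theorem above_num : (above x hx d).num = d.num + x.num :=
  (comp_eq_some_iff.1 (comp_above hx d)).2.2

end

theorem bead_isVertical (i : ℕ) (h : 1 ≤ i ∧ i ≤ r + s) :
    (bead i h : BeadDiagram r s).IsVertical := fun _ => rfl

/-! ### Two beads on straight strands -/

section BeadBead

variable (i j : ℕ) (hi : 1 ≤ i ∧ i ≤ r + s) (hj : 1 ≤ j ∧ j ≤ r + s)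

/-- The product of two one-bead diagrams. -/
noncomputable def beadBead : BeadDiagram r s := below (bead i hi) (bead_isVertical i hi) (bead j hj)

theorem beadBead_mate : (beadBead i j hi hj : BeadDiagram r s).mate = fun v => (!v.1, v.2) := by
  funext v
  rw [beadBead, below_mate]
  rcases v with ⟨(_ | _), n⟩ <;> rfl

theorem beadBead_beads_bottom (n : Label r s) :
    (beadBead i j hi hj : BeadDiagram r s).beads (false, n) =
      (if (n : ℕ) = i then [1] else []) ++ (if (n : ℕ) = j then [2] else []) := by
  rw [beadBead, below_beads]
  simp only [belowHead, belowIn, belowTail, bead, Bool.not_false, cond_true, cond_false,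
    List.append_nil]
  split_ifs <;> rfl

/-- Read downwards, the second factor is met first. For `i = j` the order is 2, 1 here and 1, 2 from
below, which is where the two sides of the wall get different squares. -/
theorem beadBead_beads_top (n : Label r s) :
    (beadBead i j hi hj : BeadDiagram r s).beads (true, n) =
      (if (n : ℕ) = j then [2] else []) ++ (if (n : ℕ) = i then [1] else []) := by
  rw [beadBead, below_beads]
  simp only [belowHead, belowIn, belowTail, bead, Bool.not_true, cond_true, cond_false,
    List.nil_append]
  split_ifs <;> rfl

theorem beadBead_num : (beadBead i j hi hj : BeadDiagram r s).num = 2 := by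
  rw [beadBead, below_num]; rfl

end BeadBead

end BeadDiagram

end WalledBrauerClifford

namespace WalledBrauerClifford

namespace DiagramAlgebra

open BeadDiagram

variable {r s : ℕ}

/-! ### The linear map to combinations of shapes -/

/-- The linear map that sends a diagram to a multiple of its shape. -/
noncomputable def shapeMap : DiagramAlgebra r s →ₗ[ℂ] (Shape r s →₀ ℂ) :=
  extend fun d => Finsupp.single d.shape d.coeff

theorem shapeMap_ofDiagram (d : BeadDiagram r s) :
    shapeMap (ofDiagram d) = Finsupp.single d.shape d.coeff := extend_ofDiagram _ d

theorem triple_mul (a m b : BeadDiagram r s) :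
    ofDiagram a * ofDiagram m * ofDiagram b =
      ofOption ((comp a m).bind fun x => comp x b) := by
  rw [ofDiagram_mul]
  exact mulMap_ofOption_left _ _

/-- Whether a loop arises depends only on the connections, so the two triple products vanish
together, and only the case of two honest diagrams has to be compared. -/
theorem shapeMap_triple {a m m' b : BeadDiagram r s} (hm : m'.mate = m.mate) (c : ℂ)
    (h : ∀ d d', IsTriple a m b d → IsTriple a m' b d' →
      d'.shape = d.shape ∧ d'.coeff = c * d.coeff) :
    shapeMap (ofDiagram a * ofDiagram m' * ofDiagram b) =
      c • shapeMap (ofDiagram a * ofDiagram m * ofDiagram b) := by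
  rw [triple_mul, triple_mul]
  have hl : (stack₃ true true a m' b).HasLoop ↔ (stack₃ true true a m b).HasLoop :=
    Net.hasLoop_congr (by simp only [stack₃, hm]) rfl
  by_cases hm : (stack₃ true true a m b).HasLoop
  · have e : ∀ m'', (stack₃ true true a m'' b).HasLoop →
        ((comp a m'').bind fun x => comp x b) = none := by
      intro m'' h''
      rw [Option.eq_none_iff_forall_ne_some]
      intro d hd
      exact (left_iff.1 hd).total h''
    rw [e m hm, e m' (hl.2 hm)]
    simp [ofOption]
  · obtain ⟨d, hd⟩ := exists_triple hm
    obtain ⟨d', hd'⟩ := exists_triple (mt hl.1 hm)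
    obtain ⟨h1, h2⟩ := h d d' hd hd'
    rw [left_iff.2 hd, left_iff.2 hd']
    change shapeMap (ofDiagram d') = c • shapeMap (ofDiagram d)
    rw [shapeMap_ofDiagram, shapeMap_ofDiagram, h1, h2, Finsupp.smul_single, smul_eq_mul]

theorem bead_mul_bead (i j : ℕ) (hi : 1 ≤ i ∧ i ≤ r + s) (hj : 1 ≤ j ∧ j ≤ r + s) :
    ofDiagram (bead i hi : BeadDiagram r s) * ofDiagram (bead j hj) =
      ofDiagram (beadBead i j hi hj) := by
  rw [ofDiagram_mul, comp_below (bead_isVertical i hi)]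
  rfl

/-- In the triple product the two beads of the middle layer have the numbers `a.num + 1` and `a.num
+ 2`. Since they lie on different strands of that layer, changing the order of the factors amounts
to exchanging these two numbers, which reverses the inversion sign and preserves shape and number of
beads. -/
theorem shapeMap_anticomm (i j : ℕ) (hi : 1 ≤ i ∧ i ≤ r + s) (hj : 1 ≤ j ∧ j ≤ r + s)
    (hij : i ≠ j) (a b : BeadDiagram r s) :
    shapeMap (ofDiagram a * ofDiagram (beadBead j i hj hi) * ofDiagram b) =
      (-1 : ℂ) • shapeMap (ofDiagram a * ofDiagram (beadBead i j hi hj) * ofDiagram b) := by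
  refine shapeMap_triple (by rw [beadBead_mate, beadBead_mate]) _ fun d d' hd hd' => ?_
  set n := a.num + 1 with hn
  have h := hd.substitute hd' (fun k => [Equiv.swap n (n + 1) k])
    (by rw [beadBead_mate, beadBead_mate])
    (fun k hk => by
      rw [Equiv.swap_apply_of_ne_of_ne] <;> lia)
    (fun v _ => by
      have e1 : Equiv.swap n (n + 1) (1 + a.num) = 2 + a.num := by
        rw [show 1 + a.num = n by lia, show 2 + a.num = n + 1 by lia, Equiv.swap_apply_left]
      have e2 : Equiv.swap n (n + 1) (2 + a.num) = 1 + a.num := by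
        rw [show 1 + a.num = n by lia, show 2 + a.num = n + 1 by lia, Equiv.swap_apply_right]
      rcases v with ⟨(_ | _), k⟩
      · rw [beadBead_beads_bottom, beadBead_beads_bottom]
        by_cases h1 : (k : ℕ) = i <;> by_cases h2 : (k : ℕ) = j <;> simp_all
      · rw [beadBead_beads_top, beadBead_beads_top]
        by_cases h1 : (k : ℕ) = i <;> by_cases h2 : (k : ℕ) = j <;> simp_all)
    (fun k hk => by
      rw [beadBead_num, beadBead_num, Equiv.swap_apply_of_ne_of_ne] <;> lia)
  have hnum : d'.num = d.num := by rw [hd.2.2, hd'.2.2, beadBead_num, beadBead_num]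
  refine ⟨shape_eq h.1 fun v hv => by rw [h.2 v hv]; simp, ?_⟩
  have hd2 : d.num = a.num + 2 + b.num := by rw [hd.2.2, beadBead_num]
  rw [coeff, coeff, readingWord_substitute h.2, hnum, ← List.map_eq_flatMap,
    inversionSign_map_swap d.readingWord_nodup ((mem_readingWord _ _).2 (by lia))
      ((mem_readingWord _ _).2 (by lia))]
  ring

/-- The bead of the middle layer carries the number `a.num + 1` in the product, so removing it
erases exactly this letter. -/
theorem substitute_one {a b d d₀ : BeadDiagram r s} {k : ℕ} {hk : 1 ≤ k ∧ k ≤ r + s}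
    (hd : IsTriple a (bead k hk) b d) (hd₀ : IsTriple a (one r s) b d₀) :
    d₀.mate = d.mate ∧ ∀ v, vertexOrient v = true →
      d₀.beads v = (d.beads v).flatMap (eraseNum (a.num + 1)) := by
  refine hd.substitute hd₀ _ rfl (fun k hk => ?_) (fun v _ => ?_) fun k hk => ?_
  · unfold eraseNum
    rw [if_neg (by lia), if_pos (by lia)]
  · simp only [one, bead]
    split_ifs <;> simp [eraseNum, add_comm]
  · change eraseNum (a.num + 1) (k + (a.num + 1)) = [k + (a.num + 0)]
    unfold eraseNum
    rw [if_neg (by lia), if_neg (by lia)]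
    rfl

/-- The product with the identity in the middle does not show where two beads would have to be
inserted. Therefore both sides are compared with the product that has one bead in the middle: its
letter `n` is doubled to get one side and erased to get the other. -/
theorem shapeMap_sq (k : ℕ) (hk : 1 ≤ k ∧ k ≤ r + s) (a b : BeadDiagram r s) :
    shapeMap (ofDiagram a * ofDiagram (beadBead k k hk hk) * ofDiagram b) =
      (if k ≤ r then -1 else 1 : ℂ) •
        shapeMap (ofDiagram a * ofDiagram (one r s) * ofDiagram b) := by
  refine shapeMap_triple (by rw [beadBead_mate]; rfl) _ fun d₀ d' hd₀ hd' => ?_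
  obtain ⟨d, hd⟩ := exists_triple (d₁ := a) (d₂ := bead k hk) (d₃ := b) (fun hl =>
    hd₀.total ((Net.hasLoop_congr rfl rfl).1 hl))
  have h₀ := substitute_one hd hd₀
  set n := a.num + 1 with hn
  have hnum₀ : d₀.num = a.num + b.num := by rw [hd₀.2.2]; rfl
  have hnum' : d'.num = d₀.num + 2 := by rw [hnum₀, hd'.2.2, beadBead_num]; lia
  have hmem : n ∈ d.readingWord := by
    rw [mem_readingWord, hd.2.2]
    change _ ∧ _ ≤ a.num + 1 + b.num
    lia
  have hI : Complex.I ^ d'.num = -Complex.I ^ d₀.num := by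
    rw [hnum', pow_add, Complex.I_sq, mul_neg_one]
  have hmate : (beadBead k k hk hk : BeadDiagram r s).mate = (bead k hk).mate := by
    rw [beadBead_mate]; rfl
  by_cases hkr : k ≤ r
  · have h := hd.substitute hd' (doubleNum n) hmate
      (fun k hk => by unfold doubleNum; rw [if_neg (by lia), if_pos (by lia)])
      (fun v hv => by
        rcases v with ⟨(_ | _), m⟩
        · rw [beadBead_beads_bottom]
          by_cases hm : (m : ℕ) = k
          · simp [bead, hm, doubleNum, hn, add_comm]; lia
          · simp [bead, hm]
        · have hm : (m : ℕ) ≠ k := by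
            intro h
            simp [vertexOrient, IsLeft, h, hkr] at hv
          rw [beadBead_beads_top]
          simp [bead, hm])
      (fun j hj => by
        rw [beadBead_num]
        change doubleNum n (j + (a.num + 1)) = _
        unfold doubleNum; rw [if_neg (by lia), if_neg (by lia)]
        rfl)
    refine ⟨shape_eq (h.1.trans h₀.1.symm) fun v hv => ?_, ?_⟩
    · rw [h.2 v hv, h₀.2 v hv]
      exact length_flatMap_cast (length_doubleNum_cast n) _
    · rw [coeff, coeff, hI, readingWord_substitute h.2, readingWord_substitute h₀.2,
        (inversionSign_flatMap d.readingWord_nodup).1, if_pos hkr]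
      ring
  -- On the right of the wall the positive end is the top one. The beads are read as `n + 1`, `n`,
  -- and the resulting inversion cancels the sign of `I ^ 2`.
  · have h := hd.substitute hd' (doubleNumRev n) hmate
      (fun k hk => by unfold doubleNumRev; rw [if_neg (by lia), if_pos (by lia)])
      (fun v hv => by
        rcases v with ⟨(_ | _), m⟩
        · have hm : (m : ℕ) ≠ k := by
            intro h
            simp [vertexOrient, IsLeft, h, hkr] at hv
          rw [beadBead_beads_bottom]
          simp [bead, hm]
        · rw [beadBead_beads_top]
          by_cases hm : (m : ℕ) = k
          · simp [bead, hm, doubleNumRev, hn, add_comm]; lia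
          · simp [bead, hm])
      (fun j hj => by
        rw [beadBead_num]
        change doubleNumRev n (j + (a.num + 1)) = _
        unfold doubleNumRev; rw [if_neg (by lia), if_neg (by lia)]
        rfl)
    refine ⟨shape_eq (h.1.trans h₀.1.symm) fun v hv => ?_, ?_⟩
    · rw [h.2 v hv, h₀.2 v hv]
      exact length_flatMap_cast (length_doubleNumRev_cast n) _
    · rw [coeff, coeff, hI, readingWord_substitute h.2, readingWord_substitute h₀.2,
        (inversionSign_flatMap d.readingWord_nodup).2, if_pos hmem, if_neg hkr]
      ring

theorem one_eq : (1 : DiagramAlgebra r s) = ofDiagram (one r s) := rfl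

/-- The outer factors range over the whole diagram algebra, so that linearity reduces the claim to
products with single diagrams. -/
theorem shapeMap_clifford {x : BDSub r s} (hx : BDSub.CliffordElement r s x)
    (a b : DiagramAlgebra r s) : shapeMap (a * (x : DiagramAlgebra r s) * b) = 0 := by
  suffices h : ∀ d d' : BeadDiagram r s,
      shapeMap (ofDiagram d * (x : DiagramAlgebra r s) * ofDiagram d') = 0 by
    have : ((LinearMap.mul ℂ (DiagramAlgebra r s)).comp
        ((LinearMap.mul ℂ (DiagramAlgebra r s)).flip x)).compr₂ shapeMap = 0 :=
      hom_ext fun d => hom_ext fun d' => h d d'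
    exact congrArg (fun f => f a b) this
  intro d d'
  cases hx with
  | sq_left k hk hkr =>
    have e : ((BDSub.c k hk ^ 2 + 1 : BDSub r s) : DiagramAlgebra r s) =
        ofDiagram (beadBead k k hk hk) + ofDiagram (one r s) := by
      rw [← bead_mul_bead, ← one_eq, pow_two]; rfl
    rw [e, mul_add, add_mul, map_add, shapeMap_sq, if_pos hkr]
    simp
  | sq_right k hk hkr =>
    have e : ((BDSub.c k hk ^ 2 - 1 : BDSub r s) : DiagramAlgebra r s) =
        ofDiagram (beadBead k k hk hk) - ofDiagram (one r s) := by
      rw [← bead_mul_bead, ← one_eq, pow_two]; rfl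
    rw [e, mul_sub, sub_mul, map_sub, shapeMap_sq, if_neg (by lia)]
    simp
  | anticomm i j hi hj hij =>
    have e : ((BDSub.c i hi * BDSub.c j hj + BDSub.c j hj * BDSub.c i hi : BDSub r s) :
        DiagramAlgebra r s) =
        ofDiagram (beadBead i j hi hj) + ofDiagram (beadBead j i hj hi) := by
      rw [← bead_mul_bead, ← bead_mul_bead]; rfl
    rw [e, mul_add, add_mul, map_add, shapeMap_anticomm i j hi hj hij]
    simp

end DiagramAlgebra

/-! ### The shape map on the quotient -/

namespace BD

variable {r s : ℕ}

theorem shapeMap_of_mem {x : BDSub r s} (hx : x ∈ BDSub.cliffordIdeal r s) :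
    DiagramAlgebra.shapeMap (x : DiagramAlgebra r s) = 0 := by
  -- The kernel of the shape map is only a subspace. Requiring the vanishing for all multiples on
  -- both sides turns it into an ideal, which contains the Clifford elements.
  let J : TwoSidedIdeal (BDSub r s) := TwoSidedIdeal.mk'
    {y | ∀ a b : DiagramAlgebra r s,
      DiagramAlgebra.shapeMap (a * (y : DiagramAlgebra r s) * b) = 0}
    (by simp)
    (by
      intro y z hy hz a b
      rw [Subalgebra.coe_add, mul_add, add_mul, map_add, hy, hz, add_zero])
    (by
      intro y hy a b
      rw [Subalgebra.coe_neg, mul_neg, neg_mul, map_neg, hy, neg_zero])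
    (by
      intro y z hz a b
      rw [Subalgebra.coe_mul, ← mul_assoc, hz])
    (by
      intro y z hy a b
      rw [Subalgebra.coe_mul, ← mul_assoc, mul_assoc, hy])
  have h : BDSub.cliffordIdeal r s ≤ J := by
    unfold BDSub.cliffordIdeal
    rw [TwoSidedIdeal.span_le]
    intro y hy
    refine (TwoSidedIdeal.mem_mk' _ _ _ _ _ _ _).2 ?_
    exact fun a b => DiagramAlgebra.shapeMap_clifford hy a b
  have := (TwoSidedIdeal.mem_mk' _ _ _ _ _ _ _).1 (h hx) 1 1
  rwa [one_mul, mul_one] at this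

variable (r s) in
/-- The linear map that sends the class of a diagram to a multiple of its shape. -/
noncomputable def shapeMap : BD r s →ₗ[ℂ] (BeadDiagram.Shape r s →₀ ℂ) :=
  ((LinearMap.ker (mk r s).toLinearMap).liftQ
    (DiagramAlgebra.shapeMap ∘ₗ (BDSub r s).val.toLinearMap) (by
      intro x hx
      refine shapeMap_of_mem ?_
      have : mk r s x = mk r s 0 := by rw [map_zero]; exact hx
      rwa [mk_eq_iff, sub_zero] at this)) ∘ₗ
  ((mk r s).toLinearMap.quotKerEquivOfSurjective mk_surjective).symm.toLinearMap

theorem shapeMap_mk (x : BDSub r s) :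
    shapeMap r s (mk r s x) = DiagramAlgebra.shapeMap (x : DiagramAlgebra r s) := by
  have : ((mk r s).toLinearMap.quotKerEquivOfSurjective mk_surjective).symm (mk r s x) =
      Submodule.Quotient.mk x := by
    rw [LinearEquiv.symm_apply_eq]
    rfl
  unfold shapeMap
  rw [LinearMap.comp_apply, LinearEquiv.coe_coe, this]
  rfl

end BD

end WalledBrauerClifford

namespace WalledBrauerClifford

namespace BeadDiagram

variable {r s : ℕ}

/-! ### Diagrams without beads -/

/-- The permutation of the labels preserves the two sides of the wall. -/
def PreservesSides (g : Equiv.Perm (Label r s)) : Prop := ∀ n, ((g n : ℕ) ≤ r ↔ (n : ℕ) ≤ r)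

theorem PreservesSides.one : PreservesSides (1 : Equiv.Perm (Label r s)) := fun _ => Iff.rfl

theorem PreservesSides.mul {g h : Equiv.Perm (Label r s)} (hg : PreservesSides g)
    (hh : PreservesSides h) : PreservesSides (g * h) := fun n => (hg _).trans (hh n)

theorem PreservesSides.inv {g : Equiv.Perm (Label r s)} (hg : PreservesSides g) :
    PreservesSides g⁻¹ := fun n => by
  have := hg (g.symm n)
  rw [Equiv.apply_symm_apply] at this
  exact this.symm

theorem PreservesSides.swap {m n : Label r s} (h : (m : ℕ) ≤ r ↔ (n : ℕ) ≤ r) :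
    PreservesSides (Equiv.swap m n) := by
  intro k
  simp only [Equiv.swap_apply_def]
  split_ifs with h1 h2
  · rw [h1]; exact h.symm
  · rw [h2]; exact h
  · rfl

/-- The diagram of a permutation: the top vertex `n` is connected with the bottom vertex `g n`. -/
def perm (g : Equiv.Perm (Label r s)) (hg : PreservesSides g) : BeadDiagram r s where
  mate v := (!v.1, bif v.1 then g v.2 else g.symm v.2)
  beads _ := []
  num := 0
  mate_ne v h := by simpa using congrArg Prod.fst h
  mate_mate v := by rcases v with ⟨(_ | _), n⟩ <;> simp
  vertical v _ := by
    rcases v with ⟨(_ | _), n⟩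
    · exact hg.inv n
    · exact hg n
  horizontal v h := by simp at h
  beads_mate v := rfl
  mem_beads k := by simp; lia
  beads_nodup v := List.nodup_nil
  beads_unique v w k h := by simp at h

/-- The map is an involution that only connects labels on different sides of the wall. -/
structure IsMatching (t : Label r s → Label r s) : Prop where
  invol : ∀ n, t (t n) = n
  sides : ∀ n, t n ≠ n → ((t n : ℕ) ≤ r ↔ ¬ (n : ℕ) ≤ r)

/-- The diagram in which `n` is connected with `t n` within each row if these are different labels;
all other strands are vertical and straight. -/
def matching (t : Label r s → Label r s) (ht : IsMatching t) : BeadDiagram r s where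
  mate v := if t v.2 = v.2 then (!v.1, v.2) else (v.1, t v.2)
  beads _ := []
  num := 0
  mate_ne v h := by
    split_ifs at h with h1
    · simpa using congrArg Prod.fst h
    · exact h1 (congrArg Prod.snd h)
  mate_mate v := by
    by_cases h1 : t v.2 = v.2
    · simp [h1]
    · rw [if_neg h1]
      simp only [ht.invol]
      rw [if_neg (Ne.symm h1)]
  vertical v h := by
    split_ifs at h ⊢ with h1
    · rfl
    · simp at h
  horizontal v h := by
    split_ifs at h ⊢ with h1
    · simp at h
    · exact ht.sides _ h1
  beads_mate v := rfl
  mem_beads k := by simp; lia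
  beads_nodup v := List.nodup_nil
  beads_unique v w k h := by simp at h

theorem perm_isVertical (g : Equiv.Perm (Label r s)) (hg : PreservesSides g) :
    (perm g hg).IsVertical := fun _ => rfl

/-- Conjugation by a permutation relabels the horizontal strands. Both outer layers are vertical, so
the product is given by the explicit formulas and no walk has to be followed. -/
theorem below_perm_matching_perm (g : Equiv.Perm (Label r s)) (hg : PreservesSides g)
    (hg' : PreservesSides g⁻¹) (t t' : Label r s → Label r s) (ht : IsMatching t)
    (ht' : IsMatching t') (h : ∀ n, t' (g n) = g (t n)) :
    above (perm g⁻¹ hg') (perm_isVertical _ _) (below (perm g hg) (perm_isVertical _ _)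
      (matching t ht)) = matching t' ht' := by
  have h' : ∀ n, t (g.symm n) = g.symm (t' n) := by
    intro n
    rw [Equiv.eq_symm_apply, ← h, Equiv.apply_symm_apply]
  refine BeadDiagram.ext (funext fun v => ?_) (funext fun v => ?_) ?_
  · rw [above_mate, below_mate]
    rcases v with ⟨b, n⟩
    have hgi : Equiv.symm g⁻¹ = g := rfl
    have e : t (g.symm n) = g.symm n ↔ t' n = n := by rw [h', EmbeddingLike.apply_eq_iff_eq]
    by_cases hn : t' n = n
    · cases b <;> simp [aboveOut, aboveIn, belowIn, belowOut, perm, matching, e, hn, hgi]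
    · cases b <;> simp [aboveOut, aboveIn, belowIn, belowOut, perm, matching, hn, h', hgi]
  · rw [above_beads, below_beads]
    rcases v with ⟨b, n⟩
    simp [aboveHead, aboveTail, belowHead, belowTail, perm, matching]
  · rw [above_num, below_num]; rfl

theorem below_perm_perm (g h : Equiv.Perm (Label r s)) (hg : PreservesSides g)
    (hh : PreservesSides h) :
    below (perm g hg) (perm_isVertical _ _) (perm h hh) = perm (g * h) (hg.mul hh) := by
  refine BeadDiagram.ext (funext fun v => ?_) (funext fun v => ?_) ?_
  · rw [below_mate]
    rcases v with ⟨(_ | _), n⟩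
    · simp only [belowIn, belowOut, perm, Bool.not_false, cond_true, cond_false]
      rfl
    · simp [belowIn, belowOut, perm]
  · rw [below_beads]
    rcases v with ⟨(_ | _), n⟩ <;> simp [belowIn, belowHead, belowTail, perm]
  · rw [below_num]; rfl

/-- The bead slides along the strand that joins the top vertex `n` to the bottom vertex `g n`. -/
theorem below_perm_bead (g : Equiv.Perm (Label r s)) (hg : PreservesSides g) (n : Label r s) :
    below (perm g hg) (perm_isVertical _ _) (bead n.1 n.2) =
      below (bead (g n).1 (g n).2) (bead_isVertical _ _) (perm g hg) := by
  have e : ∀ m : Label r s, (m : ℕ) = g n ↔ ((g.symm m : Label r s) : ℕ) = n := by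
    intro m
    rw [← Subtype.ext_iff, ← Subtype.ext_iff, Equiv.symm_apply_eq]
  refine BeadDiagram.ext (funext fun v => ?_) (funext fun v => ?_) ?_
  · rw [below_mate, below_mate]
    rcases v with ⟨(_ | _), k⟩ <;> rfl
  · rw [below_beads, below_beads]
    rcases v with ⟨(_ | _), k⟩
    · simp [belowIn, belowHead, belowTail, perm, bead, e]
    · simp [belowIn, belowHead, belowTail, perm, bead, e]
  · rw [below_num, below_num]; rfl

theorem _root_.WalledBrauerClifford.Net.Trace.exit_of {X : Type} {N : Net X} {x z : X}
    (h : N.mate x = z) (hz : N.glue z = none) (hw : N.word x = []) : N.Trace x z [] := by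
  have := Net.Trace.exit (N := N) x (by rw [h, hz])
  rwa [h, hw] at this

theorem _root_.WalledBrauerClifford.Net.Trace.step_of {X : Type} {N : Net X} {x y w z : X}
    (h : N.mate x = y) (hy : N.glue y = some w) (hw : N.word x = []) (t : N.Trace w z []) : N.Trace x z [] := by
  have := Net.Trace.step (N := N) x w z [] (by unfold Net.Step; rw [h, hy]) t
  rwa [hw] at this

/-- A closed curve that consists of two strands. -/
theorem comp_eq_none {d d' : BeadDiagram r s} {p q : Label r s} (h : d.mate (true, p) = (true, q))
    (h' : d'.mate (false, q) = (false, p)) : comp d d' = none := by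
  unfold comp
  rw [dif_pos]
  refine ⟨.inl (true, p), .head (b := .inr (false, q)) ?_ (.single ?_)⟩
  · change stackGlue (.inl (d.mate (true, p))) = _
    rw [h]; rfl
  · change stackGlue (.inr (d'.mate (false, q))) = _
    rw [h']; rfl

theorem IsMatching.swap {p q : Label r s} (h : (p : ℕ) ≤ r ↔ ¬ (q : ℕ) ≤ r) :
    IsMatching (Equiv.swap p q) := by
  refine ⟨fun n => by simp, fun n hn => ?_⟩
  rw [Equiv.swap_apply_def] at hn ⊢
  split_ifs at hn ⊢ with h1 h2
  · rw [h1]; tauto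
  · rw [h2]; exact h
  · exact absurd rfl hn

/-- The strands of `t` at `p` and `q` are straight, so they carry the arc at the top of the lower
diagram to the top row; the arcs of `t` meet only straight strands of the lower diagram. No loop
arises because the two sets of arcs are disjoint. -/
theorem matching_swap_comp {p q : Label r s} (h : (p : ℕ) ≤ r ↔ ¬ (q : ℕ) ≤ r)
    {t : Label r s → Label r s} (ht : IsMatching t) (hp : t p = p) (hq : t q = q)
    (ht' : IsMatching (Equiv.swap p q ∘ t)) :
    comp (matching (Equiv.swap p q) (.swap h)) (matching t ht) = some (matching _ ht') := by
  set N := stack (matching (Equiv.swap p q) (.swap h)) (matching t ht) with hN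
  have hpq : p ≠ q := by rintro rfl; exact iff_not_self h
  have hw : ∀ x, N.word x = [] := by rintro (v | v) <;> rfl
  have hnp : ∀ n, n ≠ p → n ≠ q → t n ≠ p ∧ t n ≠ q := by
    intro n h1 h2
    constructor
    · intro h3; rw [← ht.invol n, h3, hp] at h1; exact h1 rfl
    · intro h3; rw [← ht.invol n, h3, hq] at h2; exact h2 rfl
  have m1 : ∀ b n, n ≠ p → n ≠ q → N.mate (.inl (b, n)) = .inl (!b, n) := by
    intro b n h1 h2
    simp [hN, stack, matching, Equiv.swap_apply_of_ne_of_ne h1 h2]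
  have m1p : ∀ b, N.mate (.inl (b, p)) = .inl (b, q) := by
    intro b
    simp [hN, stack, matching, hpq.symm]
  have m1q : ∀ b, N.mate (.inl (b, q)) = .inl (b, p) := by
    intro b
    simp [hN, stack, matching, hpq]
  have m2 : ∀ b n, t n = n → N.mate (.inr (b, n)) = .inr (!b, n) := by
    intro b n h1
    simp [hN, stack, matching, h1]
  have m2' : ∀ b n, t n ≠ n → N.mate (.inr (b, n)) = .inr (b, t n) := by
    intro b n h1
    simp [hN, stack, matching, h1]
  have tlt : ∀ n, n ≠ p → n ≠ q → N.Trace (.inl (true, n)) (.inl (false, n)) [] :=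
    fun n h1 h2 => Net.Trace.exit_of (m1 _ _ h1 h2) rfl (hw _)
  have tufs : ∀ n, t n = n → N.Trace (.inr (false, n)) (.inr (true, n)) [] :=
    fun n h1 => Net.Trace.exit_of (m2 _ _ h1) rfl (hw _)
  have tltp : N.Trace (.inl (true, p)) (.inr (true, q)) [] :=
    Net.Trace.step_of (m1p _) rfl (hw _) (tufs q hq)
  have tltq : N.Trace (.inl (true, q)) (.inr (true, p)) [] :=
    Net.Trace.step_of (m1q _) rfl (hw _) (tufs p hp)
  have tuf : ∀ n, t n ≠ n → N.Trace (.inr (false, n)) (.inl (false, t n)) [] := by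
    intro n h1
    have h2 : n ≠ p := by rintro rfl; exact h1 hp
    have h3 : n ≠ q := by rintro rfl; exact h1 hq
    obtain ⟨h4, h5⟩ := hnp n h2 h3
    exact Net.Trace.step_of (m2' _ _ h1) rfl (hw _) (tlt _ h4 h5)
  have tlf : ∀ n, N.Trace (.inl (false, n)) (outer ((matching _ ht').mate (false, n))) [] := by
    intro n
    rcases eq_or_ne n p with rfl | h1
    · have := Net.Trace.exit_of (m1p false) rfl (hw _)
      simpa [matching, hp, hpq.symm, outer] using this
    rcases eq_or_ne n q with rfl | h2
    · have := Net.Trace.exit_of (m1q false) rfl (hw _)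
      simpa [matching, hq, hpq, outer] using this
    obtain ⟨h4, h5⟩ := hnp n h1 h2
    by_cases h3 : t n = n
    · have := Net.Trace.step_of (m1 false n h1 h2) rfl (hw _) (tufs n h3)
      simpa [matching, h3, Equiv.swap_apply_of_ne_of_ne h1 h2, outer] using this
    · have := Net.Trace.step_of (m1 false n h1 h2) rfl (hw _) (tuf n h3)
      simpa [matching, h3, Equiv.swap_apply_of_ne_of_ne h4 h5, outer] using this
  have tut : ∀ n, N.Trace (.inr (true, n)) (outer ((matching _ ht').mate (true, n))) [] := by
    intro n
    rcases eq_or_ne n p with rfl | h1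
    · have := Net.Trace.step_of (m2 true n hp) rfl (hw _) tltp
      simpa [matching, hp, hpq.symm, outer] using this
    rcases eq_or_ne n q with rfl | h2
    · have := Net.Trace.step_of (m2 true n hq) rfl (hw _) tltq
      simpa [matching, hq, hpq, outer] using this
    obtain ⟨h4, h5⟩ := hnp n h1 h2
    by_cases h3 : t n = n
    · have := Net.Trace.step_of (m2 true n h3) rfl (hw _) (tlt n h1 h2)
      simpa [matching, h3, Equiv.swap_apply_of_ne_of_ne h1 h2, outer] using this
    · have := Net.Trace.exit_of (m2' true n h3) rfl (hw _)
      simpa [matching, h3, Equiv.swap_apply_of_ne_of_ne h4 h5, outer] using this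
  refine comp_eq_some_iff.2 ⟨?_, ?_, rfl⟩
  · rintro (⟨(_ | _), n⟩ | ⟨(_ | _), n⟩)
    · exact ⟨_, _, tlf n⟩
    · rcases eq_or_ne n p with rfl | h1
      · exact ⟨_, _, tltp⟩
      rcases eq_or_ne n q with rfl | h2
      · exact ⟨_, _, tltq⟩
      exact ⟨_, _, tlt n h1 h2⟩
    · by_cases h3 : t n = n
      · exact ⟨_, _, tufs n h3⟩
      · exact ⟨_, _, tuf n h3⟩
    · exact ⟨_, _, tut n⟩
  · rintro ⟨(_ | _), n⟩
    · exact tlf n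
    · exact tut n

/-- This is the straightening of a zigzag, the geometric reason for `e s e = e`: the inner arcs at
`p, q` and at `x, q` join the lower strand at `x` to the upper strand at `x`. -/
theorem matching_swap_comp_swap {p q x : Label r s} (h : (p : ℕ) ≤ r ↔ ¬ (q : ℕ) ≤ r)
    (hx : (p : ℕ) ≤ r ↔ (x : ℕ) ≤ r) (hpx : p ≠ x) :
    comp (matching (Equiv.swap p q) (.swap h)) (below (perm (Equiv.swap p x) (.swap hx))
      (perm_isVertical _ _) (matching (Equiv.swap p q) (.swap h))) =
      some (matching (Equiv.swap p q) (.swap h)) := by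
  set u := below (perm (Equiv.swap p x) (.swap hx)) (perm_isVertical _ _)
    (matching (Equiv.swap p q) (.swap h)) with hu
  set N := stack (matching (Equiv.swap p q) (.swap h)) u with hN
  have hpq : p ≠ q := by rintro rfl; exact iff_not_self h
  have hxq : x ≠ q := by rintro rfl; exact iff_not_self (hx.symm.trans h)
  have hw : ∀ y, N.word y = [] := by
    rintro (v | v)
    · rfl
    · simp [hN, stack, hu, below_beads, belowHead, belowTail, perm, matching]
  have m1 : ∀ b n, n ≠ p → n ≠ q → N.mate (.inl (b, n)) = .inl (!b, n) := by
    intro b n h1 h2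
    simp [hN, stack, matching, Equiv.swap_apply_of_ne_of_ne h1 h2]
  have m1p : ∀ b, N.mate (.inl (b, p)) = .inl (b, q) := by
    intro b
    simp [hN, stack, matching, hpq.symm]
  have m1q : ∀ b, N.mate (.inl (b, q)) = .inl (b, p) := by
    intro b
    simp [hN, stack, matching, hpq]
  have u1 : N.mate (.inr (false, x)) = .inr (false, q) := by
    simp [hN, stack, hu, below_mate, belowIn, belowOut, perm, matching, hpq.symm,
      Equiv.swap_apply_of_ne_of_ne hpq.symm hxq.symm]
  have u2 : N.mate (.inr (false, q)) = .inr (false, x) := by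
    simp [hN, stack, hu, below_mate, belowIn, belowOut, perm, matching, hpq,
      Equiv.swap_apply_of_ne_of_ne hpq.symm hxq.symm]
  have u3 : N.mate (.inr (false, p)) = .inr (true, x) := by
    simp [hN, stack, hu, below_mate, belowIn, belowOut, perm, matching,
      Equiv.swap_apply_of_ne_of_ne hpx.symm hxq]
  have u4 : N.mate (.inr (true, x)) = .inr (false, p) := by
    simp [hN, stack, hu, below_mate, belowIn, belowOut, perm, matching,
      Equiv.swap_apply_of_ne_of_ne hpx.symm hxq]
  have u5 : N.mate (.inr (true, p)) = .inr (true, q) := by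
    simp [hN, stack, hu, below_mate, belowIn, belowOut, matching, hpq.symm]
  have u6 : N.mate (.inr (true, q)) = .inr (true, p) := by
    simp [hN, stack, hu, below_mate, belowIn, belowOut, matching, hpq]
  have u7 : ∀ b n, n ≠ p → n ≠ q → n ≠ x → N.mate (.inr (b, n)) = .inr (!b, n) := by
    intro b n h1 h2 h3
    cases b <;> simp [hN, stack, hu, below_mate, belowIn, belowOut, perm, matching,
      Equiv.swap_apply_of_ne_of_ne h1 h2, Equiv.swap_apply_of_ne_of_ne h1 h3]
  have e0 : ∀ n, n ≠ p → n ≠ q → N.Trace (.inl (true, n)) (.inl (false, n)) [] :=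
    fun n h1 h2 => Net.Trace.exit_of (m1 _ _ h1 h2) rfl (hw _)
  have e1 : N.Trace (.inr (false, p)) (.inr (true, x)) [] := Net.Trace.exit_of u3 rfl (hw _)
  have e2 : N.Trace (.inl (true, q)) (.inr (true, x)) [] :=
    Net.Trace.step_of (m1q _) rfl (hw _) e1
  -- The zigzag: from `x` to `q` in the upper layer, from `q` to `p` in the lower layer, and from
  -- `p` up to `x`.
  have e3 : N.Trace (.inr (false, x)) (.inr (true, x)) [] := Net.Trace.step_of u1 rfl (hw _) e2
  have e4 : N.Trace (.inr (false, q)) (.inl (false, x)) [] :=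
    Net.Trace.step_of u2 rfl (hw _) (e0 x hpx.symm hxq)
  have e5 : N.Trace (.inl (true, p)) (.inl (false, x)) [] :=
    Net.Trace.step_of (m1p _) rfl (hw _) e4
  have e6 : ∀ n, n ≠ p → n ≠ q → n ≠ x → N.Trace (.inr (false, n)) (.inr (true, n)) [] :=
    fun n h1 h2 h3 => Net.Trace.exit_of (u7 _ n h1 h2 h3) rfl (hw _)
  have tlf : ∀ n, N.Trace (.inl (false, n))
      (outer ((matching (Equiv.swap p q) (.swap h)).mate (false, n))) [] := by
    intro n
    rcases eq_or_ne n p with rfl | h1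
    · have := Net.Trace.exit_of (m1p false) rfl (hw _)
      simpa [matching, hpq.symm, outer] using this
    rcases eq_or_ne n q with rfl | h2
    · have := Net.Trace.exit_of (m1q false) rfl (hw _)
      simpa [matching, hpq, outer] using this
    have h4 : N.Trace (.inr (false, n)) (.inr (true, n)) [] := by
      rcases eq_or_ne n x with rfl | h3
      · exact e3
      · exact e6 n h1 h2 h3
    have := Net.Trace.step_of (m1 false n h1 h2) rfl (hw _) h4
    simpa [matching, Equiv.swap_apply_of_ne_of_ne h1 h2, outer] using this
  have tut : ∀ n, N.Trace (.inr (true, n))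
      (outer ((matching (Equiv.swap p q) (.swap h)).mate (true, n))) [] := by
    intro n
    rcases eq_or_ne n p with rfl | h1
    · have := Net.Trace.exit_of u5 rfl (hw _)
      simpa [matching, hpq.symm, outer] using this
    rcases eq_or_ne n q with rfl | h2
    · have := Net.Trace.exit_of u6 rfl (hw _)
      simpa [matching, hpq, outer] using this
    have h4 : N.Trace (.inr (true, n)) (.inl (false, n)) [] := by
      rcases eq_or_ne n x with rfl | h3
      · exact Net.Trace.step_of u4 rfl (hw _) e5
      · exact Net.Trace.step_of (u7 true n h1 h2 h3) rfl (hw _) (e0 n h1 h2)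
    simpa [matching, Equiv.swap_apply_of_ne_of_ne h1 h2, outer] using h4
  refine comp_eq_some_iff.2 ⟨?_, ?_, ?_⟩
  · rintro (⟨(_ | _), n⟩ | ⟨(_ | _), n⟩)
    · exact ⟨_, _, tlf n⟩
    · rcases eq_or_ne n p with rfl | h1
      · exact ⟨_, _, e5⟩
      rcases eq_or_ne n q with rfl | h2
      · exact ⟨_, _, e2⟩
      exact ⟨_, _, e0 n h1 h2⟩
    · rcases eq_or_ne n p with rfl | h1
      · exact ⟨_, _, e1⟩
      rcases eq_or_ne n q with rfl | h2
      · exact ⟨_, _, e4⟩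
      rcases eq_or_ne n x with rfl | h3
      · exact ⟨_, _, e3⟩
      exact ⟨_, _, e6 n h1 h2 h3⟩
    · exact ⟨_, _, tut n⟩
  · rintro ⟨(_ | _), n⟩
    · exact tlf n
    · exact tut n
  · rw [hu, below_num]; rfl

/-! The generating diagrams are of these forms. -/

theorem crossing_eq_perm (i : ℕ) (h : 1 ≤ i ∧ i < r + s ∧ i ≠ r) :
    (crossing i h : BeadDiagram r s) = perm (Equiv.swap ⟨i, h.1, h.2.1.le⟩
      ⟨i + 1, Nat.le_add_left 1 i, h.2.1⟩) (.swap (by simp only; lia)) := by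
  refine BeadDiagram.ext (funext fun v => ?_) rfl rfl
  rcases v with ⟨(_ | _), n⟩ <;> simp [crossing, perm]

theorem cupCap_eq_matching (h : 1 ≤ r ∧ 1 ≤ s) :
    (cupCap h : BeadDiagram r s) = matching (Equiv.swap ⟨r, by lia⟩ ⟨r + 1, by lia⟩)
      (.swap (by simp only; lia)) := by
  refine BeadDiagram.ext (funext fun v => ?_) rfl rfl
  rcases v with ⟨b, n, hn⟩
  simp only [cupCap, matching, Equiv.swap_apply_def, Subtype.mk.injEq]
  split_ifs <;> simp_all

end BeadDiagram

end WalledBrauerClifford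

namespace WalledBrauerClifford

namespace DiagramAlgebra

open BeadDiagram

variable {r s : ℕ}

/-! ### Relations between diagrams -/

theorem vertical_mul {x : BeadDiagram r s} (hx : x.IsVertical) (d : BeadDiagram r s) :
    ofDiagram x * ofDiagram d = ofDiagram (below x hx d) := by
  rw [ofDiagram_mul, comp_below hx]; rfl

theorem mul_vertical {x : BeadDiagram r s} (hx : x.IsVertical) (d : BeadDiagram r s) :
    ofDiagram d * ofDiagram x = ofDiagram (above x hx d) := by
  rw [ofDiagram_mul, comp_above hx]; rfl

theorem perm_mul_perm {g h : Equiv.Perm (Label r s)} (hg : PreservesSides g)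
    (hh : PreservesSides h) :
    ofDiagram (perm g hg) * ofDiagram (perm h hh) = ofDiagram (perm (g * h) (hg.mul hh)) := by
  rw [vertical_mul (perm_isVertical _ _), below_perm_perm]

theorem perm_one (h : PreservesSides (1 : Equiv.Perm (Label r s))) :
    ofDiagram (perm 1 h) = 1 := by
  rw [one_eq]
  congr 1
  refine BeadDiagram.ext (funext fun v => ?_) rfl rfl
  rcases v with ⟨(_ | _), n⟩ <;> rfl

theorem perm_inv_mul_perm {g : Equiv.Perm (Label r s)} (hg : PreservesSides g) :
    ofDiagram (perm g⁻¹ hg.inv) * ofDiagram (perm g hg) = 1 := by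
  rw [perm_mul_perm, ← perm_one .one]
  congr 2
  exact inv_mul_cancel g

theorem perm_mul_bead {g : Equiv.Perm (Label r s)} (hg : PreservesSides g) (n : Label r s) :
    ofDiagram (perm g hg) * ofDiagram (bead n.1 n.2) =
      ofDiagram (bead (g n).1 (g n).2) * ofDiagram (perm g hg) := by
  rw [vertical_mul (perm_isVertical _ _), vertical_mul (bead_isVertical _ _), below_perm_bead]

/-- The sandwich with `g` and its inverse is turned into a commutation rule by cancelling the
inverse; `h` says that `t'` is the conjugate of `t`. -/
theorem perm_mul_matching {g : Equiv.Perm (Label r s)} (hg : PreservesSides g)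
    {t t' : Label r s → Label r s} (ht : IsMatching t) (ht' : IsMatching t')
    (h : ∀ n, t' (g n) = g (t n)) :
    ofDiagram (perm g hg) * ofDiagram (matching t ht) =
      ofDiagram (matching t' ht') * ofDiagram (perm g hg) := by
  rw [← below_perm_matching_perm g hg hg.inv t t' ht ht' h, ← mul_vertical, ← vertical_mul,
    mul_assoc, perm_inv_mul_perm, mul_one]

theorem matching_swap_mul {p q : Label r s} (h : (p : ℕ) ≤ r ↔ ¬ (q : ℕ) ≤ r)
    {t : Label r s → Label r s} (ht : IsMatching t) (hp : t p = p) (hq : t q = q)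
    (ht' : IsMatching (Equiv.swap p q ∘ t)) :
    ofDiagram (matching (Equiv.swap p q) (.swap h)) * ofDiagram (matching t ht) =
      ofDiagram (matching _ ht') := by
  rw [ofDiagram_mul, matching_swap_comp h ht hp hq ht']; rfl

theorem isMatching_swap_comp {p q : Label r s} (h : (p : ℕ) ≤ r ↔ ¬ (q : ℕ) ≤ r)
    {t : Label r s → Label r s} (ht : IsMatching t) (hp : t p = p) (hq : t q = q) :
    IsMatching (Equiv.swap p q ∘ t) := by
  have key : ∀ n, n ≠ p → n ≠ q → t n ≠ p ∧ t n ≠ q := by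
    intro n h1 h2
    constructor
    · intro h3; rw [← ht.invol n, h3, hp] at h1; exact h1 rfl
    · intro h3; rw [← ht.invol n, h3, hq] at h2; exact h2 rfl
  constructor
  · intro n
    rcases eq_or_ne n p with rfl | h1
    · simp [hp, hq]
    rcases eq_or_ne n q with rfl | h2
    · simp [hp, hq]
    obtain ⟨h3, h4⟩ := key n h1 h2
    simp [Equiv.swap_apply_of_ne_of_ne h3 h4, ht.invol, Equiv.swap_apply_of_ne_of_ne h1 h2]
  · intro n hn
    rcases eq_or_ne n p with rfl | h1
    · simp only [Function.comp_apply, hp, Equiv.swap_apply_left]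
      tauto
    rcases eq_or_ne n q with rfl | h2
    · simp only [Function.comp_apply, hq, Equiv.swap_apply_right]
      exact h
    obtain ⟨h3, h4⟩ := key n h1 h2
    simp only [Function.comp_apply, Equiv.swap_apply_of_ne_of_ne h3 h4] at hn ⊢
    exact ht.sides n hn

/-- Either product is the diagram that contains both arcs in each row; this is the same diagram
because disjoint transpositions commute. -/
theorem matching_comm {p q p' q' : Label r s} (h : (p : ℕ) ≤ r ↔ ¬ (q : ℕ) ≤ r)
    (h' : (p' : ℕ) ≤ r ↔ ¬ (q' : ℕ) ≤ r) (hpp : p ≠ p') (hpq : p ≠ q') (hqp : q ≠ p')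
    (hqq : q ≠ q') :
    ofDiagram (matching (Equiv.swap p q) (.swap h)) *
        ofDiagram (matching (Equiv.swap p' q') (.swap h')) =
      ofDiagram (matching (Equiv.swap p' q') (.swap h')) *
        ofDiagram (matching (Equiv.swap p q) (.swap h)) := by
  have e1 := Equiv.swap_apply_of_ne_of_ne hpp hpq
  have e2 := Equiv.swap_apply_of_ne_of_ne hqp hqq
  have e3 := Equiv.swap_apply_of_ne_of_ne hpp.symm hqp.symm
  have e4 := Equiv.swap_apply_of_ne_of_ne hpq.symm hqq.symm
  rw [matching_swap_mul h (.swap h') e1 e2 (isMatching_swap_comp h (.swap h') e1 e2),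
    matching_swap_mul h' (.swap h) e3 e4 (isMatching_swap_comp h' (.swap h) e3 e4)]
  congr 2
  have hd : (Equiv.swap p q).Disjoint (Equiv.swap p' q') := by
    intro n
    simp only [Equiv.swap_apply_def]
    split_ifs <;> simp_all
  exact congrArg (fun f : Equiv.Perm (Label r s) => (f : Label r s → Label r s)) hd.commute

theorem matching_swap_perm_matching {p q x : Label r s} (h : (p : ℕ) ≤ r ↔ ¬ (q : ℕ) ≤ r)
    (hx : (p : ℕ) ≤ r ↔ (x : ℕ) ≤ r) (hpx : p ≠ x) :
    ofDiagram (matching (Equiv.swap p q) (.swap h)) *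
        ofDiagram (perm (Equiv.swap p x) (.swap hx)) *
        ofDiagram (matching (Equiv.swap p q) (.swap h)) =
      ofDiagram (matching (Equiv.swap p q) (.swap h)) := by
  rw [mul_assoc, vertical_mul (perm_isVertical _ _), ofDiagram_mul,
    matching_swap_comp_swap h hx hpx]
  rfl

theorem matching_swap_sq {p q : Label r s} (h : (p : ℕ) ≤ r ↔ ¬ (q : ℕ) ≤ r) :
    ofDiagram (matching (Equiv.swap p q) (.swap h)) *
      ofDiagram (matching (Equiv.swap p q) (.swap h)) = 0 := by
  have hpq : p ≠ q := by rintro rfl; exact iff_not_self h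
  rw [ofDiagram_mul, comp_eq_none (p := p) (q := q)]
  · rfl
  · simp [matching, hpq.symm]
  · simp [matching, hpq]

/-- A closed loop makes the product zero whether or not there is a bead on it, so `n` may be any
label. -/
theorem matching_swap_bead_matching {p q : Label r s} (h : (p : ℕ) ≤ r ↔ ¬ (q : ℕ) ≤ r)
    (n : Label r s) :
    ofDiagram (matching (Equiv.swap p q) (.swap h)) * ofDiagram (bead n.1 n.2) *
      ofDiagram (matching (Equiv.swap p q) (.swap h)) = 0 := by
  have hpq : p ≠ q := by rintro rfl; exact iff_not_self h
  rw [mul_vertical (bead_isVertical _ _), ofDiagram_mul, comp_eq_none (p := p) (q := q)]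
  · rfl
  · simp [above_mate, aboveIn, aboveOut, bead, matching, hpq.symm]
  · simp [matching, hpq]

/-- In the bottom row `p` and `q` are the two ends of one strand without other beads, so a bead
attached at either end gives the same diagram. -/
theorem bead_mul_matching_swap {p q : Label r s} (h : (p : ℕ) ≤ r ↔ ¬ (q : ℕ) ≤ r) :
    ofDiagram (bead p.1 p.2) * ofDiagram (matching (Equiv.swap p q) (.swap h)) =
      ofDiagram (bead q.1 q.2) * ofDiagram (matching (Equiv.swap p q) (.swap h)) := by
  have hpq : p ≠ q := by rintro rfl; exact iff_not_self h
  rw [vertical_mul (bead_isVertical _ _), vertical_mul (bead_isVertical _ _)]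
  congr 1
  refine BeadDiagram.ext (funext fun v => ?_) (funext fun v => ?_) ?_
  · rw [below_mate, below_mate]; rfl
  · rw [below_beads, below_beads]
    rcases v with ⟨(_ | _), n⟩
    · rcases eq_or_ne n p with rfl | h1
      · simp [belowIn, belowHead, belowTail, bead, matching, hpq.symm, ← Subtype.ext_iff, hpq]
      rcases eq_or_ne n q with rfl | h2
      · simp [belowIn, belowHead, belowTail, bead, matching, hpq.symm, ← Subtype.ext_iff, hpq]
      simp [belowIn, belowHead, belowTail, bead, matching, ← Subtype.ext_iff, h1, h2,
        Equiv.swap_apply_of_ne_of_ne h1 h2]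
    · rcases eq_or_ne n p with rfl | h1
      · simp [belowIn, belowHead, belowTail, bead, matching, hpq.symm]
      rcases eq_or_ne n q with rfl | h2
      · simp [belowIn, belowHead, belowTail, bead, matching, hpq]
      simp [belowIn, belowHead, belowTail, bead, matching, ← Subtype.ext_iff, h1, h2,
        Equiv.swap_apply_of_ne_of_ne h1 h2]
  · rw [below_num, below_num]; rfl

theorem matching_swap_mul_bead {p q : Label r s} (h : (p : ℕ) ≤ r ↔ ¬ (q : ℕ) ≤ r) :
    ofDiagram (matching (Equiv.swap p q) (.swap h)) * ofDiagram (bead p.1 p.2) =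
      ofDiagram (matching (Equiv.swap p q) (.swap h)) * ofDiagram (bead q.1 q.2) := by
  have hpq : p ≠ q := by rintro rfl; exact iff_not_self h
  rw [mul_vertical (bead_isVertical _ _), mul_vertical (bead_isVertical _ _)]
  congr 1
  refine BeadDiagram.ext (funext fun v => ?_) (funext fun v => ?_) ?_
  · rw [above_mate, above_mate]; rfl
  · rw [above_beads, above_beads]
    rcases v with ⟨(_ | _), n⟩
    · rcases eq_or_ne n p with rfl | h1
      · simp [aboveIn, aboveHead, aboveTail, bead, matching, hpq.symm]
      rcases eq_or_ne n q with rfl | h2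
      · simp [aboveIn, aboveHead, aboveTail, bead, matching, hpq]
      simp [aboveIn, aboveHead, aboveTail, bead, matching, ← Subtype.ext_iff, h1, h2,
        Equiv.swap_apply_of_ne_of_ne h1 h2]
    · rcases eq_or_ne n p with rfl | h1
      · simp [aboveIn, aboveHead, aboveTail, bead, matching, hpq.symm, ← Subtype.ext_iff, hpq]
      rcases eq_or_ne n q with rfl | h2
      · simp [aboveIn, aboveHead, aboveTail, bead, matching, hpq.symm, ← Subtype.ext_iff, hpq]
      simp [aboveIn, aboveHead, aboveTail, bead, matching, ← Subtype.ext_iff, h1, h2,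
        Equiv.swap_apply_of_ne_of_ne h1 h2]
  · rw [above_num, above_num]; rfl

theorem matching_mul_bead {t : Label r s → Label r s} (ht : IsMatching t) {n : Label r s}
    (hn : t n = n) :
    ofDiagram (matching t ht) * ofDiagram (bead n.1 n.2) =
      ofDiagram (bead n.1 n.2) * ofDiagram (matching t ht) := by
  rw [mul_vertical (bead_isVertical _ _), vertical_mul (bead_isVertical _ _)]
  congr 1
  refine BeadDiagram.ext (funext fun v => ?_) (funext fun v => ?_) ?_
  · rw [above_mate, below_mate]
    rcases v with ⟨b, m⟩
    by_cases hm : t m = m <;> cases b <;>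
      simp [aboveIn, aboveOut, belowIn, belowOut, bead, matching, hm]
  · rw [above_beads, below_beads]
    rcases v with ⟨b, m⟩
    by_cases hm : t m = m
    · cases b <;> simp [aboveIn, aboveHead, aboveTail, belowIn, belowHead, belowTail, bead,
        matching, hm]
    · have h1 : m ≠ n := by rintro rfl; exact hm hn
      have h2 : t m ≠ n := by intro h; rw [← h, ht.invol] at hn; exact hm hn.symm
      cases b <;> simp [aboveIn, aboveHead, aboveTail, belowIn, belowHead, belowTail, bead,
        matching, hm, ← Subtype.ext_iff, h1, h2]
  · rw [above_num, below_num]; rfl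

end DiagramAlgebra

end WalledBrauerClifford

namespace WalledBrauerClifford

open BeadDiagram DiagramAlgebra

variable {r s : ℕ}

/-! ### The homomorphism -/

namespace BD

theorem mk_eq_of_coe_eq {x y : BDSub r s} (h : (x : DiagramAlgebra r s) = y) :
    mk r s x = mk r s y := congrArg _ (Subtype.ext h)

theorem mk_eq_of_clifford {x : BDSub r s} (h : BDSub.CliffordElement r s x) : mk r s x = 0 := by
  rw [← map_zero (mk r s), mk_eq_iff, sub_zero]
  exact TwoSidedIdeal.subset_span h

variable (r s) in
/-- The homomorphism from the free algebra to the subalgebra generated by diagrams. -/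
noncomputable def freeMap : FreeAlgebra ℂ (Gen r s) →ₐ[ℂ] BDSub r s :=
  FreeAlgebra.lift ℂ BDSub.gen

theorem freeMap_s (i h) : (freeMap r s (fs i h) : DiagramAlgebra r s) =
    ofDiagram (crossing i h) := by
  rw [fs, freeMap, FreeAlgebra.lift_ι_apply]; rfl

theorem freeMap_e (h) : (freeMap r s (fe h) : DiagramAlgebra r s) = ofDiagram (cupCap h) := by
  rw [fe, freeMap, FreeAlgebra.lift_ι_apply]; rfl

theorem freeMap_c (i h) : freeMap r s (fc i h) = BDSub.c i h := by
  rw [fc, freeMap, FreeAlgebra.lift_ι_apply]; rfl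

theorem coe_freeMap_c (n : Label r s) : (freeMap r s (fc n.1 n.2) : DiagramAlgebra r s) =
    ofDiagram (bead n.1 n.2) := by
  rw [freeMap_c]; rfl

theorem swap_braid {α : Type} [DecidableEq α] {a b c : α} (hab : a ≠ b) (hac : a ≠ c)
    (hbc : b ≠ c) : Equiv.swap a b * Equiv.swap b c * Equiv.swap a b =
      Equiv.swap b c * Equiv.swap a b * Equiv.swap b c := by
  ext x
  simp only [Equiv.Perm.mul_apply, Equiv.swap_apply_def]
  split_ifs <;> simp_all

theorem crossing_sq (j hj) :
    ofDiagram (crossing (r := r) (s := s) j hj) * ofDiagram (crossing j hj) = 1 := by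
  rw [crossing_eq_perm, perm_mul_perm, ← perm_one .one]
  congr 2
  exact Equiv.swap_mul_self _ _

/-- Conjugating the arc at the wall by both crossings moves it to the labels next to it on either
side. Both sides of the relation are products of this moved arc with the arc at the wall, and the
two are disjoint, hence commute. -/
theorem crossing_cupCap_comm {i s : ℕ} (h : 1 ≤ i + 1 ∧ 1 ≤ s)
    (hi : 1 ≤ i ∧ i < i + 1 + s ∧ i ≠ i + 1)
    (hr : 1 ≤ i + 1 + 1 ∧ i + 1 + 1 < i + 1 + s ∧ i + 1 + 1 ≠ i + 1) :
    ofDiagram (crossing i hi) * ofDiagram (crossing (i + 1 + 1) hr) * ofDiagram (cupCap h) *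
        ofDiagram (crossing (i + 1 + 1) hr) * ofDiagram (crossing i hi) * ofDiagram (cupCap h) =
      ofDiagram (cupCap h) * ofDiagram (crossing i hi) * ofDiagram (crossing (i + 1 + 1) hr) *
        ofDiagram (cupCap h) * ofDiagram (crossing (i + 1 + 1) hr) * ofDiagram (crossing i hi) := by
  -- Here `x` is the moved arc, with ends `i` and `i + 3`; the wall lies between `i + 1` and `i +
  -- 2`.
  obtain ⟨x, hx1, hx2⟩ : ∃ x : DiagramAlgebra (i + 1) s,
      ofDiagram (crossing i hi) * ofDiagram (crossing (i + 1 + 1) hr) * ofDiagram (cupCap h) =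
        x * (ofDiagram (crossing i hi) * ofDiagram (crossing (i + 1 + 1) hr)) ∧
      x * ofDiagram (cupCap h) = ofDiagram (cupCap h) * x := by
    let p : Label (i + 1) s := ⟨i + 1, by lia⟩
    let q : Label (i + 1) s := ⟨i + 1 + 1, by lia⟩
    let p' : Label (i + 1) s := ⟨i, by lia⟩
    let q' : Label (i + 1) s := ⟨i + 1 + 1 + 1, by lia⟩
    have ne : p ≠ q ∧ p ≠ p' ∧ p ≠ q' ∧ q ≠ p' ∧ q ≠ q' ∧ p' ≠ q' := by
      simp only [p, q, p', q', ne_eq, Subtype.mk.injEq]; lia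
    obtain ⟨n1, n2, n3, n4, n5, n6⟩ := ne
    have h' : (p' : ℕ) ≤ i + 1 ↔ ¬ (q' : ℕ) ≤ i + 1 := by simp only [p', q']; lia
    refine ⟨ofDiagram (matching _ (.swap h')), ?_, ?_⟩
    · rw [crossing_eq_perm, crossing_eq_perm, cupCap_eq_matching, perm_mul_perm]
      refine perm_mul_matching _ _ _ fun n => ?_
      have e := Equiv.mul_swap_eq_swap_mul (Equiv.swap p' p * Equiv.swap q q') p q
      have e1 : (Equiv.swap p' p * Equiv.swap q q') p = p' := by
        rw [Equiv.Perm.mul_apply, Equiv.swap_apply_of_ne_of_ne n1 n3, Equiv.swap_apply_right]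
      have e2 : (Equiv.swap p' p * Equiv.swap q q') q = q' := by
        rw [Equiv.Perm.mul_apply, Equiv.swap_apply_left,
          Equiv.swap_apply_of_ne_of_ne n6.symm n3.symm]
      rw [e1, e2] at e
      exact congrArg (fun f : Equiv.Perm (Label (i + 1) s) => f n) e.symm
    · rw [cupCap_eq_matching]
      exact matching_comm h' (by simp only; lia) n2.symm n4.symm n3.symm n5.symm
  have ha := crossing_sq i hi
  have hb := crossing_sq (i + 1 + 1) hr
  generalize ofDiagram (crossing i hi) = a at *
  generalize ofDiagram (crossing (i + 1 + 1) hr) = b at *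
  generalize ofDiagram (cupCap h) = e at *
  have hx3 : a * b * e * b * a = x := by
    rw [hx1, mul_assoc x, mul_assoc a, hb, mul_one, mul_assoc x, ha, mul_one]
  rw [hx3, hx2]
  nth_rewrite 1 [← hx3]
  simp only [mul_assoc]

/-- Only the two kinds of Clifford squares and the anticommutation of the `c i` need the ideal;
every other relation is already an identity between diagrams. -/
theorem freeMap_rel {x y : FreeAlgebra ℂ (Gen r s)} (h : BCRel r s x y) :
    mk r s (freeMap r s x) = mk r s (freeMap r s y) := by
  cases h with
  | s_sq i hi =>
    apply mk_eq_of_coe_eq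
    rw [map_mul, map_one, Subalgebra.coe_mul, Subalgebra.coe_one, freeMap_s, crossing_eq_perm,
      perm_mul_perm, ← perm_one .one]
    congr 2
    exact Equiv.swap_mul_self _ _
  | braid i hi hi' =>
    apply mk_eq_of_coe_eq
    simp only [map_mul, Subalgebra.coe_mul, freeMap_s, crossing_eq_perm, perm_mul_perm]
    congr 2
    exact swap_braid (by simp) (by simp; lia) (by simp)
  | s_comm i j hi hj hij =>
    apply mk_eq_of_coe_eq
    simp only [map_mul, Subalgebra.coe_mul, freeMap_s, crossing_eq_perm, perm_mul_perm]
    congr 2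
    refine Equiv.Perm.Disjoint.commute fun n => ?_
    simp only [Equiv.swap_apply_def]
    split_ifs <;> simp_all <;> lia
  | e_sq h =>
    apply mk_eq_of_coe_eq
    simp only [map_mul, map_zero, Subalgebra.coe_mul, freeMap_e, cupCap_eq_matching]
    exact matching_swap_sq (p := ⟨r, by lia⟩) (q := ⟨r + 1, by lia⟩) (by simp only; lia)
  | e_s_comm h j hj h1 h2 =>
    apply mk_eq_of_coe_eq
    simp only [map_mul, Subalgebra.coe_mul, freeMap_e, freeMap_s, crossing_eq_perm,
      cupCap_eq_matching]
    refine (perm_mul_matching _ _ _ fun n => ?_).symm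
    have hd : (Equiv.swap (⟨r, by lia⟩ : Label r s) ⟨r + 1, by lia⟩).Disjoint
        (Equiv.swap ⟨j, hj.1, hj.2.1.le⟩ ⟨j + 1, Nat.le_add_left 1 j, hj.2.1⟩) := by
      intro n
      simp only [Equiv.swap_apply_def]
      split_ifs <;> simp_all
    exact congrArg (fun f : Equiv.Perm (Label r s) => f n) hd.commute
  | e_s_e_left h i hi hir =>
    apply mk_eq_of_coe_eq
    subst hir
    simp only [map_mul, Subalgebra.coe_mul, freeMap_e, freeMap_s, crossing_eq_perm,
      cupCap_eq_matching]
    refine (Eq.trans ?_ (matching_swap_perm_matching (p := ⟨i + 1, by lia⟩)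
      (q := ⟨i + 1 + 1, by lia⟩) (x := ⟨i, by lia⟩) (by simp) (by simp) (by simp))).symm
    simp only [Equiv.swap_comm]
  | e_s_e_right h hr =>
    apply mk_eq_of_coe_eq
    simp only [map_mul, Subalgebra.coe_mul, freeMap_e, freeMap_s, crossing_eq_perm,
      cupCap_eq_matching]
    -- The zigzag is now on the right of the wall, so the roles of `p` and `q` are interchanged.
    have := matching_swap_perm_matching (p := (⟨r + 1, by lia⟩ : Label r s))
      (q := ⟨r, by lia⟩) (x := ⟨r + 1 + 1, by lia⟩) (by simp) (by simp) (by simp)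
    have e := Equiv.swap_comm (⟨r, by lia⟩ : Label r s) ⟨r + 1, by lia⟩
    simp only [e]
    exact this.symm
  | e_e h i hi hr hir =>
    apply mk_eq_of_coe_eq
    subst hir
    simp only [map_mul, Subalgebra.coe_mul, freeMap_e, freeMap_s]
    exact crossing_cupCap_comm h hi hr
  | c_sq_left i hi hir =>
    rw [← sub_eq_zero, ← map_sub]
    convert mk_eq_of_clifford (BDSub.CliffordElement.sq_left i hi hir) using 2
    rw [map_mul, map_neg, map_one, freeMap_c, pow_two, sub_neg_eq_add]
  | c_sq_right i hi hir =>
    rw [← sub_eq_zero, ← map_sub]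
    convert mk_eq_of_clifford (BDSub.CliffordElement.sq_right i hi hir) using 2
    rw [map_mul, map_one, freeMap_c, pow_two]
  | c_anticomm i j hi hj hij =>
    rw [← sub_eq_zero, ← map_sub]
    convert mk_eq_of_clifford (BDSub.CliffordElement.anticomm i j hi hj hij) using 2
    rw [map_neg, map_mul, map_mul, freeMap_c, freeMap_c, sub_neg_eq_add]
  | s_c_s i hi hc hc' =>
    apply mk_eq_of_coe_eq
    have e1 := coe_freeMap_c (⟨i, hc⟩ : Label r s)
    have e2 := coe_freeMap_c (⟨i + 1, hc'⟩ : Label r s)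
    simp only [map_mul, Subalgebra.coe_mul, freeMap_s, crossing_eq_perm, e1, e2]
    have := perm_mul_bead (g := Equiv.swap (⟨i, hc⟩ : Label r s) ⟨i + 1, hc'⟩)
      (.swap (by simp only; lia)) ⟨i, hc⟩
    rw [this, mul_assoc, perm_mul_perm, Equiv.swap_apply_left]
    convert mul_one _
    rw [← perm_one .one]
    congr 2
    exact Equiv.swap_mul_self _ _
  | s_c_comm i j hi hj h1 h2 =>
    apply mk_eq_of_coe_eq
    have e1 := coe_freeMap_c (⟨j, hj⟩ : Label r s)
    simp only [map_mul, Subalgebra.coe_mul, freeMap_s, crossing_eq_perm, e1]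
    have := perm_mul_bead (g := Equiv.swap (⟨i, hi.1, hi.2.1.le⟩ : Label r s)
      ⟨i + 1, Nat.le_add_left 1 i, hi.2.1⟩) (.swap (by simp only; lia)) ⟨j, hj⟩
    rwa [Equiv.swap_apply_of_ne_of_ne (by simpa using h1) (by simpa using h2)] at this
  | c_e h h1 h2 =>
    apply mk_eq_of_coe_eq
    have e1 := coe_freeMap_c (⟨r, h1⟩ : Label r s)
    have e2 := coe_freeMap_c (⟨r + 1, h2⟩ : Label r s)
    simp only [map_mul, Subalgebra.coe_mul, freeMap_e, cupCap_eq_matching, e1, e2]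
    exact bead_mul_matching_swap (p := ⟨r, h1⟩) (q := ⟨r + 1, h2⟩) (by simp only; lia)
  | e_c h h1 h2 =>
    apply mk_eq_of_coe_eq
    have e1 := coe_freeMap_c (⟨r, h1⟩ : Label r s)
    have e2 := coe_freeMap_c (⟨r + 1, h2⟩ : Label r s)
    simp only [map_mul, Subalgebra.coe_mul, freeMap_e, cupCap_eq_matching, e1, e2]
    exact matching_swap_mul_bead (p := ⟨r, h1⟩) (q := ⟨r + 1, h2⟩) (by simp only; lia)
  | e_c_e h h1 =>
    apply mk_eq_of_coe_eq
    have e1 := coe_freeMap_c (⟨r, h1⟩ : Label r s)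
    simp only [map_mul, map_zero, Subalgebra.coe_mul, Subalgebra.coe_zero, freeMap_e,
      cupCap_eq_matching, e1]
    exact matching_swap_bead_matching (p := ⟨r, by lia⟩) (q := ⟨r + 1, by lia⟩)
      (by simp only; lia) ⟨r, h1⟩
  | e_c_comm h j hj h1 h2 =>
    apply mk_eq_of_coe_eq
    have e1 := coe_freeMap_c (⟨j, hj⟩ : Label r s)
    simp only [map_mul, Subalgebra.coe_mul, freeMap_e, cupCap_eq_matching, e1]
    refine matching_mul_bead (n := ⟨j, hj⟩) _ ?_
    rw [Equiv.swap_apply_of_ne_of_ne (by simpa using h1) (by simpa using h2)]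

end BD

variable (r s) in
/-- The homomorphism from the walled Brauer–Clifford superalgebra to the bead diagram algebra. -/
noncomputable def toBD : BC r s →ₐ[ℂ] BD r s :=
  BC.lift ((BD.mk r s).comp (BD.freeMap r s)) fun _ _ h => BD.freeMap_rel h

theorem toBD_mk (x : FreeAlgebra ℂ (Gen r s)) :
    toBD r s (BC.mk r s x) = BD.mk r s (BD.freeMap r s x) := BC.lift_mk _ _ x

theorem toBD_gen (g : Gen r s) : toBD r s (BC.gen g) = BD.mk r s (BDSub.gen g) := by
  rw [BC.gen, toBD_mk, BD.freeMap, FreeAlgebra.lift_ι_apply]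

/-! ### Surjectivity and parity -/

theorem freeMap_surjective : Function.Surjective (BD.freeMap r s) := by
  rintro ⟨x, hx⟩
  induction hx using Algebra.adjoin_induction with
  | mem x hx =>
    obtain ⟨g, rfl⟩ := hx
    exact ⟨FreeAlgebra.ι ℂ g, by rw [BD.freeMap, FreeAlgebra.lift_ι_apply]; rfl⟩
  | algebraMap a => exact ⟨algebraMap ℂ _ a, by rw [AlgHom.commutes]; rfl⟩
  | add x y hx hy ihx ihy =>
    obtain ⟨a, ha⟩ := ihx
    obtain ⟨b, hb⟩ := ihy
    exact ⟨a + b, by rw [map_add, ha, hb]; rfl⟩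
  | mul x y hx hy ihx ihy =>
    obtain ⟨a, ha⟩ := ihx
    obtain ⟨b, hb⟩ := ihy
    exact ⟨a * b, by rw [map_mul, ha, hb]; rfl⟩

theorem toBD_surjective : Function.Surjective (toBD r s) := by
  intro y
  obtain ⟨x, rfl⟩ := BD.mk_surjective y
  obtain ⟨z, rfl⟩ := freeMap_surjective x
  exact ⟨BC.mk r s z, toBD_mk z⟩

theorem toBD_sign (x : BC r s) : toBD r s (BC.sign x) = BD.sign (toBD r s x) := by
  have h := BC.mem_span_words x
  induction h using Submodule.span_induction with
  | mem x hx =>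
    obtain ⟨w, rfl⟩ := hx
    induction w with
    | nil => simp
    | cons g w ih =>
      rw [List.map_cons, List.prod_cons, map_mul, map_mul, map_mul, map_mul, ih]
      congr 1
      rw [BC.sign_gen, map_smul, toBD_gen, BD.sign_mk, ← map_smul]
      congr 1
      apply Subtype.ext
      rw [BDSub.coe_sign]
      change (-1 : ℂ) ^ g.parity.val • ofDiagram g.diagram = sign (ofDiagram g.diagram)
      rw [sign_ofDiagram]
      cases g <;> rfl
  | zero => simp
  | add x y _ _ hx hy => simp only [map_add, hx, hy]
  | smul a x _ hx => simp only [map_smul, hx]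

/-- Membership in a component is an eigenvalue equation for the parity automorphism. The map
intertwines these automorphisms, and injectivity lets the equation be pulled back. -/
theorem toBD_mem_grading (hinj : Function.Injective (toBD r s)) (i : ZMod 2) (x : BC r s) :
    x ∈ BC.grading r s i ↔ toBD r s x ∈ BD.grading r s i := by
  rw [BC.mem_grading_iff, BD.mem_grading_iff, ← toBD_sign, ← map_smul, hinj.eq_iff]

end WalledBrauerClifford

namespace WalledBrauerClifford

/-! ### The Coxeter presentation of the symmetric group -/

namespace Coxeter

variable {M : Type*} [Monoid M]

/-- The Coxeter relations for the elements `t 0, …, t (n - 2)`. -/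
structure Relations (n : ℕ) (t : ℕ → M) : Prop where
  sq : ∀ a, a + 1 < n → t a * t a = 1
  braid : ∀ a, a + 2 < n → t a * t (a + 1) * t a = t (a + 1) * t a * t (a + 1)
  comm : ∀ a b, a + 1 < b → b + 1 < n → t a * t b = t b * t a

/-- The product `t (k + m - 1) ⋯ t k`. -/
def descending (t : ℕ → M) (k : ℕ) : ℕ → M
  | 0 => 1
  | m + 1 => t (k + m) * descending t k m

theorem descending_succ (t : ℕ → M) (k m : ℕ) :
    descending t k (m + 1) = descending t (k + 1) m * t k := by
  induction m with
  | zero => simp [descending]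
  | succ m ih =>
    rw [descending, ih, descending, mul_assoc, show k + (m + 1) = k + 1 + m by lia]

namespace Relations

variable {n : ℕ} {t : ℕ → M}

theorem descending_comm_below (ht : Relations n t) {i k : ℕ} (hik : i + 1 < k) {m : ℕ}
    (hm : k + m < n) :
    descending t k m * t i = t i * descending t k m := by
  induction m with
  | zero => simp [descending]
  | succ m ih =>
    rw [descending, mul_assoc, ih (by lia), ← mul_assoc, ← ht.comm i (k + m) (by lia) (by lia),
      mul_assoc]

theorem descending_comm_above (ht : Relations n t) {i k m : ℕ} (hm : k + m < i) (hi : i + 1 < n) :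
    descending t k m * t i = t i * descending t k m := by
  induction m with
  | zero => simp [descending]
  | succ m ih =>
    rw [descending, mul_assoc, ih (by lia), ← mul_assoc, ht.comm (k + m) i (by lia) (by lia),
      mul_assoc]

/-- The letter `t (i + 1)` moves to the left until it meets `t (i + 1) * t i`; there the braid
relation turns it into `t i`, which commutes with the remaining larger letters. -/
theorem descending_shift (ht : Relations n t) {i k m : ℕ} (hki : k < i + 1) (him : i + 1 < k + m)
    (hm : k + m < n) :
    descending t k m * t (i + 1) = t i * descending t k m := by
  induction m with
  | zero => lia
  | succ m ih =>
    rcases lt_or_ge (i + 1) (k + m) with h | h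
    · rw [descending, mul_assoc, ih h (by lia), ← mul_assoc, ← ht.comm i (k + m) (by lia) (by lia),
        mul_assoc]
    · obtain ⟨m, rfl⟩ : ∃ m', m = m' + 1 := ⟨m - 1, by lia⟩
      obtain rfl : i = k + m := by lia
      rw [descending, descending, mul_assoc, mul_assoc, ht.descending_comm_above (by lia) (by lia),
        show k + (m + 1) = k + m + 1 by lia, ← mul_assoc, ← mul_assoc, ← ht.braid _ (by lia),
        mul_assoc, mul_assoc]

end Relations

/-- Coset representatives for the submonoid generated by all but the last generator. -/
theorem exists_descending {n : ℕ} {t : ℕ → M} (ht : Relations (n + 1) t) {x : M}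
    (hx : x ∈ Submonoid.closure {y | ∃ a, a + 1 < n + 1 ∧ t a = y}) :
    ∃ h ∈ Submonoid.closure {y | ∃ a, a + 1 < n ∧ t a = y}, ∃ k m, k + m = n ∧
      x = h * descending t k m := by
  induction hx using Submonoid.closure_induction_right with
  | one => exact ⟨1, one_mem _, n, 0, rfl, by simp [descending]⟩
  | mul_right x hx y hy ih =>
    obtain ⟨i, hi, rfl⟩ := hy
    obtain ⟨h, hh, k, m, hkm, rfl⟩ := ih
    have mem : ∀ a, a + 1 < n → h * t a ∈ Submonoid.closure {y | ∃ a, a + 1 < n ∧ t a = y} :=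
      fun a ha => mul_mem hh (Submonoid.subset_closure ⟨a, ha, rfl⟩)
    -- Multiplying a coset representative by `t i` lengthens it for `i + 1 = k` and shortens it for
    -- `i = k`. Otherwise the letter passes through it into the smaller submonoid, as `t i` if it
    -- lies below and as `t (i - 1)` if it lies above `k`.
    rcases lt_trichotomy (i + 1) k with hik | rfl | hik
    · refine ⟨_, mem i (by lia), k, m, hkm, ?_⟩
      rw [mul_assoc, ht.descending_comm_below hik (by lia), mul_assoc]
    · exact ⟨h, hh, i, m + 1, by lia, by rw [descending_succ, mul_assoc]⟩
    · rcases eq_or_ne i k with rfl | hne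
      · obtain ⟨m, rfl⟩ : ∃ m', m = m' + 1 := ⟨m - 1, by lia⟩
        refine ⟨h, hh, i + 1, m, by lia, ?_⟩
        rw [descending_succ, mul_assoc, mul_assoc, ht.sq i hi, mul_one]
      · obtain ⟨i, rfl⟩ : ∃ i', i = i' + 1 := ⟨i - 1, by lia⟩
        refine ⟨_, mem i (by lia), k, m, hkm, ?_⟩
        rw [mul_assoc, ht.descending_shift (by lia) (by lia) (by lia), mul_assoc]

/-- The adjacent transpositions. -/
def adjacent (N a : ℕ) : Equiv.Perm (Fin N) :=
  if h : a + 1 < N then Equiv.swap ⟨a, by lia⟩ ⟨a + 1, h⟩ else 1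

theorem adjacent_eq {N a : ℕ} (h : a + 1 < N) :
    adjacent N a = Equiv.swap ⟨a, by lia⟩ ⟨a + 1, h⟩ := dif_pos h

theorem adjacent_relations (N : ℕ) : Relations N (adjacent N) where
  sq a h := by rw [adjacent_eq h, Equiv.swap_mul_self]
  braid a h := by
    rw [adjacent_eq (a := a) (by lia), adjacent_eq (a := a + 1) (by lia)]
    exact BD.swap_braid (by simp) (by simp; lia) (by simp)
  comm a b h h' := by
    rw [adjacent_eq (a := a) (by lia), adjacent_eq h']
    refine Equiv.Perm.Disjoint.commute fun n => ?_
    simp only [Equiv.swap_apply_def]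
    split_ifs <;> simp_all <;> lia

theorem adjacent_fix {N n : ℕ} {σ : Equiv.Perm (Fin N)}
    (h : σ ∈ Submonoid.closure {y | ∃ a, a + 1 < n ∧ adjacent N a = y}) (j : Fin N)
    (hj : n ≤ j) : σ j = j := by
  induction h using Submonoid.closure_induction with
  | mem y hy =>
    obtain ⟨a, ha, rfl⟩ := hy
    rw [adjacent_eq (by lia), Equiv.swap_apply_of_ne_of_ne] <;>
      · intro h
        have := congrArg Fin.val h
        simp only at this
        lia
  | one => rfl
  | mul x y _ _ hx hy => rw [Equiv.Perm.mul_apply, hy, hx]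

theorem descending_adjacent {N k m : ℕ} (h : k + m < N) :
    descending (adjacent N) k m ⟨k, by lia⟩ = ⟨k + m, h⟩ := by
  induction m with
  | zero => rfl
  | succ m ih =>
    rw [descending, Equiv.Perm.mul_apply, ih (by lia), adjacent_eq (by lia), Equiv.swap_apply_left]
    rfl

theorem descending_map {M' : Type*} [Monoid M'] (f : M →* M') (t : ℕ → M) (k m : ℕ) :
    f (descending t k m) = descending (fun a => f (t a)) k m := by
  induction m with
  | zero => exact map_one f
  | succ m ih => rw [descending, map_mul, ih, descending]

/-- The submonoid generated by the pairs in `M × Perm` is the graph of a function, which is the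
presentation in disguise. The pairs satisfy the Coxeter relations themselves, so coset
representatives exist, and the permutation alone decides which one occurs. -/
theorem eq_of_snd_eq {N : ℕ} {t : ℕ → M} (ht : Relations N t) (n : ℕ) (hn : n ≤ N)
    {x y : M × Equiv.Perm (Fin N)}
    (hx : x ∈ Submonoid.closure {y | ∃ a, a + 1 < n ∧ (t a, adjacent N a) = y})
    (hy : y ∈ Submonoid.closure {y | ∃ a, a + 1 < n ∧ (t a, adjacent N a) = y})
    (h : x.2 = y.2) : x = y := by
  induction n generalizing x y with
  | zero =>
    have : {y | ∃ a, a + 1 < 0 ∧ (t a, adjacent N a) = y} = ∅ := by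
      ext y; simp
    rw [this, Submonoid.closure_empty, Submonoid.mem_bot] at hx hy
    rw [hx, hy]
  | succ n ih =>
    have ha := adjacent_relations N
    have hT : Relations (n + 1) (fun a => (t a, adjacent N a)) :=
      ⟨fun a h => Prod.ext (ht.sq a (by lia)) (ha.sq a (by lia)),
        fun a h => Prod.ext (ht.braid a (by lia)) (ha.braid a (by lia)),
        fun a b h h' => Prod.ext (ht.comm a b h (by lia)) (ha.comm a b h (by lia))⟩
    obtain ⟨g, hg, k, m, hkm, rfl⟩ := exists_descending hT hx
    obtain ⟨g', hg', k', m', hkm', rfl⟩ := exists_descending hT hy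
    have snd : ∀ k m, (descending (fun a => (t a, adjacent N a)) k m).2 =
        descending (adjacent N) k m := fun k m => 
          descending_map (MonoidHom.snd M (Equiv.Perm (Fin N))) (fun a => (t a, adjacent N a)) k m
    -- The index `k` is the preimage of `n`: the descending product takes `k` to `n`, and the factor
    -- `g` only moves smaller points.
    have top : ∀ g ∈ Submonoid.closure {y | ∃ a, a + 1 < n ∧ (t a, adjacent N a) = y}, ∀ k m,
        (h : k + m = n) → (g.2 * descending (adjacent N) k m) ⟨k, by lia⟩ = ⟨n, by lia⟩ := by
      intro g hg k m h
      rw [Equiv.Perm.mul_apply, descending_adjacent (by lia)]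
      have h2 : g.2 ∈ Submonoid.closure {y | ∃ a, a + 1 < n ∧ adjacent N a = y} := by
        have := Submonoid.mem_map_of_mem (MonoidHom.snd M (Equiv.Perm (Fin N))) hg
        rw [MonoidHom.map_mclosure] at this
        refine Submonoid.closure_mono ?_ this
        rintro _ ⟨_, ⟨a, ha, rfl⟩, rfl⟩
        exact ⟨a, ha, rfl⟩
      rw [adjacent_fix h2 _ (by simp only; lia)]
      exact Fin.ext h
    rw [Prod.snd_mul, Prod.snd_mul, snd, snd] at h
    have h1 := top g hg k m hkm
    have h2 := top g' hg' k' m' hkm'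
    rw [h, ← h2] at h1
    obtain rfl : k = k' := by simpa using h1
    obtain rfl : m = m' := by lia
    rw [ih (by lia) hg hg' (mul_right_cancel h)]

theorem adjacent_closure (N : ℕ) :
    Submonoid.closure {y | ∃ a, a + 1 < N ∧ adjacent N a = y} = ⊤ := by
  rcases N with _ | n
  · rw [eq_top_iff]
    intro σ _
    rw [Subsingleton.elim σ 1]
    exact one_mem _
  · rw [← Equiv.Perm.mclosure_swap_castSucc_succ n]
    congr 1
    ext y
    constructor
    · rintro ⟨a, ha, rfl⟩
      exact ⟨⟨a, by lia⟩, (adjacent_eq ha).symm⟩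
    · rintro ⟨a, rfl⟩
      exact ⟨a, by lia, adjacent_eq (by lia)⟩

/-- Elements that satisfy the Coxeter relations define a homomorphism from the symmetric group. -/
theorem exists_hom {N : ℕ} {t : ℕ → M} (ht : Relations N t) :
    ∃ f : Equiv.Perm (Fin N) →* M, ∀ a, a + 1 < N → f (adjacent N a) = t a := by
  -- The graph of the homomorphism. It projects onto the whole symmetric group because adjacent
  -- transpositions generate it.
  let H := Submonoid.closure {y | ∃ a, a + 1 < N ∧ (t a, adjacent N a) = y}
  have ex : ∀ σ : Equiv.Perm (Fin N), ∃ m, (m, σ) ∈ H := by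
    intro σ
    have hσ : σ ∈ Submonoid.closure {y | ∃ a, a + 1 < N ∧ adjacent N a = y} := by
      rw [adjacent_closure]; trivial
    induction hσ using Submonoid.closure_induction with
    | mem y hy =>
      obtain ⟨a, ha, rfl⟩ := hy
      exact ⟨t a, Submonoid.subset_closure ⟨a, ha, rfl⟩⟩
    | one => exact ⟨1, one_mem H⟩
    | mul x y _ _ hx hy =>
      obtain ⟨m, hm⟩ := hx
      obtain ⟨m', hm'⟩ := hy
      exact ⟨m * m', mul_mem hm hm'⟩
  choose f hf using ex
  have uniq : ∀ σ m, (m, σ) ∈ H → f σ = m := fun σ m hm =>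
    congrArg Prod.fst (eq_of_snd_eq ht N le_rfl (hf σ) hm rfl)
  exact ⟨{ toFun := f
           map_one' := uniq 1 1 (one_mem H)
           map_mul' := fun σ τ => uniq _ _ (mul_mem (hf σ) (hf τ)) },
    fun a ha => uniq _ _ (Submonoid.subset_closure ⟨a, ha, rfl⟩)⟩

theorem swap_mem {N : ℕ} {S : Submonoid (Equiv.Perm (Fin N))} {b : ℕ}
    (h : ∀ a, b ≤ a → a + 1 < N → adjacent N a ∈ S) {x y : Fin N} (hx : b ≤ x) (hxy : x < y) :
    Equiv.swap x y ∈ S := by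
  obtain ⟨y, hy⟩ := y
  induction y with
  | zero => exact absurd hxy (Nat.not_lt_zero _)
  | succ y ih =>
    have hy' := adjacent_eq hy
    have hxy' : (x : ℕ) ≤ y := Nat.lt_succ_iff.1 hxy
    have hm := h y (by lia) hy
    rcases hxy'.eq_or_lt with he | hlt
    · have : x = ⟨y, by lia⟩ := Fin.ext he
      rwa [this, ← hy']
    · have h1 := ih (by lia) hlt
      have h2 := mul_mem (mul_mem hm h1) hm
      have e := Equiv.mul_swap_eq_swap_mul (adjacent N y) x ⟨y, by lia⟩
      rw [e, mul_assoc, (adjacent_relations N).sq y hy, mul_one] at h2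
      rw [hy', Equiv.swap_apply_left, Equiv.swap_apply_of_ne_of_ne] at h2
      · exact h2
      · intro h
        exact hlt.ne (congrArg Fin.val h)
      · intro h
        have := congrArg Fin.val h
        simp only at this
        lia

/-- A permutation that fixes the first element is a product of the other adjacent
transpositions. -/
theorem mem_of_fix {N : ℕ} {S : Submonoid (Equiv.Perm (Fin N))}
    (h : ∀ a, 1 ≤ a → a + 1 < N → adjacent N a ∈ S) (σ : Equiv.Perm (Fin N))
    (hσ : ∀ x : Fin N, (x : ℕ) = 0 → σ x = x) : σ ∈ S := by
  induction hn : σ.support.card using Nat.strong_induction_on generalizing σ with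
  | _ n ih =>
    by_cases h1 : σ = 1
    · rw [h1]; exact one_mem S
    · obtain ⟨x, hx⟩ : ∃ x, σ x ≠ x := by
        by_contra hc
        push Not at hc
        exact h1 (Equiv.ext hc)
      have hx0 : (x : ℕ) ≠ 0 := fun h0 => hx (hσ x h0)
      have hx1 : (σ x : ℕ) ≠ 0 := fun h0 => hx (σ.injective (hσ _ h0))
      -- Neither `x` nor `σ x` is the first element, so this transposition is available, and
      -- multiplying by it makes the support smaller.
      have hs : Equiv.swap x (σ x) ∈ S := by
        rcases lt_or_gt_of_ne hx with hlt | hlt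
        · rw [Equiv.swap_comm]; exact swap_mem h (by lia) hlt
        · exact swap_mem h (by lia) hlt
      have hr := ih _ (hn ▸ Equiv.Perm.card_support_swap_mul hx) (Equiv.swap x (σ x) * σ)
        (fun y hy => by
          rw [Equiv.Perm.mul_apply, hσ y hy, Equiv.swap_apply_of_ne_of_ne]
          · rintro rfl; exact hx0 hy
          · rintro rfl; exact hx1 hy) rfl
      have := mul_mem hs hr
      rwa [← mul_assoc, Equiv.swap_mul_self, one_mul] at this

end Coxeter

end WalledBrauerClifford

namespace WalledBrauerClifford

/-! ### Normal forms -/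

/-- The permutation of the strands given by a pair of permutations of the two sides. -/
def sideAct {r s : ℕ} (g : Equiv.Perm (Fin r) × Equiv.Perm (Fin s)) :
    Equiv.Perm (Fin r ⊕ Fin s) := Equiv.sumCongr g.1 g.2

/-- A monoid with zero that contains the products of permutations, commuting involutions `c x` and
arcs `e i j`. -/
structure ArcSystem (r s : ℕ) (Q : Type) [MonoidWithZero Q] where
  perm : Equiv.Perm (Fin r) × Equiv.Perm (Fin s) →* Q
  c : Fin r ⊕ Fin s → Q
  e : Fin r → Fin s → Q
  perm_c : ∀ g x, perm g * c x = c (sideAct g x) * perm g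
  perm_e : ∀ g i j, perm g * e i j = e (g.1 i) (g.2 j) * perm g
  c_sq : ∀ x, c x * c x = 1
  c_comm : ∀ x y, c x * c y = c y * c x
  e_sq : ∀ i j, e i j * e i j = 0
  e_c_e : ∀ i j, e i j * c (.inl i) * e i j = 0
  e_e_left : ∀ i i' j, i ≠ i' → e i j * e i' j = perm (Equiv.swap i i', 1) * e i' j
  e_e_right : ∀ i j j', j ≠ j' → e i j * e i j' = perm (1, Equiv.swap j j') * e i j'
  e_comm : ∀ i i' j j', i ≠ i' → j ≠ j' → e i j * e i' j' = e i' j' * e i j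
  c_e : ∀ i j, c (.inl i) * e i j = c (.inr j) * e i j
  e_c : ∀ i j, e i j * c (.inl i) = e i j * c (.inr j)
  e_c_comm : ∀ i j x, x ≠ .inl i → x ≠ .inr j → e i j * c x = c x * e i j

/-- No two arcs have a common end. -/
def ValidArcs {r s : ℕ} (P : List (Fin r × Fin s)) : Prop :=
  P.Pairwise fun p q => p.1 ≠ q.1 ∧ p.2 ≠ q.2

theorem ValidArcs.nodup {r s : ℕ} {P : List (Fin r × Fin s)} (h : ValidArcs P) : P.Nodup :=
  h.imp fun h he => h.1 (congrArg Prod.fst he)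

theorem ValidArcs.eq_of_fst {r s : ℕ} {P : List (Fin r × Fin s)} (h : ValidArcs P)
    {p q : Fin r × Fin s} (hp : p ∈ P) (hq : q ∈ P) (he : p.1 = q.1) : p = q := by
  by_contra hne
  have : Std.Symm fun p q : Fin r × Fin s => p.1 ≠ q.1 ∧ p.2 ≠ q.2 :=
    ⟨fun _ _ h => ⟨h.1.symm, h.2.symm⟩⟩
  exact (List.Pairwise.forall h hp hq hne).1 he

theorem ValidArcs.eq_of_snd {r s : ℕ} {P : List (Fin r × Fin s)} (h : ValidArcs P)
    {p q : Fin r × Fin s} (hp : p ∈ P) (hq : q ∈ P) (he : p.2 = q.2) : p = q := by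
  by_contra hne
  have : Std.Symm fun p q : Fin r × Fin s => p.1 ≠ q.1 ∧ p.2 ≠ q.2 :=
    ⟨fun _ _ h => ⟨h.1.symm, h.2.symm⟩⟩
  exact (List.Pairwise.forall h hp hq hne).2 he

namespace ArcSystem

variable {r s : ℕ} {Q : Type} [MonoidWithZero Q] (S : ArcSystem r s Q)

/-- The homomorphism that sends the nontrivial element to the involution `c x`. -/
def cHom (x : Fin r ⊕ Fin s) : Multiplicative (ZMod 2) →* Q where
  toFun a := if a = 1 then 1 else S.c x
  map_one' := if_pos rfl
  map_mul' a b := by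
    have key : ∀ a b : Multiplicative (ZMod 2), (a = 1 ∨ b = 1) ∨ (a ≠ 1 ∧ b ≠ 1 ∧ a * b = 1) := by
      decide
    rcases key a b with (rfl | rfl) | ⟨h1, h2, h3⟩
    · simp
    · simp
    · rw [if_pos h3, if_neg h1, if_neg h2, S.c_sq]

theorem cHom_comm :
    Pairwise fun x y => ∀ a b : Multiplicative (ZMod 2), Commute (S.cHom x a) (S.cHom y b) := by
  intro x y _ a b
  change (if a = 1 then 1 else S.c x) * (if b = 1 then 1 else S.c y) =
    (if b = 1 then 1 else S.c y) * (if a = 1 then 1 else S.c x)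
  split_ifs <;> simp [S.c_comm x y]

/-- Products of the elements `c x`. -/
def clif : (Fin r ⊕ Fin s → Multiplicative (ZMod 2)) →* Q :=
  MonoidHom.noncommPiCoprod S.cHom S.cHom_comm

/-- The nontrivial element. -/
abbrev odd : Multiplicative (ZMod 2) := Multiplicative.ofAdd 1

theorem eq_one_or_odd (a : Multiplicative (ZMod 2)) : a = 1 ∨ a = odd := by
  revert a; decide

theorem clif_single (x : Fin r ⊕ Fin s) : S.clif (Pi.mulSingle x odd) = S.c x := by
  rw [clif, MonoidHom.noncommPiCoprod_mulSingle]
  change (if odd = 1 then 1 else S.c x) = S.c x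
  exact if_neg (by decide)

theorem clif_induction {p : (Fin r ⊕ Fin s → Multiplicative (ZMod 2)) → Prop} (one : p 1)
    (mul : ∀ A B, p A → p B → p (A * B)) (single : ∀ x, p (Pi.mulSingle x odd))
    (A : Fin r ⊕ Fin s → Multiplicative (ZMod 2)) : p A := by
  refine Pi.mulSingle_induction p A one mul fun x a => ?_
  rcases eq_one_or_odd a with rfl | rfl
  · rwa [Pi.mulSingle_one]
  · exact single x

theorem clif_comm (A B : Fin r ⊕ Fin s → Multiplicative (ZMod 2)) :
    S.clif A * S.clif B = S.clif B * S.clif A := by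
  rw [← map_mul, mul_comm, map_mul]

theorem clif_sq (A : Fin r ⊕ Fin s → Multiplicative (ZMod 2)) : S.clif A * S.clif A = 1 := by
  rw [← map_mul, show A * A = 1 from ?_, map_one]
  funext x
  rcases eq_one_or_odd (A x) with h | h <;> rw [Pi.mul_apply, h] <;> rfl

theorem perm_clif (g : Equiv.Perm (Fin r) × Equiv.Perm (Fin s))
    (A : Fin r ⊕ Fin s → Multiplicative (ZMod 2)) :
    S.perm g * S.clif A = S.clif (A ∘ (sideAct g).symm) * S.perm g := by
  induction A using clif_induction with
  | one => simp [show (1 : Fin r ⊕ Fin s → Multiplicative (ZMod 2)) ∘ (sideAct g).symm = 1 from rfl]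
  | mul A B hA hB =>
    rw [map_mul, ← mul_assoc, hA, mul_assoc, hB, ← mul_assoc, ← map_mul]
    rfl
  | single x =>
    have : Pi.mulSingle x odd ∘ (sideAct g).symm = Pi.mulSingle (sideAct g x) odd := by
      funext y
      simp only [Function.comp_apply, Pi.mulSingle_apply, Equiv.symm_apply_eq]
    rw [this, clif_single, clif_single, S.perm_c]

/-- The product of the arcs in a list. -/
def arcs (P : List (Fin r × Fin s)) : Q := (P.map fun p => S.e p.1 p.2).prod

theorem arcs_cons (p : Fin r × Fin s) (P : List (Fin r × Fin s)) :
    S.arcs (p :: P) = S.e p.1 p.2 * S.arcs P := by simp [arcs]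

theorem arcs_perm {P P' : List (Fin r × Fin s)} (h : ValidArcs P) (hp : P.Perm P') :
    S.arcs P = S.arcs P' := by
  refine (hp.map _).prod_eq' ?_
  rw [List.pairwise_map]
  exact h.imp fun h => S.e_comm _ _ _ _ h.1 h.2

/-- Exchanging two arcs as a whole does nothing. This follows by letting the arc between `i'` and
`j` appear and disappear, using fusion at a common right end and then at a common left end. -/
theorem perm_swap_arcs {i i' : Fin r} {j j' : Fin s} (hi : i ≠ i') (hj : j ≠ j')
    (P : List (Fin r × Fin s)) :
    S.perm (Equiv.swap i i', Equiv.swap j j') * S.arcs ((i, j) :: (i', j') :: P) =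
      S.arcs ((i, j) :: (i', j') :: P) := by
  have h1 : S.e i j = S.perm (Equiv.swap i i', 1) * (S.e i' j * S.e i j) := by
    rw [S.e_e_left i' i j hi.symm, ← mul_assoc, ← map_mul, Prod.mk_mul_mk, Equiv.swap_comm i',
      Equiv.swap_mul_self, one_mul, ← Prod.one_eq_mk, map_one, one_mul]
  have h2 : S.e i j * S.e i' j' =
      S.perm (Equiv.swap i i', Equiv.swap j j') * (S.e i j * S.e i' j') := by
    calc S.e i j * S.e i' j'
        = S.perm (Equiv.swap i i', 1) * (S.e i' j * S.e i j) * S.e i' j' := by rw [← h1]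
      _ = S.perm (Equiv.swap i i', 1) * (S.e i' j * S.e i' j' * S.e i j) := by
        rw [mul_assoc, mul_assoc (S.e i' j), S.e_comm i i' j j' hi hj, mul_assoc (S.e i' j)]
      _ = S.perm (Equiv.swap i i', 1) * S.perm (1, Equiv.swap j j') *
          (S.e i' j' * S.e i j) := by
        rw [S.e_e_right i' j j' hj, mul_assoc, mul_assoc]
      _ = _ := by
        rw [← map_mul, Prod.mk_mul_mk, one_mul, mul_one, S.e_comm i i' j j' hi hj]
  rw [arcs_cons, arcs_cons, ← mul_assoc (S.e _ _), ← mul_assoc, ← h2]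

/-- A permutation that permutes the arcs and fixes everything else acts trivially. -/
theorem perm_mul_arcs {P : List (Fin r × Fin s)} (hP : ValidArcs P)
    (g : Equiv.Perm (Fin r) × Equiv.Perm (Fin s))
    (h : ∀ p ∈ P, (g.1 p.1, g.2 p.2) ∈ P) (h1 : ∀ i, (∀ p ∈ P, p.1 ≠ i) → g.1 i = i)
    (h2 : ∀ j, (∀ p ∈ P, p.2 ≠ j) → g.2 j = j) : S.perm g * S.arcs P = S.arcs P := by
  -- Induction on the support of the left permutation is enough, since the left end of an arc
  -- determines its right end. Composing with the exchange `t` of two arcs reduces this support.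
  induction hn : g.1.support.card using Nat.strong_induction_on generalizing g with
  | _ n ih =>
    by_cases hg : g.1 = 1
    · have hg2 : g.2 = 1 := by
        refine Equiv.ext fun j => ?_
        by_cases hj : ∀ p ∈ P, p.2 ≠ j
        · exact h2 j hj
        · push Not at hj
          obtain ⟨p, hp, rfl⟩ := hj
          have := h p hp
          rw [hg] at this
          exact congrArg Prod.snd (hP.eq_of_fst this hp rfl)
      rw [show g = 1 from Prod.ext hg hg2, map_one, one_mul]
    · obtain ⟨i, hi⟩ : ∃ i, g.1 i ≠ i := by
        by_contra hc
        push Not at hc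
        exact hg (Equiv.ext hc)
      obtain ⟨p, hp, rfl⟩ : ∃ p ∈ P, p.1 = i := by
        by_contra hc
        push Not at hc
        exact hi (h1 i hc)
      obtain ⟨i, j⟩ := p
      simp only at hi
      have hq := h _ hp
      simp only at hq
      have hj : j ≠ g.2 j := fun he => hi (congrArg Prod.fst (hP.eq_of_snd hq hp he.symm))
      obtain ⟨P', hP'⟩ : ∃ P', P.Perm ((i, j) :: (g.1 i, g.2 j) :: P') := by
        refine ⟨(P.erase (i, j)).erase (g.1 i, g.2 j), ?_⟩
        refine (List.perm_cons_erase hp).trans (.cons _ (List.perm_cons_erase ?_))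
        rw [List.mem_erase_of_ne (fun he => hi (congrArg Prod.fst he))]
        exact hq
      let t : Equiv.Perm (Fin r) × Equiv.Perm (Fin s) :=
        (Equiv.swap i (g.1 i), Equiv.swap j (g.2 j))
      have ht : S.perm t * S.arcs P = S.arcs P := by
        rw [S.arcs_perm hP hP']
        exact S.perm_swap_arcs hi.symm hj P'
      have htP : ∀ p ∈ P, (t.1 p.1, t.2 p.2) ∈ P := by
        rintro ⟨a, b⟩ hab
        by_cases ha : a = i
        · subst ha
          obtain rfl : b = j := congrArg Prod.snd (hP.eq_of_fst hab hp rfl)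
          simpa [t] using hq
        by_cases ha' : a = g.1 i
        · subst ha'
          obtain rfl : b = g.2 j := congrArg Prod.snd (hP.eq_of_fst hab hq rfl)
          simpa [t] using hp
        have hb : b ≠ j := fun he => ha (congrArg Prod.fst (hP.eq_of_snd hab hp he))
        have hb' : b ≠ g.2 j := fun he => ha' (congrArg Prod.fst (hP.eq_of_snd hab hq he))
        simpa [t, Equiv.swap_apply_of_ne_of_ne ha ha', Equiv.swap_apply_of_ne_of_ne hb hb']
          using hab
      have key := ih _ (hn ▸ Equiv.Perm.card_support_swap_mul hi) (t * g)
        (fun p hp' => htP _ (h p hp'))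
        (fun a ha => by
          change Equiv.swap i (g.1 i) (g.1 a) = a
          rw [h1 a ha, Equiv.swap_apply_of_ne_of_ne]
          · rintro rfl; exact ha _ hp rfl
          · rintro rfl; exact ha _ hq rfl)
        (fun b hb => by
          change Equiv.swap j (g.2 j) (g.2 b) = b
          rw [h2 b hb, Equiv.swap_apply_of_ne_of_ne]
          · rintro rfl; exact hb _ hp rfl
          · rintro rfl; exact hb _ hq rfl) rfl
      have htt : t * (t * g) = g := by
        rw [← mul_assoc]
        have : t * t = 1 := Prod.ext (Equiv.swap_mul_self _ _) (Equiv.swap_mul_self _ _)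
        rw [this, one_mul]
      rw [← htt, map_mul, mul_assoc, key, ht]

theorem arcs_c_comm {P : List (Fin r × Fin s)} {x : Fin r ⊕ Fin s}
    (h : ∀ p ∈ P, x ≠ .inl p.1 ∧ x ≠ .inr p.2) : S.arcs P * S.c x = S.c x * S.arcs P := by
  induction P with
  | nil => simp [arcs]
  | cons p P ih =>
    rw [arcs_cons, mul_assoc, ih fun q hq => h q (List.mem_cons_of_mem _ hq), ← mul_assoc,
      S.e_c_comm _ _ _ (h p List.mem_cons_self).1 (h p List.mem_cons_self).2, mul_assoc]

/-- The function that is `a` at the ends of an arc, and trivial elsewhere. -/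
def arcFun (p : Fin r × Fin s) (a : Multiplicative (ZMod 2)) :
    Fin r ⊕ Fin s → Multiplicative (ZMod 2) :=
  Pi.mulSingle (.inl p.1) a * Pi.mulSingle (.inr p.2) a

/-- Beads at both ends of an arc slide together and cancel. -/
theorem clif_arcFun_mul_e (p : Fin r × Fin s) (a : Multiplicative (ZMod 2)) :
    S.clif (arcFun p a) * S.e p.1 p.2 = S.e p.1 p.2 := by
  rcases eq_one_or_odd a with rfl | rfl
  · simp [arcFun]
  · rw [arcFun, map_mul, clif_single, clif_single, mul_assoc, ← S.c_e, ← mul_assoc, S.c_sq, one_mul]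

theorem e_mul_clif_arcFun (p : Fin r × Fin s) (a : Multiplicative (ZMod 2)) :
    S.e p.1 p.2 * S.clif (arcFun p a) = S.e p.1 p.2 := by
  rcases eq_one_or_odd a with rfl | rfl
  · simp [arcFun]
  · rw [arcFun, map_mul, clif_single, clif_single, ← mul_assoc, S.e_c, mul_assoc, S.c_sq, mul_one]

/-- Replace the values at the ends of an arc by the trivial one. -/
def eraseArc (p : Fin r × Fin s) (A : Fin r ⊕ Fin s → Multiplicative (ZMod 2)) :
    Fin r ⊕ Fin s → Multiplicative (ZMod 2) :=
  fun x => if x = .inl p.1 ∨ x = .inr p.2 then 1 else A x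

/-- Beads away from the arc pass to the left of it, and those at its two ends gather at the left
end. What remains to the right of the arc is at most one bead, which keeps the case distinction in
`e_mul_arcs` finite. -/
theorem e_mul_clif (p : Fin r × Fin s) (A : Fin r ⊕ Fin s → Multiplicative (ZMod 2)) :
    S.e p.1 p.2 * S.clif A = S.clif (eraseArc p A) * S.e p.1 p.2 *
      S.clif (Pi.mulSingle (.inl p.1) (A (.inl p.1) * A (.inr p.2))) := by
  induction A using clif_induction with
  | one =>
    have : eraseArc p 1 = 1 := by funext x; simp [eraseArc]
    rw [this]
    simp
  | mul A B hA hB =>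
    have : eraseArc p (A * B) = eraseArc p A * eraseArc p B := by
      funext x
      simp only [eraseArc, Pi.mul_apply]
      split_ifs <;> simp
    rw [this, map_mul, map_mul, ← mul_assoc, hA, mul_assoc, S.clif_comm _ B, ← mul_assoc,
      mul_assoc (S.clif _), hB, ← mul_assoc, ← mul_assoc, mul_assoc, ← map_mul S.clif,
      ← map_mul S.clif (Pi.mulSingle _ _), ← Pi.mulSingle_mul]
    congr 3
    simp only [Pi.mul_apply]
    rw [mul_comm, mul_mul_mul_comm]
  | single x =>
    rcases eq_or_ne x (.inl p.1) with rfl | h1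
    · have : eraseArc p (Pi.mulSingle (.inl p.1) odd) = 1 := by
        funext y
        simp only [eraseArc, Pi.mulSingle_apply]
        split_ifs <;> simp_all
      rw [this]
      simp
    rcases eq_or_ne x (.inr p.2) with rfl | h2
    · have : eraseArc p (Pi.mulSingle (.inr p.2) odd) = 1 := by
        funext y
        simp only [eraseArc, Pi.mulSingle_apply]
        split_ifs <;> simp_all
      rw [this]
      simp [clif_single, S.e_c]
    have : eraseArc p (Pi.mulSingle x odd) = Pi.mulSingle x odd := by
      funext y
      simp only [eraseArc, Pi.mulSingle_apply]
      split_ifs <;> simp_all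
    rw [this, Pi.mulSingle_eq_of_ne h1.symm, Pi.mulSingle_eq_of_ne h2.symm, mul_one,
      Pi.mulSingle_one, map_one, mul_one, clif_single, S.e_c_comm _ _ _ h1 h2]

theorem e_clif_comm {p : Fin r × Fin s} {A : Fin r ⊕ Fin s → Multiplicative (ZMod 2)}
    (h1 : A (.inl p.1) = 1) (h2 : A (.inr p.2) = 1) :
    S.e p.1 p.2 * S.clif A = S.clif A * S.e p.1 p.2 := by
  have : eraseArc p A = A := by
    funext x
    unfold eraseArc
    split_ifs with h
    · rcases h with rfl | rfl
      · exact h1.symm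
      · exact h2.symm
    · rfl
  rw [S.e_mul_clif, h1, h2, this]
  simp

theorem arcs_clif_comm {P : List (Fin r × Fin s)} {A : Fin r ⊕ Fin s → Multiplicative (ZMod 2)}
    (h : ∀ p ∈ P, A (.inl p.1) = 1 ∧ A (.inr p.2) = 1) :
    S.arcs P * S.clif A = S.clif A * S.arcs P := by
  induction P with
  | nil => simp [arcs]
  | cons p P ih =>
    rw [arcs_cons, mul_assoc, ih fun q hq => h q (List.mem_cons_of_mem _ hq), ← mul_assoc,
      S.e_clif_comm (h p List.mem_cons_self).1 (h p List.mem_cons_self).2, mul_assoc]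

theorem eq_arcFun_mul_eraseArc {p : Fin r × Fin s}
    {A : Fin r ⊕ Fin s → Multiplicative (ZMod 2)} (h : A (.inl p.1) = A (.inr p.2)) :
    A = arcFun p (A (.inl p.1)) * eraseArc p A := by
  funext x
  simp only [arcFun, eraseArc, Pi.mul_apply, Pi.mulSingle_apply]
  split_ifs <;> simp_all

/-- Beads can be moved through the arcs if they come in pairs at the ends of each arc. -/
theorem clif_mul_arcs {P : List (Fin r × Fin s)} (hP : ValidArcs P)
    {A B : Fin r ⊕ Fin s → Multiplicative (ZMod 2)}
    (hA : ∀ p ∈ P, A (.inl p.1) = A (.inr p.2)) (hB : ∀ p ∈ P, B (.inl p.1) = B (.inr p.2))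
    (hAB : ∀ x, (∀ p ∈ P, x ≠ .inl p.1 ∧ x ≠ .inr p.2) → A x = B x) :
    S.clif A * S.arcs P = S.arcs P * S.clif B := by
  induction P generalizing A B with
  | nil =>
    obtain rfl : A = B := funext fun x => hAB x (by simp)
    simp [arcs]
  | cons p P ih =>
    have hP' := List.pairwise_cons.1 hP
    have hA' := eq_arcFun_mul_eraseArc (hA p List.mem_cons_self)
    have hB' := eq_arcFun_mul_eraseArc (hB p List.mem_cons_self)
    have hne : ∀ q ∈ P, (Sum.inl q.1 : Fin r ⊕ Fin s) ≠ .inl p.1 ∧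
        (Sum.inr q.2 : Fin r ⊕ Fin s) ≠ .inr p.2 := fun q hq =>
      ⟨fun h => (hP'.1 q hq).1 (Sum.inl_injective h).symm,
        fun h => (hP'.1 q hq).2 (Sum.inr_injective h).symm⟩
    have er : ∀ C : Fin r ⊕ Fin s → Multiplicative (ZMod 2),
        (∀ q ∈ p :: P, C (.inl q.1) = C (.inr q.2)) →
        ∀ q ∈ P, eraseArc p C (.inl q.1) = eraseArc p C (.inr q.2) := by
      intro C hC q hq
      have := hne q hq
      simp only [eraseArc, this.1, this.2, reduceCtorEq, or_self, if_false]
      exact hC q (List.mem_cons_of_mem _ hq)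
    have key := ih hP'.2 (er A hA) (er B hB) (fun x hx => by
      unfold eraseArc
      split_ifs with h
      · rfl
      · rw [not_or] at h
        refine hAB x fun q hq => ?_
        rcases List.mem_cons.1 hq with rfl | hq
        · exact h
        · exact hx q hq)
    have hc : S.arcs P * S.clif (arcFun p (B (.inl p.1))) =
        S.clif (arcFun p (B (.inl p.1))) * S.arcs P := by
      refine S.arcs_clif_comm fun q hq => ?_
      have := hne q hq
      simp [arcFun, this.1, this.2]
    have hz : eraseArc p A (.inl p.1) = 1 ∧ eraseArc p A (.inr p.2) = 1 := by simp [eraseArc]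
    -- Each function is split into its equal values at the ends of `p`, which the arc absorbs on its
    -- own side, and a rest that is trivial there and commutes with the arc.
    conv_lhs => rw [hA']
    conv_rhs => rw [hB']
    rw [arcs_cons, mul_comm (arcFun p (A _)), map_mul, map_mul, mul_assoc (S.clif (eraseArc p A)),
      ← mul_assoc (S.clif (arcFun p _)), S.clif_arcFun_mul_e, ← mul_assoc,
      ← S.e_clif_comm hz.1 hz.2, mul_assoc, key, mul_assoc (S.e _ _), ← mul_assoc (S.arcs P),
      hc, ← mul_assoc, ← mul_assoc, ← mul_assoc, S.e_mul_clif_arcFun]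

/-! Closure of the set of normal forms under multiplication -/

/-- The normal forms. -/
def normalForm (g : Equiv.Perm (Fin r) × Equiv.Perm (Fin s))
    (A : Fin r ⊕ Fin s → Multiplicative (ZMod 2)) (P : List (Fin r × Fin s))
    (B : Fin r ⊕ Fin s → Multiplicative (ZMod 2)) : Q :=
  S.perm g * (S.clif A * (S.arcs P * S.clif B))

/-- The element is zero or a normal form. -/
def IsNormal (x : Q) : Prop := x = 0 ∨ ∃ g A P B, ValidArcs P ∧ x = S.normalForm g A P B

theorem IsNormal.perm_mul {S : ArcSystem r s Q} {x : Q} (hx : S.IsNormal x) (g) :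
    S.IsNormal (S.perm g * x) := by
  rcases hx with rfl | ⟨g', A, P, B, hP, rfl⟩
  · exact .inl (mul_zero _)
  · exact .inr ⟨g * g', A, P, B, hP, by rw [normalForm, normalForm, map_mul, mul_assoc]⟩

theorem clif_perm (g : Equiv.Perm (Fin r) × Equiv.Perm (Fin s))
    (A : Fin r ⊕ Fin s → Multiplicative (ZMod 2)) :
    S.clif A * S.perm g = S.perm g * S.clif (A ∘ sideAct g) := by
  rw [S.perm_clif, Function.comp_assoc, Equiv.self_comp_symm, Function.comp_id]

theorem IsNormal.clif_mul {S : ArcSystem r s Q} {x : Q} (hx : S.IsNormal x) (A) :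
    S.IsNormal (S.clif A * x) := by
  rcases hx with rfl | ⟨g, A', P, B, hP, rfl⟩
  · exact .inl (mul_zero _)
  · refine .inr ⟨g, (A ∘ sideAct g) * A', P, B, hP, ?_⟩
    rw [normalForm, normalForm, ← mul_assoc, clif_perm, map_mul]
    simp only [mul_assoc]

theorem IsNormal.mul_clif {S : ArcSystem r s Q} {x : Q} (hx : S.IsNormal x) (A) :
    S.IsNormal (x * S.clif A) := by
  rcases hx with rfl | ⟨g, A', P, B, hP, rfl⟩
  · exact .inl (zero_mul _)
  · refine .inr ⟨g, A', P, B * A, hP, ?_⟩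
    rw [normalForm, normalForm, map_mul]
    simp only [mul_assoc]

theorem isNormal_arcs {P : List (Fin r × Fin s)} (hP : ValidArcs P) : S.IsNormal (S.arcs P) :=
  .inr ⟨1, 1, P, 1, hP, by simp [normalForm]⟩

/-- If the new arc coincides with an arc of `P`, there is a loop. If it shares one end with an arc
of `P`, it fuses with that arc and leaves only a permutation. If it shares none, it is added to `P`.
The bead can be moved outside in the last two cases. -/
theorem e_mul_arcs {P : List (Fin r × Fin s)} (hP : ValidArcs P) (i : Fin r) (j : Fin s) :
    S.IsNormal (S.e i j * S.arcs P) ∧ S.IsNormal (S.e i j * S.c (.inl i) * S.arcs P) := by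
  by_cases hi : ∃ j', (i, j') ∈ P
  · obtain ⟨j', hj'⟩ := hi
    have hperm := List.perm_cons_erase hj'
    have hE : S.arcs P = S.e i j' * S.arcs (P.erase (i, j')) := by
      rw [S.arcs_perm hP hperm, arcs_cons]
    rcases eq_or_ne j j' with rfl | hjj
    · constructor
      · left
        rw [hE, ← mul_assoc, S.e_sq, zero_mul]
      · left
        rw [hE, ← mul_assoc, S.e_c_e, zero_mul]
    · have h1 : S.e i j * S.arcs P = S.perm (1, Equiv.swap j j') * S.arcs P := by
        rw [hE, ← mul_assoc, S.e_e_right _ _ _ hjj, mul_assoc]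
      constructor
      · rw [h1]
        exact (S.isNormal_arcs hP).perm_mul _
      -- The bead at the shared end `i` is first slid along the second arc to `j'`, where the first
      -- arc has no end and lets it pass.
      · have h2 : S.e i j * S.c (.inl i) * S.arcs P = S.c (.inr j') * (S.e i j * S.arcs P) := by
          rw [hE, mul_assoc, ← mul_assoc (S.c _), S.c_e, ← mul_assoc, ← mul_assoc,
            S.e_c_comm _ _ _ (by simp) (by simpa using hjj.symm)]
          simp only [mul_assoc]
        rw [h2, h1, ← clif_single]
        exact ((S.isNormal_arcs hP).perm_mul _).clif_mul _
  · by_cases hj : ∃ i', (i', j) ∈ P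
    · obtain ⟨i', hi'⟩ := hj
      have hperm := List.perm_cons_erase hi'
      have hii : i ≠ i' := by rintro rfl; exact hi ⟨j, hi'⟩
      have hE : S.arcs P = S.e i' j * S.arcs (P.erase (i', j)) := by
        rw [S.arcs_perm hP hperm, arcs_cons]
      have h1 : S.e i j * S.arcs P = S.perm (Equiv.swap i i', 1) * S.arcs P := by
        rw [hE, ← mul_assoc, S.e_e_left _ _ _ hii, mul_assoc]
      constructor
      · rw [h1]
        exact (S.isNormal_arcs hP).perm_mul _
      · have h2 : S.e i j * S.c (.inl i) * S.arcs P = S.c (.inl i') * (S.e i j * S.arcs P) := by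
          rw [hE, S.e_c, mul_assoc, ← mul_assoc (S.c _), ← S.c_e, ← mul_assoc, ← mul_assoc,
            S.e_c_comm _ _ _ (by simpa using hii.symm) (by simp)]
          simp only [mul_assoc]
        rw [h2, h1, ← clif_single]
        exact ((S.isNormal_arcs hP).perm_mul _).clif_mul _
    · push Not at hi hj
      have hP' : ValidArcs ((i, j) :: P) := List.pairwise_cons.2 ⟨by
        rintro ⟨i', j'⟩ hp
        exact ⟨fun h => hi j' (by rwa [show i = i' from h]),
          fun h => hj i' (by rwa [show j = j' from h])⟩, hP⟩
      constructor
      · rw [← S.arcs_cons (i, j)]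
        exact S.isNormal_arcs hP'
      · rw [mul_assoc, ← S.arcs_c_comm, ← mul_assoc, ← S.arcs_cons (i, j), ← clif_single]
        · exact (S.isNormal_arcs hP').mul_clif _
        · intro p hp
          exact ⟨fun h => hi p.2 (by rwa [Sum.inl_injective h]), by simp⟩

/-- Moving an arc through the permutation relabels it, and moving it through the first layer of
beads leaves at most one bead behind. The rest is `e_mul_arcs`. -/
theorem IsNormal.e_mul {S : ArcSystem r s Q} {x : Q} (hx : S.IsNormal x) (i : Fin r) (j : Fin s) :
    S.IsNormal (S.e i j * x) := by
  rcases hx with rfl | ⟨g, A, P, B, hP, rfl⟩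
  · exact .inl (mul_zero _)
  · have h1 := S.perm_e g (g.1.symm i) (g.2.symm j)
    rw [Equiv.apply_symm_apply, Equiv.apply_symm_apply] at h1
    rw [normalForm, ← mul_assoc, ← h1, mul_assoc]
    refine IsNormal.perm_mul ?_ g
    generalize g.1.symm i = i
    generalize g.2.symm j = j
    rw [← mul_assoc, S.e_mul_clif (i, j), ← mul_assoc]
    refine IsNormal.mul_clif ?_ B
    rw [mul_assoc, mul_assoc]
    refine IsNormal.clif_mul ?_ _
    rw [← mul_assoc]
    rcases eq_one_or_odd (A (.inl i) * A (.inr j)) with h | h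
    · simp only [h, Pi.mulSingle_one, map_one, mul_one]
      exact (S.e_mul_arcs hP i j).1
    · simp only [h, clif_single]
      exact (S.e_mul_arcs hP i j).2

/-- Normal forms with matching data are equal. -/
theorem normalForm_eq {g g' : Equiv.Perm (Fin r) × Equiv.Perm (Fin s)}
    {A A' B B' : Fin r ⊕ Fin s → Multiplicative (ZMod 2)} {P P' : List (Fin r × Fin s)}
    (hP : ValidArcs P) (hPP : P.Perm P')
    (h : ∀ p ∈ P, ((g⁻¹ * g').1 p.1, (g⁻¹ * g').2 p.2) ∈ P)
    (h1 : ∀ i, (∀ p ∈ P, p.1 ≠ i) → (g⁻¹ * g').1 i = i)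
    (h2 : ∀ j, (∀ p ∈ P, p.2 ≠ j) → (g⁻¹ * g').2 j = j)
    (hA : ∀ p ∈ P, A (.inl p.1) * A (.inr p.2) =
      A' ((sideAct (g⁻¹ * g')).symm (.inl p.1)) * A' ((sideAct (g⁻¹ * g')).symm (.inr p.2)))
    (hB : ∀ p ∈ P, B (.inl p.1) * B (.inr p.2) = B' (.inl p.1) * B' (.inr p.2))
    (hAB : ∀ x, (∀ p ∈ P, x ≠ .inl p.1 ∧ x ≠ .inr p.2) →
      A x * B x = A' ((sideAct (g⁻¹ * g')).symm x) * B' x) :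
    S.normalForm g A P B = S.normalForm g' A' P' B' := by
  -- The two permutations differ by `k`, which permutes the arcs and fixes all other strands. After
  -- it is moved past the beads, the arcs absorb it.
  have eg : g' = g * (g⁻¹ * g') := by group
  set k := g⁻¹ * g' with hk
  have e1 : S.normalForm g' A' P' B' = S.perm g * (S.clif (A' ∘ (sideAct k).symm) *
      (S.arcs P * S.clif B')) := by
    rw [normalForm, ← S.arcs_perm hP hPP]
    conv_lhs => rw [eg]
    rw [map_mul, mul_assoc, ← mul_assoc (S.perm k), S.perm_clif, mul_assoc, ← mul_assoc (S.perm k),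
      S.perm_mul_arcs hP k h h1 h2]
  have inv2 : ∀ a : Multiplicative (ZMod 2), a * a = 1 := by decide
  have flip : ∀ a b c d : Multiplicative (ZMod 2), a * b = c * d → a * c = b * d := by decide
  -- As products of beads are involutions, the claim is equivalent to moving the differences of the
  -- bead layers through the arcs. The hypotheses say that these differences come in pairs on arcs
  -- and agree elsewhere.
  have key := S.clif_mul_arcs (A := (A' ∘ (sideAct k).symm) * A) (B := B * B') hP
    (fun p hp => by
      have := hA p hp
      simp only [Pi.mul_apply, Function.comp_apply]
      rw [mul_comm, flip _ _ _ _ this, mul_comm])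
    (fun p hp => by
      simp only [Pi.mul_apply]
      exact flip _ _ _ _ (hB p hp))
    (fun x hx => by
      simp only [Pi.mul_apply, Function.comp_apply]
      rw [mul_comm]
      exact flip _ _ _ _ (hAB x hx))
  rw [e1, normalForm]
  congr 1
  rw [map_mul, map_mul, mul_assoc] at key
  have h3 := congrArg (fun y => S.clif (A' ∘ (sideAct k).symm) * y * S.clif B) key
  simp only [mul_assoc] at h3
  rw [← mul_assoc, S.clif_sq, one_mul, S.clif_comm B' B, ← mul_assoc (S.clif B), S.clif_sq,
    one_mul] at h3
  exact h3

end ArcSystem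

end WalledBrauerClifford

namespace WalledBrauerClifford

/-! ### The walled Brauer–Clifford superalgebra up to signs -/

variable {r s : ℕ}

variable (r s) in
/-- Equality up to sign. -/
def signCon : Con (BC r s) where
  r x y := x = y ∨ x = -y
  iseqv := ⟨fun _ => .inl rfl, fun h => h.imp Eq.symm (fun h => by rw [h, neg_neg]), by
    rintro x y z (rfl | rfl) (rfl | rfl) <;> simp⟩
  mul' := by
    rintro a b c d (rfl | rfl) (rfl | rfl) <;> simp

variable (r s) in
/-- The elements of the walled Brauer–Clifford superalgebra up to sign. -/
def SignQuot : Type := (signCon r s).Quotient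

namespace SignQuot

noncomputable instance : Monoid (SignQuot r s) :=
  inferInstanceAs (Monoid (signCon r s).Quotient)

variable (r s) in
/-- The quotient map. -/
noncomputable def cls : BC r s →* SignQuot r s := (signCon r s).mk'

theorem cls_surjective : Function.Surjective (cls r s) := Quotient.mk_surjective

theorem cls_eq_iff {x y : BC r s} : cls r s x = cls r s y ↔ x = y ∨ x = -y :=
  (signCon r s).eq

theorem cls_neg (x : BC r s) : cls r s (-x) = cls r s x := cls_eq_iff.2 (.inr rfl)

noncomputable instance : MonoidWithZero (SignQuot r s) where
  zero := cls r s 0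
  zero_mul x := by
    obtain ⟨x, rfl⟩ := cls_surjective x
    change cls r s 0 * cls r s x = cls r s 0
    rw [← map_mul, zero_mul]
  mul_zero x := by
    obtain ⟨x, rfl⟩ := cls_surjective x
    change cls r s x * cls r s 0 = cls r s 0
    rw [← map_mul, mul_zero]

theorem cls_zero : cls r s 0 = 0 := rfl

open scoped Classical in
/-- The class of a generator `s_i`. -/
noncomputable def sg (i : ℕ) : SignQuot r s :=
  -- The default 1 lets the involution and distant commutation relations hold for all indices.
  if h : 1 ≤ i ∧ i < r + s ∧ i ≠ r then cls r s (BC.gen (.s i h)) else 1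

open scoped Classical in
/-- The class of a generator `c_i`. -/
noncomputable def cg (i : ℕ) : SignQuot r s :=
  if h : 1 ≤ i ∧ i ≤ r + s then cls r s (BC.gen (.c i h)) else 1

open scoped Classical in
variable (r s) in
/-- The class of the generator `e`. -/
noncomputable def eg : SignQuot r s :=
  -- The default is 0, so the relations in which `eg` occurs as a factor on both sides become
  -- trivial when one side of the wall is empty.
  if h : 1 ≤ r ∧ 1 ≤ s then cls r s (BC.gen (.e h)) else 0

theorem sg_eq {i : ℕ} (h : 1 ≤ i ∧ i < r + s ∧ i ≠ r) :
    sg i = cls r s (BC.mk r s (fs i h)) := dif_pos h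

theorem cg_eq {i : ℕ} (h : 1 ≤ i ∧ i ≤ r + s) : cg i = cls r s (BC.mk r s (fc i h)) := dif_pos h

theorem eg_eq (h : 1 ≤ r ∧ 1 ≤ s) : eg r s = cls r s (BC.mk r s (fe h)) := dif_pos h

theorem sg_sq (i : ℕ) : sg i * sg i = (1 : SignQuot r s) := by
  by_cases h : 1 ≤ i ∧ i < r + s ∧ i ≠ r
  · rw [sg_eq h, ← map_mul, ← map_mul, BC.mk_rel (.s_sq i h), map_one, map_one]
  · simp [sg, h]

theorem sg_braid {i : ℕ} (h : 1 ≤ i ∧ i < r + s ∧ i ≠ r)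
    (h' : 1 ≤ i + 1 ∧ i + 1 < r + s ∧ i + 1 ≠ r) :
    sg i * sg (i + 1) * sg i = (sg (i + 1) * sg i * sg (i + 1) : SignQuot r s) := by
  simp only [sg_eq h, sg_eq h', ← map_mul]
  rw [BC.mk_rel (.braid i h h')]

theorem sg_comm {i j : ℕ} (hij : i + 1 < j ∨ j + 1 < i) :
    sg i * sg j = (sg j * sg i : SignQuot r s) := by
  by_cases h : 1 ≤ i ∧ i < r + s ∧ i ≠ r
  · by_cases h' : 1 ≤ j ∧ j < r + s ∧ j ≠ r
    · simp only [sg_eq h, sg_eq h', ← map_mul]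
      rw [BC.mk_rel (.s_comm i j h h' hij)]
    · rw [show sg j = (1 : SignQuot r s) from dif_neg h']; simp
  · rw [show sg i = (1 : SignQuot r s) from dif_neg h]; simp

theorem eg_sq : eg r s * eg r s = 0 := by
  by_cases h : 1 ≤ r ∧ 1 ≤ s
  · rw [eg_eq h, ← map_mul, ← map_mul, BC.mk_rel (.e_sq h), map_zero, cls_zero]
  · simp [eg, h]

theorem eg_sg_comm {j : ℕ} (h1 : j + 1 ≠ r) (h2 : j ≠ r + 1) :
    eg r s * sg j = sg j * eg r s := by
  by_cases h : 1 ≤ r ∧ 1 ≤ s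
  · by_cases h' : 1 ≤ j ∧ j < r + s ∧ j ≠ r
    · simp only [eg_eq h, sg_eq h', ← map_mul]
      rw [BC.mk_rel (.e_s_comm h j h' h1 h2)]
    · rw [show sg j = (1 : SignQuot r s) from dif_neg h']; simp
  · rw [show eg r s = 0 from dif_neg h]; simp

theorem eg_sg_eg_left (hr : 2 ≤ r) : eg r s * sg (r - 1) * eg r s = eg r s := by
  by_cases h : 1 ≤ r ∧ 1 ≤ s
  · have h' : 1 ≤ r - 1 ∧ r - 1 < r + s ∧ r - 1 ≠ r := by lia
    simp only [eg_eq h, sg_eq h', ← map_mul]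
    rw [← BC.mk_rel (.e_s_e_left h (r - 1) h' (by lia))]
  · rw [show eg r s = 0 from dif_neg h]; simp

theorem eg_sg_eg_right (hs : 2 ≤ s) : eg r s * sg (r + 1) * eg r s = eg r s := by
  by_cases h : 1 ≤ r ∧ 1 ≤ s
  · have h' : 1 ≤ r + 1 ∧ r + 1 < r + s ∧ r + 1 ≠ r := by lia
    simp only [eg_eq h, sg_eq h', ← map_mul]
    rw [← BC.mk_rel (.e_s_e_right h h')]
  · rw [show eg r s = 0 from dif_neg h]; simp

theorem eg_eg (hr : 2 ≤ r) (hs : 2 ≤ s) :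
    sg (r - 1) * sg (r + 1) * eg r s * sg (r + 1) * sg (r - 1) * eg r s =
      eg r s * sg (r - 1) * sg (r + 1) * eg r s * sg (r + 1) * sg (r - 1) := by
  have h : 1 ≤ r ∧ 1 ≤ s := by lia
  have h' : 1 ≤ r - 1 ∧ r - 1 < r + s ∧ r - 1 ≠ r := by lia
  have h'' : 1 ≤ r + 1 ∧ r + 1 < r + s ∧ r + 1 ≠ r := by lia
  simp only [eg_eq h, sg_eq h', sg_eq h'', ← map_mul]
  rw [BC.mk_rel (.e_e h (r - 1) h' h'' (by lia))]

theorem cg_sq (i : ℕ) : cg i * cg i = (1 : SignQuot r s) := by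
  by_cases h : 1 ≤ i ∧ i ≤ r + s
  · rw [cg_eq h, ← map_mul, ← map_mul]
    by_cases hi : i ≤ r
    · rw [BC.mk_rel (.c_sq_left i h hi), map_neg, map_one, cls_neg, map_one]
    · rw [BC.mk_rel (.c_sq_right i h (by lia)), map_one, map_one]
  · simp [cg, h]

theorem cg_comm (i j : ℕ) : cg i * cg j = (cg j * cg i : SignQuot r s) := by
  by_cases h : 1 ≤ i ∧ i ≤ r + s
  · by_cases h' : 1 ≤ j ∧ j ≤ r + s
    · rcases eq_or_ne i j with rfl | hij
      · rfl
      · simp only [cg_eq h, cg_eq h', ← map_mul]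
        rw [BC.mk_rel (.c_anticomm i j h h' hij), map_neg, cls_neg]
    · rw [show cg j = (1 : SignQuot r s) from dif_neg h']; simp
  · rw [show cg i = (1 : SignQuot r s) from dif_neg h]; simp

theorem sg_cg {i : ℕ} (h : 1 ≤ i ∧ i < r + s ∧ i ≠ r) :
    sg i * cg i = (cg (i + 1) * sg i : SignQuot r s) := by
  have h1 : 1 ≤ i ∧ i ≤ r + s := by lia
  have h2 : 1 ≤ i + 1 ∧ i + 1 ≤ r + s := by lia
  have : cg (i + 1) = (sg i * cg i * sg i : SignQuot r s) := by
    simp only [sg_eq h, cg_eq h1, cg_eq h2, ← map_mul]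
    rw [BC.mk_rel (.s_c_s i h h1 h2)]
  rw [this, mul_assoc, sg_sq, mul_one]

theorem sg_cg_succ {i : ℕ} (h : 1 ≤ i ∧ i < r + s ∧ i ≠ r) :
    sg i * cg (i + 1) = (cg i * sg i : SignQuot r s) := by
  have := congrArg (fun x : SignQuot r s => sg i * x * sg i) (sg_cg h)
  rw [← mul_assoc, sg_sq, one_mul, mul_assoc, mul_assoc, sg_sq, mul_one] at this
  exact this.symm

theorem sg_cg_comm {i j : ℕ} (h1 : j ≠ i) (h2 : j ≠ i + 1) :
    sg i * cg j = (cg j * sg i : SignQuot r s) := by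
  by_cases h : 1 ≤ i ∧ i < r + s ∧ i ≠ r
  · by_cases h' : 1 ≤ j ∧ j ≤ r + s
    · simp only [sg_eq h, cg_eq h', ← map_mul]
      rw [BC.mk_rel (.s_c_comm i j h h' h1 h2)]
    · rw [show cg j = (1 : SignQuot r s) from dif_neg h']; simp
  · rw [show sg i = (1 : SignQuot r s) from dif_neg h]; simp

theorem cg_eg : cg r * eg r s = cg (r + 1) * eg r s := by
  by_cases h : 1 ≤ r ∧ 1 ≤ s
  · have h1 : 1 ≤ r ∧ r ≤ r + s := by lia
    have h2 : 1 ≤ r + 1 ∧ r + 1 ≤ r + s := by lia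
    simp only [eg_eq h, cg_eq h1, cg_eq h2, ← map_mul]
    rw [BC.mk_rel (.c_e h h1 h2)]
  · rw [show eg r s = 0 from dif_neg h]; simp

theorem eg_cg : eg r s * cg r = eg r s * cg (r + 1) := by
  by_cases h : 1 ≤ r ∧ 1 ≤ s
  · have h1 : 1 ≤ r ∧ r ≤ r + s := by lia
    have h2 : 1 ≤ r + 1 ∧ r + 1 ≤ r + s := by lia
    simp only [eg_eq h, cg_eq h1, cg_eq h2, ← map_mul]
    rw [BC.mk_rel (.e_c h h1 h2)]
  · rw [show eg r s = 0 from dif_neg h]; simp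

theorem eg_cg_eg : eg r s * cg r * eg r s = 0 := by
  by_cases h : 1 ≤ r ∧ 1 ≤ s
  · have h1 : 1 ≤ r ∧ r ≤ r + s := by lia
    simp only [eg_eq h, cg_eq h1, ← map_mul]
    rw [BC.mk_rel (.e_c_e h h1), map_zero, cls_zero]
  · rw [show eg r s = 0 from dif_neg h]; simp

theorem eg_cg_comm {j : ℕ} (h1 : j ≠ r) (h2 : j ≠ r + 1) :
    eg r s * cg j = cg j * eg r s := by
  by_cases h : 1 ≤ r ∧ 1 ≤ s
  · by_cases h' : 1 ≤ j ∧ j ≤ r + s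
    · simp only [eg_eq h, cg_eq h', ← map_mul]
      rw [BC.mk_rel (.e_c_comm h j h' h1 h2)]
    · rw [show cg j = (1 : SignQuot r s) from dif_neg h']; simp
  · rw [show eg r s = 0 from dif_neg h]; simp

/-! The permutations -/

/-- Strands are counted from the wall, so `a` stands for the position `r - a` and the order on the
left is reversed. With this convention both ends of the generator `e` have index 0. -/
theorem relations_left : Coxeter.Relations r fun a => (sg (r - a - 1) : SignQuot r s) where
  sq _ _ := sg_sq _
  braid a h := by
    have := sg_braid (r := r) (s := s) (i := r - a - 2) (by lia) (by lia)
    rw [show r - a - 2 + 1 = r - a - 1 by lia] at this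
    rw [show r - (a + 1) - 1 = r - a - 2 by lia]
    exact this.symm
  comm a b h h' := sg_comm (by lia)

theorem relations_right : Coxeter.Relations s fun b => (sg (r + 1 + b) : SignQuot r s) where
  sq _ _ := sg_sq _
  braid b h := sg_braid (by lia) (by lia)
  comm a b h h' := sg_comm (by lia)

variable (r s) in
/-- The permutations of the strands on the left. -/
noncomputable def permLeft : Equiv.Perm (Fin r) →* SignQuot r s :=
  (Coxeter.exists_hom relations_left).choose

variable (r s) in
/-- The permutations of the strands on the right. -/
noncomputable def permRight : Equiv.Perm (Fin s) →* SignQuot r s :=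
  (Coxeter.exists_hom relations_right).choose

theorem permLeft_adjacent {a : ℕ} (h : a + 1 < r) :
    permLeft r s (Coxeter.adjacent r a) = sg (r - a - 1) :=
  (Coxeter.exists_hom relations_left).choose_spec a h

theorem permRight_adjacent {b : ℕ} (h : b + 1 < s) :
    permRight r s (Coxeter.adjacent s b) = sg (r + 1 + b) :=
  (Coxeter.exists_hom relations_right).choose_spec b h

theorem adjacent_induction {n : ℕ} {p : Equiv.Perm (Fin n) → Prop} (one : p 1)
    (mul : ∀ σ τ, p σ → p τ → p (σ * τ)) (adj : ∀ a, a + 1 < n → p (Coxeter.adjacent n a))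
    (σ : Equiv.Perm (Fin n)) : p σ := by
  have hσ : σ ∈ Submonoid.closure {y | ∃ a, a + 1 < n ∧ Coxeter.adjacent n a = y} := by
    rw [Coxeter.adjacent_closure]; trivial
  induction hσ using Submonoid.closure_induction with
  | mem y hy =>
    obtain ⟨a, ha, rfl⟩ := hy
    exact adj a ha
  | one => exact one
  | mul x y _ _ hx hy => exact mul x y hx hy

/-- As there is no generator `s_r`, crossings on different sides have indices that differ by at
least two. -/
theorem permLeft_comm_permRight (σ : Equiv.Perm (Fin r)) (τ : Equiv.Perm (Fin s)) :
    Commute (permLeft r s σ) (permRight r s τ) := by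
  induction σ using adjacent_induction with
  | one => rw [map_one]; exact .one_left _
  | mul σ σ' h h' => rw [map_mul]; exact h.mul_left h'
  | adj a ha =>
    induction τ using adjacent_induction with
    | one => rw [map_one]; exact .one_right _
    | mul τ τ' h h' => rw [map_mul]; exact h.mul_right h'
    | adj b hb =>
      rw [permLeft_adjacent ha, permRight_adjacent hb]
      exact sg_comm (by lia)

variable (r s) in
/-- The permutations of the strands. -/
noncomputable def perm : Equiv.Perm (Fin r) × Equiv.Perm (Fin s) →* SignQuot r s :=
  (permLeft r s).noncommCoprod (permRight r s) permLeft_comm_permRight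

theorem perm_apply (g : Equiv.Perm (Fin r) × Equiv.Perm (Fin s)) :
    perm r s g = permLeft r s g.1 * permRight r s g.2 := rfl

/-- The position of a strand: the strands are counted from the wall. -/
def position : Fin r ⊕ Fin s → ℕ := Sum.elim (fun a => r - a) (fun b => r + 1 + b)

theorem prod_induction {p : Equiv.Perm (Fin r) × Equiv.Perm (Fin s) → Prop} (one : p 1)
    (mul : ∀ g h, p g → p h → p (g * h))
    (left : ∀ a, a + 1 < r → p (Coxeter.adjacent r a, 1))
    (right : ∀ b, b + 1 < s → p (1, Coxeter.adjacent s b))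
    (g : Equiv.Perm (Fin r) × Equiv.Perm (Fin s)) : p g := by
  have h1 : ∀ σ, p (σ, 1) := fun σ => by
    induction σ using adjacent_induction with
    | one => exact one
    | mul σ τ hσ hτ => exact mul _ _ hσ hτ
    | adj a ha => exact left a ha
  have h2 : ∀ τ, p (1, τ) := fun τ => by
    induction τ using adjacent_induction with
    | one => exact one
    | mul σ τ hσ hτ => exact mul _ _ hσ hτ
    | adj a ha => exact right a ha
  have := mul _ _ (h1 g.1) (h2 g.2)
  rwa [Prod.mk_mul_mk, one_mul, mul_one] at this

theorem perm_left {a : ℕ} (h : a + 1 < r) :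
    perm r s (Coxeter.adjacent r a, 1) = sg (r - a - 1) := by
  rw [perm_apply, map_one, mul_one, permLeft_adjacent h]

theorem perm_right {b : ℕ} (h : b + 1 < s) :
    perm r s (1, Coxeter.adjacent s b) = sg (r + 1 + b) := by
  rw [perm_apply, map_one, one_mul, permRight_adjacent h]

theorem perm_cg (g : Equiv.Perm (Fin r) × Equiv.Perm (Fin s)) (x : Fin r ⊕ Fin s) :
    perm r s g * cg (position x) = cg (position (sideAct g x)) * perm r s g := by
  induction g using prod_induction generalizing x with
  | one =>
    rw [map_one, one_mul, mul_one]
    rcases x with x | x <;> rfl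
  | mul g h hg hh =>
    rw [map_mul, mul_assoc, hh, ← mul_assoc, hg, mul_assoc]
    rcases x with x | x <;> rfl
  | left a ha =>
    rw [perm_left ha, Coxeter.adjacent_eq ha]
    rcases x with x | x
    · change sg (r - a - 1) * cg (r - x) =
        cg (r - (Equiv.swap ⟨a, by lia⟩ ⟨a + 1, ha⟩ x : Fin r)) * sg (r - a - 1)
      rcases eq_or_ne x ⟨a, by lia⟩ with rfl | h1
      · rw [Equiv.swap_apply_left]
        have := sg_cg_succ (r := r) (s := s) (i := r - a - 1) (by lia)
        rwa [show r - a - 1 + 1 = r - a by lia] at this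
      rcases eq_or_ne x ⟨a + 1, ha⟩ with rfl | h2
      · rw [Equiv.swap_apply_right]
        have := sg_cg (r := r) (s := s) (i := r - a - 1) (by lia)
        rwa [show r - a - 1 + 1 = r - a by lia] at this
      · rw [Equiv.swap_apply_of_ne_of_ne h1 h2]
        have h1' : (x : ℕ) ≠ a := fun h => h1 (Fin.ext h)
        have h2' : (x : ℕ) ≠ a + 1 := fun h => h2 (Fin.ext h)
        exact sg_cg_comm (by lia) (by lia)
    · exact sg_cg_comm (by change r + 1 + (x : ℕ) ≠ _; lia) (by change r + 1 + (x : ℕ) ≠ _; lia)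
  | right b hb =>
    rw [perm_right hb, Coxeter.adjacent_eq hb]
    rcases x with x | x
    · exact sg_cg_comm (by change r - (x : ℕ) ≠ _; lia) (by change r - (x : ℕ) ≠ _; lia)
    · change sg (r + 1 + b) * cg (r + 1 + x) =
        cg (r + 1 + (Equiv.swap ⟨b, by lia⟩ ⟨b + 1, hb⟩ x : Fin s)) * sg (r + 1 + b)
      rcases eq_or_ne x ⟨b, by lia⟩ with rfl | h1
      · rw [Equiv.swap_apply_left]
        exact sg_cg (r := r) (s := s) (i := r + 1 + b) (by lia)
      rcases eq_or_ne x ⟨b + 1, hb⟩ with rfl | h2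
      · rw [Equiv.swap_apply_right]
        exact sg_cg_succ (r := r) (s := s) (i := r + 1 + b) (by lia)
      · rw [Equiv.swap_apply_of_ne_of_ne h1 h2]
        have h1' : (x : ℕ) ≠ b := fun h => h1 (Fin.ext h)
        have h2' : (x : ℕ) ≠ b + 1 := fun h => h2 (Fin.ext h)
        exact sg_cg_comm (by lia) (by lia)

/-- A permutation that fixes the two strands at the wall is a product of the crossings that do not
touch them, and each of these commutes with `e`. -/
theorem perm_eg {g : Equiv.Perm (Fin r) × Equiv.Perm (Fin s)}
    (h1 : ∀ x : Fin r, (x : ℕ) = 0 → g.1 x = x) (h2 : ∀ x : Fin s, (x : ℕ) = 0 → g.2 x = x) :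
    perm r s g * eg r s = eg r s * perm r s g := by
  have e1 : permLeft r s g.1 * eg r s = eg r s * permLeft r s g.1 := by
    have := Coxeter.mem_of_fix (S := (Submonoid.centralizer {eg r s}).comap (permLeft r s))
      (fun a ha ha' => by
        rw [Submonoid.mem_comap, permLeft_adjacent ha', Submonoid.mem_centralizer_iff]
        rintro _ rfl
        exact eg_sg_comm (by lia) (by lia)) g.1 h1
    rw [Submonoid.mem_comap, Submonoid.mem_centralizer_iff] at this
    exact (this _ rfl).symm
  have e2 : permRight r s g.2 * eg r s = eg r s * permRight r s g.2 := by
    have := Coxeter.mem_of_fix (S := (Submonoid.centralizer {eg r s}).comap (permRight r s))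
      (fun a ha ha' => by
        rw [Submonoid.mem_comap, permRight_adjacent ha', Submonoid.mem_centralizer_iff]
        rintro _ rfl
        exact eg_sg_comm (by lia) (by lia)) g.2 h2
    rw [Submonoid.mem_comap, Submonoid.mem_centralizer_iff] at this
    exact (this _ rfl).symm
  rw [perm_apply, mul_assoc, e2, ← mul_assoc, e1, mul_assoc]

/-! ### Arcs between arbitrary strands -/

/-- The permutation that moves the strands next to the wall to given positions. -/
def toWall (i : Fin r) (j : Fin s) : Equiv.Perm (Fin r) × Equiv.Perm (Fin s) :=
  (Equiv.swap ⟨0, i.pos⟩ i, Equiv.swap ⟨0, j.pos⟩ j)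

theorem toWall_mul_self (i : Fin r) (j : Fin s) : toWall i j * toWall i j = 1 :=
  Prod.ext (Equiv.swap_mul_self _ _) (Equiv.swap_mul_self _ _)

/-- The arc between two given strands. -/
noncomputable def arc (i : Fin r) (j : Fin s) : SignQuot r s :=
  perm r s (toWall i j) * eg r s * perm r s (toWall i j)

theorem perm_arc (g : Equiv.Perm (Fin r) × Equiv.Perm (Fin s)) (i : Fin r) (j : Fin s) :
    perm r s g * arc i j = arc (g.1 i) (g.2 j) * perm r s g := by
  have h1 := toWall_mul_self i j
  have h2 := toWall_mul_self (g.1 i) (g.2 j)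
  -- Going from the wall to the strands `i, j`, applying `g`, and going back to the wall fixes both
  -- strands there. So the choice of the conjugating permutation in `arc` is immaterial.
  have hw := perm_eg (r := r) (s := s) (g := toWall (g.1 i) (g.2 j) * g * toWall i j)
    (fun x hx => by
      obtain rfl : x = ⟨0, i.pos⟩ := Fin.ext hx
      simp [toWall])
    (fun x hx => by
      obtain rfl : x = ⟨0, j.pos⟩ := Fin.ext hx
      simp [toWall])
  unfold arc
  generalize toWall (g.1 i) (g.2 j) = v at *
  generalize toWall i j = u at *
  calc perm r s g * (perm r s u * eg r s * perm r s u)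
      = perm r s v * (perm r s (v * g * u) * eg r s) * perm r s u := by
        simp only [← mul_assoc, ← map_mul]
        rw [h2, one_mul]
    _ = perm r s v * eg r s * (perm r s (v * g * u) * perm r s u) := by
        rw [hw]; simp only [mul_assoc]
    _ = perm r s v * eg r s * perm r s v * perm r s g := by
        rw [← map_mul, mul_assoc (v * g), h1, mul_one, map_mul]
        simp only [mul_assoc]

theorem arc_zero {i : Fin r} {j : Fin s} (hi : (i : ℕ) = 0) (hj : (j : ℕ) = 0) :
    arc i j = eg r s := by
  have : toWall i j = 1 := by
    have hi' : (⟨0, i.pos⟩ : Fin r) = i := Fin.ext hi.symm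
    have hj' : (⟨0, j.pos⟩ : Fin s) = j := Fin.ext hj.symm
    rw [toWall, hi', hj', Equiv.swap_self, Equiv.swap_self]
    rfl
  rw [arc, this, map_one, one_mul, mul_one]

theorem mul_perm_cancel {x y : SignQuot r s} {g : Equiv.Perm (Fin r) × Equiv.Perm (Fin s)}
    (h : x * perm r s g = y * perm r s g) : x = y := by
  have := congrArg (· * perm r s g⁻¹) h
  simpa only [mul_assoc, ← map_mul, mul_inv_cancel, map_one, mul_one] using this

/-- Double transitivity: a relation between two arcs need only be checked at the wall and one step
away from it. -/
theorem exists_move {n : ℕ} {i i' k k' : Fin n} (h : i ≠ i') (hk : k ≠ k') :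
    ∃ σ : Equiv.Perm (Fin n), σ k = i ∧ σ k' = i' := by
  have h1 : Equiv.swap k i i' ≠ k := by
    intro h2
    have := congrArg (Equiv.swap k i) h2
    rw [Equiv.swap_apply_self, Equiv.swap_apply_left] at this
    exact h this.symm
  refine ⟨Equiv.swap k i * Equiv.swap k' (Equiv.swap k i i'), ?_, ?_⟩
  · rw [Equiv.Perm.mul_apply, Equiv.swap_apply_of_ne_of_ne hk h1.symm, Equiv.swap_apply_left]
  · rw [Equiv.Perm.mul_apply, Equiv.swap_apply_left, Equiv.swap_apply_self]

end SignQuot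

end WalledBrauerClifford

/-! ### Relations between arcs, transported from the wall by conjugation -/

namespace WalledBrauerClifford

namespace SignQuot

variable {r s : ℕ}

/-- The permutation is invertible, so an element has only one conjugate under it. To prove an
identity, both of its sides are exhibited as conjugates of the same expression at the wall. -/
theorem semiconj_unique {g : Equiv.Perm (Fin r) × Equiv.Perm (Fin s)} {x y y' : SignQuot r s}
    (h : SemiconjBy (perm r s g) x y) (h' : SemiconjBy (perm r s g) x y') : y = y' :=
  mul_perm_cancel (h.symm.trans h')

theorem semiconj_arc {g : Equiv.Perm (Fin r) × Equiv.Perm (Fin s)} {k i : Fin r} {l j : Fin s}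
    (hi : g.1 k = i) (hj : g.2 l = j) : SemiconjBy (perm r s g) (arc k l) (arc i j) := by
  subst hi hj
  exact perm_arc g k l

theorem semiconj_cg {g : Equiv.Perm (Fin r) × Equiv.Perm (Fin s)} {x y : Fin r ⊕ Fin s}
    (h : sideAct g x = y) : SemiconjBy (perm r s g) (cg (position x)) (cg (position y)) := by
  subst h
  exact perm_cg g x

theorem semiconj_swap_left {g : Equiv.Perm (Fin r) × Equiv.Perm (Fin s)} {k k' i i' : Fin r}
    (h : g.1 k = i) (h' : g.1 k' = i') :
    SemiconjBy (perm r s g) (perm r s (Equiv.swap k k', 1)) (perm r s (Equiv.swap i i', 1)) := by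
  subst h h'
  change perm r s g * _ = _ * perm r s g
  rw [← map_mul, ← map_mul]
  congr 1
  exact Prod.ext (Equiv.mul_swap_eq_swap_mul _ _ _) ((mul_one _).trans (one_mul _).symm)

theorem semiconj_swap_right {g : Equiv.Perm (Fin r) × Equiv.Perm (Fin s)} {l l' j j' : Fin s}
    (h : g.2 l = j) (h' : g.2 l' = j') :
    SemiconjBy (perm r s g) (perm r s (1, Equiv.swap l l')) (perm r s (1, Equiv.swap j j')) := by
  subst h h'
  change perm r s g * _ = _ * perm r s g
  rw [← map_mul, ← map_mul]
  congr 1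
  exact Prod.ext ((mul_one _).trans (one_mul _).symm) (Equiv.mul_swap_eq_swap_mul _ _ _)

theorem semiconj_toWall_arc (i : Fin r) (j : Fin s) :
    SemiconjBy (perm r s (toWall i j)) (eg r s) (arc i j) := by
  rw [← arc_zero (i := ⟨0, i.pos⟩) (j := ⟨0, j.pos⟩) rfl rfl]
  exact semiconj_arc (Equiv.swap_apply_left _ _) (Equiv.swap_apply_left _ _)

theorem semiconj_toWall_left (i : Fin r) (j : Fin s) :
    SemiconjBy (perm r s (toWall i j)) (cg r) (cg (position (.inl i : Fin r ⊕ Fin s))) :=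
  semiconj_cg (x := .inl ⟨0, i.pos⟩) (congrArg Sum.inl (Equiv.swap_apply_left _ _))

theorem semiconj_toWall_right (i : Fin r) (j : Fin s) :
    SemiconjBy (perm r s (toWall i j)) (cg (r + 1)) (cg (position (.inr j : Fin r ⊕ Fin s))) :=
  semiconj_cg (x := .inr ⟨0, j.pos⟩) (congrArg Sum.inr (Equiv.swap_apply_left _ _))

theorem arc_sq (i : Fin r) (j : Fin s) : arc i j * arc i j = 0 := by
  have h := semiconj_toWall_arc i j
  refine semiconj_unique (h.mul_right h) ?_
  rw [eg_sq]
  exact .zero_right _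

theorem arc_cg_arc (i : Fin r) (j : Fin s) :
    arc i j * cg (position (.inl i : Fin r ⊕ Fin s)) * arc i j = 0 := by
  have h := semiconj_toWall_arc i j
  refine semiconj_unique ((h.mul_right (semiconj_toWall_left i j)).mul_right h) ?_
  rw [eg_cg_eg]
  exact .zero_right _

theorem cg_arc (i : Fin r) (j : Fin s) :
    cg (position (.inl i : Fin r ⊕ Fin s)) * arc i j =
      cg (position (.inr j : Fin r ⊕ Fin s)) * arc i j := by
  have h := semiconj_toWall_arc i j
  refine semiconj_unique ((semiconj_toWall_left i j).mul_right h) ?_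
  rw [cg_eg]
  exact (semiconj_toWall_right i j).mul_right h

theorem arc_cg (i : Fin r) (j : Fin s) :
    arc i j * cg (position (.inl i : Fin r ⊕ Fin s)) =
      arc i j * cg (position (.inr j : Fin r ⊕ Fin s)) := by
  have h := semiconj_toWall_arc i j
  refine semiconj_unique (h.mul_right (semiconj_toWall_left i j)) ?_
  rw [eg_cg]
  exact h.mul_right (semiconj_toWall_right i j)

theorem arc_cg_comm (i : Fin r) (j : Fin s) (x : Fin r ⊕ Fin s) (h1 : x ≠ .inl i)
    (h2 : x ≠ .inr j) : arc i j * cg (position x) = cg (position x) * arc i j := by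
  have h := semiconj_toWall_arc i j
  obtain ⟨y, rfl⟩ := (sideAct (toWall i j)).surjective x
  have hy := semiconj_cg (g := toWall i j) (x := y) rfl
  refine semiconj_unique (h.mul_right hy) ?_
  rw [eg_cg_comm]
  · exact hy.mul_right h
  · rcases y with y | y
    · intro hy
      have hy' : r - (y : ℕ) = r := hy
      obtain rfl : y = ⟨0, i.pos⟩ := Fin.ext (by change (y : ℕ) = 0; lia)
      exact h1 (congrArg Sum.inl (Equiv.swap_apply_left _ _))
    · change r + 1 + (y : ℕ) ≠ r
      lia
  · rcases y with y | y
    · change r - (y : ℕ) ≠ r + 1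
      lia
    · intro hy
      have hy' : r + 1 + (y : ℕ) = r + 1 := hy
      obtain rfl : y = ⟨0, j.pos⟩ := Fin.ext (by change (y : ℕ) = 0; lia)
      exact h2 (congrArg Sum.inr (Equiv.swap_apply_left _ _))

/-- After moving `i, i'` to the indices 1 and 0, the first arc is the conjugate of `e` by `s_{r-1}`,
and the claim becomes a consequence of `e s_{r-1} e = e`. -/
theorem arc_arc_left (i i' : Fin r) (j : Fin s) (h : i ≠ i') :
    arc i j * arc i' j = perm r s (Equiv.swap i i', 1) * arc i' j := by
  have hr : 1 < r := by
    have := Fin.val_ne_of_ne h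
    lia
  have hk : (⟨1, hr⟩ : Fin r) ≠ ⟨0, i.pos⟩ := by simp
  obtain ⟨σ, h1, h2⟩ := exists_move h hk
  have hj : Equiv.swap ⟨0, j.pos⟩ j ⟨0, j.pos⟩ = j := Equiv.swap_apply_left _ _
  have s1 := semiconj_arc (g := (σ, Equiv.swap ⟨0, j.pos⟩ j)) h1 hj
  have s2 := semiconj_arc (g := (σ, Equiv.swap ⟨0, j.pos⟩ j)) h2 hj
  have s3 := semiconj_swap_left (g := (σ, Equiv.swap ⟨0, j.pos⟩ j)) h1 h2
  refine semiconj_unique (s1.mul_right s2) ?_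
  have hb : arc (⟨1, hr⟩ : Fin r) (⟨0, j.pos⟩ : Fin s) =
      perm r s (Equiv.swap ⟨1, hr⟩ ⟨0, i.pos⟩, 1) * eg r s *
        perm r s (Equiv.swap ⟨1, hr⟩ ⟨0, i.pos⟩, 1) := by
    have h3 : toWall (⟨1, hr⟩ : Fin r) (⟨0, j.pos⟩ : Fin s) =
        (Equiv.swap ⟨1, hr⟩ ⟨0, i.pos⟩, 1) :=
      Prod.ext (Equiv.swap_comm _ _) (Equiv.swap_self _)
    rw [arc, h3]
  have hs : perm r s (Equiv.swap ⟨1, hr⟩ ⟨0, i.pos⟩, 1) = sg (r - 1) := by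
    have := perm_left (s := s) (a := 0) hr
    rwa [Coxeter.adjacent_eq hr, Equiv.swap_comm] at this
  have : arc (⟨1, hr⟩ : Fin r) (⟨0, j.pos⟩ : Fin s) * arc ⟨0, i.pos⟩ ⟨0, j.pos⟩ =
      perm r s (Equiv.swap ⟨1, hr⟩ ⟨0, i.pos⟩, 1) * arc ⟨0, i.pos⟩ ⟨0, j.pos⟩ := by
    rw [hb, hs, arc_zero rfl rfl, mul_assoc, mul_assoc, ← mul_assoc (eg r s), eg_sg_eg_left hr]
  rw [this]
  exact s3.mul_right s2

theorem arc_arc_right (i : Fin r) (j j' : Fin s) (h : j ≠ j') :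
    arc i j * arc i j' = perm r s (1, Equiv.swap j j') * arc i j' := by
  have hs : 1 < s := by
    have := Fin.val_ne_of_ne h
    lia
  have hl : (⟨1, hs⟩ : Fin s) ≠ ⟨0, j.pos⟩ := by simp
  obtain ⟨τ, h1, h2⟩ := exists_move h hl
  have hi : Equiv.swap ⟨0, i.pos⟩ i ⟨0, i.pos⟩ = i := Equiv.swap_apply_left _ _
  have s1 := semiconj_arc (g := (Equiv.swap ⟨0, i.pos⟩ i, τ)) hi h1
  have s2 := semiconj_arc (g := (Equiv.swap ⟨0, i.pos⟩ i, τ)) hi h2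
  have s3 := semiconj_swap_right (g := (Equiv.swap ⟨0, i.pos⟩ i, τ)) h1 h2
  refine semiconj_unique (s1.mul_right s2) ?_
  have hb : arc (⟨0, i.pos⟩ : Fin r) (⟨1, hs⟩ : Fin s) =
      perm r s (1, Equiv.swap ⟨1, hs⟩ ⟨0, j.pos⟩) * eg r s *
        perm r s (1, Equiv.swap ⟨1, hs⟩ ⟨0, j.pos⟩) := by
    have h3 : toWall (⟨0, i.pos⟩ : Fin r) (⟨1, hs⟩ : Fin s) =
        (1, Equiv.swap ⟨1, hs⟩ ⟨0, j.pos⟩) :=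
      Prod.ext (Equiv.swap_self _) (Equiv.swap_comm _ _)
    rw [arc, h3]
  have hsg : perm r s (1, Equiv.swap ⟨1, hs⟩ ⟨0, j.pos⟩) = sg (r + 1) := by
    have := perm_right (r := r) (b := 0) hs
    rwa [Coxeter.adjacent_eq hs, Equiv.swap_comm] at this
  have : arc (⟨0, i.pos⟩ : Fin r) (⟨1, hs⟩ : Fin s) * arc ⟨0, i.pos⟩ ⟨0, j.pos⟩ =
      perm r s (1, Equiv.swap ⟨1, hs⟩ ⟨0, j.pos⟩) * arc ⟨0, i.pos⟩ ⟨0, j.pos⟩ := by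
    rw [hb, hsg, arc_zero rfl rfl, mul_assoc, mul_assoc, ← mul_assoc (eg r s), eg_sg_eg_right hs]
  rw [this]
  exact s3.mul_right s2

/-- With the arcs moved to indices 1, 1 and 0, 0 this is the long relation between `e`, `s_{r-1}`
and `s_{r+1}`. -/
theorem arc_comm (i i' : Fin r) (j j' : Fin s) (hi : i ≠ i') (hj : j ≠ j') :
    arc i j * arc i' j' = arc i' j' * arc i j := by
  have hr : 1 < r := by
    have := Fin.val_ne_of_ne hi
    lia
  have hs : 1 < s := by
    have := Fin.val_ne_of_ne hj
    lia
  have hk : (⟨1, hr⟩ : Fin r) ≠ ⟨0, i.pos⟩ := by simp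
  have hl : (⟨1, hs⟩ : Fin s) ≠ ⟨0, j.pos⟩ := by simp
  obtain ⟨σ, h1, h2⟩ := exists_move hi hk
  obtain ⟨τ, h3, h4⟩ := exists_move hj hl
  have s1 := semiconj_arc (g := (σ, τ)) h1 h3
  have s2 := semiconj_arc (g := (σ, τ)) h2 h4
  refine semiconj_unique (s1.mul_right s2) ?_
  have hb : perm r s (toWall (⟨1, hr⟩ : Fin r) (⟨1, hs⟩ : Fin s)) = sg (r - 1) * sg (r + 1) := by
    have e1 := permLeft_adjacent (r := r) (s := s) (a := 0) hr
    have e2 := permRight_adjacent (r := r) (s := s) (b := 0) hs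
    rw [Coxeter.adjacent_eq hr] at e1
    rw [Coxeter.adjacent_eq hs] at e2
    rw [perm_apply]
    exact congrArg₂ (· * ·) e1 e2
  -- The conjugating permutation appears in the same order on both sides of `e`, while the defining
  -- relation has the opposite order on the right.
  have hc : (sg (r - 1) * sg (r + 1) : SignQuot r s) = sg (r + 1) * sg (r - 1) :=
    sg_comm (by lia)
  have : arc (⟨1, hr⟩ : Fin r) (⟨1, hs⟩ : Fin s) * arc ⟨0, i.pos⟩ ⟨0, j.pos⟩ =
      arc ⟨0, i.pos⟩ ⟨0, j.pos⟩ * arc (⟨1, hr⟩ : Fin r) (⟨1, hs⟩ : Fin s) := by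
    have := eg_eg (r := r) (s := s) hr hs
    rw [arc_zero (i := ⟨0, i.pos⟩) rfl rfl, arc, hb]
    nth_rw 2 [hc]
    nth_rw 3 [hc]
    simpa only [mul_assoc] using this
  rw [this]
  exact s2.mul_right s1

variable (r s) in
/-- The permutations, Clifford generators and arcs of the walled Brauer–Clifford superalgebra. -/
noncomputable def arcSystem : ArcSystem r s (SignQuot r s) where
  perm := perm r s
  c x := cg (position x)
  e := arc
  perm_c := perm_cg
  perm_e := perm_arc
  c_sq _ := cg_sq _
  c_comm _ _ := cg_comm _ _
  e_sq := arc_sq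
  e_c_e := arc_cg_arc
  e_e_left := arc_arc_left
  e_e_right := arc_arc_right
  e_comm := arc_comm
  c_e := cg_arc
  e_c := arc_cg
  e_c_comm := arc_cg_comm

theorem exists_position {i : ℕ} (h : 1 ≤ i ∧ i ≤ r + s) :
    ∃ x : Fin r ⊕ Fin s, position x = i := by
  by_cases hi : i ≤ r
  · exact ⟨.inl ⟨r - i, by lia⟩, by change r - (r - i) = i; lia⟩
  · exact ⟨.inr ⟨i - r - 1, by lia⟩, by change r + 1 + (i - r - 1) = i; lia⟩

theorem exists_perm_eq_sg {i : ℕ} (h : 1 ≤ i ∧ i < r + s ∧ i ≠ r) :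
    ∃ g, perm r s g = sg i := by
  by_cases hi : i < r
  · exact ⟨_, (perm_left (a := r - i - 1) (by lia)).trans (by congr 1; lia)⟩
  · exact ⟨_, (perm_right (b := i - r - 1) (by lia)).trans (by congr 1; lia)⟩

theorem isNormal_gen_mul (g : Gen r s) {x : SignQuot r s} (hx : (arcSystem r s).IsNormal x) :
    (arcSystem r s).IsNormal (cls r s (BC.gen g) * x) := by
  cases g with
  | s i h =>
    obtain ⟨g, hg⟩ := exists_perm_eq_sg h
    rw [show cls r s (BC.gen (.s i h)) = perm r s g from (hg.trans (sg_eq h)).symm]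
    exact hx.perm_mul g
  | c i h =>
    obtain ⟨y, hy⟩ := exists_position h
    rw [show cls r s (BC.gen (.c i h)) = (arcSystem r s).c y from
      ((congrArg cg hy).trans (cg_eq h)).symm, ← ArcSystem.clif_single]
    exact hx.clif_mul _
  | e h =>
    rw [show cls r s (BC.gen (.e h)) = arc (⟨0, h.1⟩ : Fin r) (⟨0, h.2⟩ : Fin s) from
      ((arc_zero rfl rfl).trans (eg_eq h)).symm]
    exact hx.e_mul _ _

/-- The empty word is the normal form without arcs, and normal forms are stable under left
multiplication by each generator. -/
theorem isNormal_word (l : List (Gen r s)) :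
    (arcSystem r s).IsNormal (cls r s (l.map BC.gen).prod) := by
  induction l with
  | nil =>
    rw [List.map_nil, List.prod_nil, map_one]
    exact (arcSystem r s).isNormal_arcs List.Pairwise.nil
  | cons g l ih =>
    rw [List.map_cons, List.prod_cons, map_mul]
    exact isNormal_gen_mul g ih

end SignQuot

end WalledBrauerClifford

namespace WalledBrauerClifford

section

open BeadDiagram

variable {r s : ℕ}

namespace SignQuot

/-! ### Normal forms and diagrams -/

theorem position_le_iff (x : Fin r ⊕ Fin s) : position x ≤ r ↔ x.isLeft := by
  rcases x with x | x
  · exact iff_of_true (Nat.sub_le _ _) rfl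
  · exact iff_of_false (by change ¬ r + 1 + (x : ℕ) ≤ r; lia) (by simp)

theorem position_mem (x : Fin r ⊕ Fin s) : 1 ≤ position x ∧ position x ≤ r + s := by
  rcases x with x | x
  · change 1 ≤ r - (x : ℕ) ∧ r - (x : ℕ) ≤ r + s
    lia
  · change 1 ≤ r + 1 + (x : ℕ) ∧ r + 1 + (x : ℕ) ≤ r + s
    lia

theorem position_injective : Function.Injective (position (r := r) (s := s)) := by
  rintro (x | x) (y | y) h
  · change r - (x : ℕ) = r - (y : ℕ) at h
    exact congrArg Sum.inl (Fin.ext (by lia))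
  · change r - (x : ℕ) = r + 1 + (y : ℕ) at h
    lia
  · change r + 1 + (x : ℕ) = r - (y : ℕ) at h
    lia
  · change r + 1 + (x : ℕ) = r + 1 + (y : ℕ) at h
    exact congrArg Sum.inr (Fin.ext (by lia))

variable (r s) in
/-- The label of a strand. -/
noncomputable def label : Fin r ⊕ Fin s ≃ Label r s :=
  Equiv.ofBijective (fun x => ⟨position x, position_mem x⟩)
    ⟨fun _ _ h => position_injective (congrArg Subtype.val h), fun n =>
      (exists_position n.2).imp fun _ h => Subtype.ext h⟩

theorem label_le_iff (x : Fin r ⊕ Fin s) : (label r s x : ℕ) ≤ r ↔ x.isLeft := position_le_iff x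

/-- The permutation of the labels given by a pair of permutations of the two sides. -/
noncomputable def labelPerm (g : Equiv.Perm (Fin r) × Equiv.Perm (Fin s)) :
    Equiv.Perm (Label r s) := (label r s).permCongr (sideAct g)

theorem labelPerm_label (g : Equiv.Perm (Fin r) × Equiv.Perm (Fin s)) (x : Fin r ⊕ Fin s) :
    labelPerm g (label r s x) = label r s (sideAct g x) := by
  simp [labelPerm]

theorem labelPerm_mul (g h : Equiv.Perm (Fin r) × Equiv.Perm (Fin s)) :
    labelPerm (g * h) = labelPerm g * labelPerm h := by
  ext1 n
  obtain ⟨x, rfl⟩ := (label r s).surjective n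
  simp only [Equiv.Perm.mul_apply, labelPerm_label]
  rcases x with x | x <;> rfl

theorem labelPerm_one : labelPerm (1 : Equiv.Perm (Fin r) × Equiv.Perm (Fin s)) = 1 := by
  ext1 n
  obtain ⟨x, rfl⟩ := (label r s).surjective n
  rw [labelPerm_label]
  rcases x with x | x <;> rfl

theorem labelPerm_preservesSides (g : Equiv.Perm (Fin r) × Equiv.Perm (Fin s)) :
    PreservesSides (labelPerm g) := by
  intro n
  obtain ⟨x, rfl⟩ := (label r s).surjective n
  rw [labelPerm_label, label_le_iff, label_le_iff]
  rcases x with x | x <;> rfl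

theorem labelPerm_swap_left (a b : Fin r) :
    labelPerm (Equiv.swap a b, (1 : Equiv.Perm (Fin s))) =
      Equiv.swap (label r s (.inl a)) (label r s (.inl b)) := by
  rw [← Equiv.symm_trans_swap_trans, ← Equiv.Perm.sumCongr_swap_one]
  rfl

theorem labelPerm_swap_right (a b : Fin s) :
    labelPerm ((1 : Equiv.Perm (Fin r)), Equiv.swap a b) =
      Equiv.swap (label r s (.inr a)) (label r s (.inr b)) := by
  rw [← Equiv.symm_trans_swap_trans, ← Equiv.Perm.sumCongr_one_swap]
  rfl

/-- The sides of the ends of an arc. -/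
theorem label_arc (i : Fin r) (j : Fin s) :
    (label r s (.inl i) : ℕ) ≤ r ↔ ¬ (label r s (.inr j) : ℕ) ≤ r := by
  simp [label_le_iff]

/-- An element of the walled Brauer–Clifford superalgebra, given up to sign, is represented by a
diagram. -/
def Represents (a : SignQuot r s) (d : BeadDiagram r s) : Prop :=
  ∃ x, cls r s x = a ∧ ∃ y : BDSub r s, (y : DiagramAlgebra r s) = DiagramAlgebra.ofDiagram d ∧
    toBD r s x = BD.mk r s y

theorem Represents.mul {a a' : SignQuot r s} {d d' d'' : BeadDiagram r s} (h : Represents a d)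
    (h' : Represents a' d') (hd : DiagramAlgebra.ofDiagram d * DiagramAlgebra.ofDiagram d' =
      DiagramAlgebra.ofDiagram d'') : Represents (a * a') d'' := by
  obtain ⟨x, rfl, y, hy, hxy⟩ := h
  obtain ⟨x', rfl, y', hy', hxy'⟩ := h'
  exact ⟨x * x', map_mul _ _ _, y * y', by rw [← hd, ← hy, ← hy']; rfl,
    by rw [map_mul, map_mul, hxy, hxy']⟩

theorem Represents.one {d : BeadDiagram r s} (hd : DiagramAlgebra.ofDiagram d = 1) :
    Represents (1 : SignQuot r s) d :=
  ⟨1, map_one _, 1, hd.symm, by rw [map_one, map_one]⟩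

theorem Represents.gen (g : Gen r s) : Represents (cls r s (BC.gen g)) g.diagram :=
  ⟨_, rfl, BDSub.gen g, rfl, toBD_gen g⟩

theorem Represents.congr {a : SignQuot r s} {d d' : BeadDiagram r s} (e : d = d')
    (h : Represents a d) : Represents a d' := e ▸ h

theorem perm_congr {g h : Equiv.Perm (Label r s)} (e : g = h) (hg : PreservesSides g)
    (hh : PreservesSides h) : BeadDiagram.perm g hg = BeadDiagram.perm h hh := by
  subst e; rfl

theorem represents_perm (g : Equiv.Perm (Fin r) × Equiv.Perm (Fin s)) :
    Represents (perm r s g) (BeadDiagram.perm _ (labelPerm_preservesSides g)) := by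
  induction g using prod_induction with
  | one =>
    rw [map_one]
    refine .one ?_
    rw [perm_congr labelPerm_one _ .one, DiagramAlgebra.perm_one]
  | mul g h hg hh =>
    rw [map_mul]
    refine hg.mul hh ?_
    rw [DiagramAlgebra.perm_mul_perm]
    exact congrArg _ (perm_congr (labelPerm_mul g h).symm _ _)
  | left a ha =>
    have h : 1 ≤ r - a - 1 ∧ r - a - 1 < r + s ∧ r - a - 1 ≠ r := by lia
    rw [perm_left ha, sg_eq h]
    refine Represents.congr ?_ (.gen (.s _ h))
    refine (crossing_eq_perm _ h).trans (perm_congr (Eq.symm ?_) _ _)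
    rw [Coxeter.adjacent_eq ha, labelPerm_swap_left, Equiv.swap_comm]
    congr 1
    exact Subtype.ext (by change r - a = r - a - 1 + 1; lia)
  | right b hb =>
    have h : 1 ≤ r + 1 + b ∧ r + 1 + b < r + s ∧ r + 1 + b ≠ r := by lia
    rw [perm_right hb, sg_eq h]
    refine Represents.congr ?_ (.gen (.s _ h))
    refine (crossing_eq_perm _ h).trans (perm_congr (Eq.symm ?_) _ _)
    rw [Coxeter.adjacent_eq hb, labelPerm_swap_right]
    rfl

theorem represents_c (x : Fin r ⊕ Fin s) :
    Represents ((arcSystem r s).c x) (bead (label r s x).1 (label r s x).2) := by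
  change Represents (cg (position x)) _
  rw [cg_eq (position_mem x)]
  exact .gen (.c _ _)

/-- Up to sign the order of the factors is irrelevant, so some diagram with straight strands is
enough, and only the parities of its beads are recorded. -/
theorem represents_clif (A : Fin r ⊕ Fin s → Multiplicative (ZMod 2)) :
    ∃ d, Represents ((arcSystem r s).clif A) d ∧ (∀ v, d.mate v = (!v.1, v.2)) ∧
      ∀ b x, ((d.beads (b, label r s x)).length : ZMod 2) = (A x).toAdd := by
  induction A using ArcSystem.clif_induction with
  | one =>
    refine ⟨BeadDiagram.one r s, ?_, fun _ => rfl, fun _ _ => ?_⟩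
    · rw [map_one]
      exact .one DiagramAlgebra.one_eq.symm
    · change ((List.length [] : ℕ) : ZMod 2) = 0
      simp
  | mul A B hA hB =>
    obtain ⟨d, hd, hm, hl⟩ := hA
    obtain ⟨d', hd', hm', hl'⟩ := hB
    have hv : d.IsVertical := fun v => by rw [hm]
    refine ⟨below d hv d', ?_, fun v => ?_, fun b x => ?_⟩
    · rw [map_mul]
      exact hd.mul hd' (DiagramAlgebra.vertical_mul hv d')
    · rw [below_mate]
      rcases v with ⟨(_ | _), n⟩ <;> simp [belowIn, belowOut, hm, hm']
    · have h1 := hl false x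
      have h2 := hl' b x
      have h3 := hl true x
      rw [below_beads]
      rcases b with _ | _
      · simp [belowIn, belowHead, belowTail, hm, hm', h1, h2]
      · simp [belowIn, belowHead, belowTail, hm, hm', h3, h2, add_comm]
  | single x =>
    refine ⟨bead (label r s x).1 (label r s x).2, ?_, fun _ => rfl, fun b y => ?_⟩
    · rw [ArcSystem.clif_single]
      exact represents_c x
    simp only [bead, Pi.mulSingle_apply]
    simp only [← Subtype.ext_iff, (label r s).injective.eq_iff]
    split_ifs <;> simp

/-- The arc at the wall is represented by the cup-cap diagram, and conjugating diagrams by a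
permutation moves its ends in the same way. -/
theorem represents_arc (i : Fin r) (j : Fin s) :
    Represents (arc i j) (matching _ (.swap (label_arc i j))) := by
  have h : 1 ≤ r ∧ 1 ≤ s := ⟨i.pos, j.pos⟩
  have h0 := label_arc (⟨0, i.pos⟩ : Fin r) (⟨0, j.pos⟩ : Fin s)
  have he : Represents (eg r s) (matching _ (.swap h0)) := by
    rw [eg_eq h]
    exact Represents.congr (cupCap_eq_matching h) (.gen (.e h))
  have hp := represents_perm (toWall i j)
  refine (hp.mul he (d'' := above _ (perm_isVertical _ (labelPerm_preservesSides (toWall i j)))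
    (matching _ (.swap (label_arc i j)))) ?_).mul hp ?_
  · rw [← DiagramAlgebra.mul_vertical]
    refine DiagramAlgebra.perm_mul_matching _ _ _ fun n => ?_
    have h1 : labelPerm (toWall i j) (label r s (.inl ⟨0, i.pos⟩)) = label r s (.inl i) := by
      rw [labelPerm_label]
      exact congrArg (fun k => label r s (.inl k)) (Equiv.swap_apply_left _ _)
    have h2 : labelPerm (toWall i j) (label r s (.inr ⟨0, j.pos⟩)) = label r s (.inr j) := by
      rw [labelPerm_label]
      exact congrArg (fun k => label r s (.inr k)) (Equiv.swap_apply_left _ _)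
    rw [← h1, ← h2]
    exact (labelPerm (toWall i j)).injective.swap_apply _ _ _
  · rw [← DiagramAlgebra.mul_vertical, mul_assoc, DiagramAlgebra.perm_mul_perm,
      perm_congr (h := 1) _ _ .one, DiagramAlgebra.perm_one, mul_one]
    rw [← labelPerm_mul, toWall_mul_self, labelPerm_one]

/-- Since the arcs are disjoint, adding one meets straight strands at both of its ends, and the
product of diagrams is not zero. -/
theorem represents_arcs {P : List (Fin r × Fin s)} (hP : ValidArcs P) :
    ∃ t, ∃ ht : IsMatching t, Represents ((arcSystem r s).arcs P) (matching t ht) ∧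
      (∀ p ∈ P, t (label r s (.inl p.1)) = label r s (.inr p.2)) ∧
      ∀ x, (∀ p ∈ P, x ≠ .inl p.1 ∧ x ≠ .inr p.2) → t (label r s x) = label r s x := by
  induction P with
  | nil =>
    refine ⟨id, ⟨fun _ => rfl, fun _ h => (h rfl).elim⟩, ?_, by simp, fun _ _ => rfl⟩
    refine .one ?_
    rw [DiagramAlgebra.one_eq]
    congr 1
    refine BeadDiagram.ext (funext fun v => ?_) rfl rfl
    simp [matching, BeadDiagram.one]
  | cons p P ih =>
    have hP' := List.pairwise_cons.1 hP
    obtain ⟨t, ht, hrep, h1, h2⟩ := ih hP'.2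
    have hne : ∀ q ∈ P, (Sum.inl p.1 : Fin r ⊕ Fin s) ≠ .inl q.1 ∧
        (Sum.inr p.2 : Fin r ⊕ Fin s) ≠ .inr q.2 := fun q hq =>
      ⟨fun h => (hP'.1 q hq).1 (Sum.inl_injective h), fun h => (hP'.1 q hq).2 (Sum.inr_injective h)⟩
    have hp := h2 (.inl p.1) fun q hq => ⟨(hne q hq).1, by simp⟩
    have hq := h2 (.inr p.2) fun q hq => ⟨by simp, (hne q hq).2⟩
    have hm := DiagramAlgebra.isMatching_swap_comp (label_arc p.1 p.2) ht hp hq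
    refine ⟨_, hm, ?_, fun q hq' => ?_, fun x hx => ?_⟩
    · rw [ArcSystem.arcs_cons]
      exact (represents_arc p.1 p.2).mul hrep 
        (DiagramAlgebra.matching_swap_mul (label_arc p.1 p.2) ht hp hq hm)
    · rcases List.mem_cons.1 hq' with rfl | hq'
      · rw [Function.comp_apply, hp, Equiv.swap_apply_left]
      · rw [Function.comp_apply, h1 q hq', Equiv.swap_apply_of_ne_of_ne]
        · exact fun h => by simpa using (label r s).injective h
        · exact fun h => (hne q hq').2 ((label r s).injective h).symm
    · rw [Function.comp_apply, h2 x fun q hq' => hx q (List.mem_cons_of_mem _ hq'),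
        Equiv.swap_apply_of_ne_of_ne]
      · exact fun h => (hx p List.mem_cons_self).1 ((label r s).injective h)
      · exact fun h => (hx p List.mem_cons_self).2 ((label r s).injective h)

end SignQuot

end

end WalledBrauerClifford

/-! ### Normal forms are determined by the shapes of their diagrams -/

namespace WalledBrauerClifford

section

open BeadDiagram

variable {r s : ℕ}

namespace SignQuot

/-- The connections and the parities of the numbers of beads in the diagram of a normal form. -/
structure Describes (g : Equiv.Perm (Fin r) × Equiv.Perm (Fin s))
    (A : Fin r ⊕ Fin s → Multiplicative (ZMod 2)) (P : List (Fin r × Fin s))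
    (B : Fin r ⊕ Fin s → Multiplicative (ZMod 2)) (d : BeadDiagram r s) : Prop where
  mate_top : ∀ p ∈ P, d.mate (true, label r s (.inl p.1)) = (true, label r s (.inr p.2))
  mate_bottom : ∀ p ∈ P, d.mate (false, label r s (.inl (g.1 p.1))) =
    (false, label r s (.inr (g.2 p.2)))
  mate_through : ∀ x, (∀ p ∈ P, x ≠ .inl p.1 ∧ x ≠ .inr p.2) →
    d.mate (true, label r s x) = (false, label r s (sideAct g x))
  beads_top : ∀ p ∈ P, ((d.beads (true, label r s (.inl p.1))).length : ZMod 2) =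
    (B (.inl p.1) * B (.inr p.2)).toAdd
  beads_bottom : ∀ p ∈ P, ((d.beads (false, label r s (.inl (g.1 p.1)))).length : ZMod 2) =
    (A (.inl p.1) * A (.inr p.2)).toAdd
  beads_through : ∀ x, (∀ p ∈ P, x ≠ .inl p.1 ∧ x ≠ .inr p.2) →
    ((d.beads (true, label r s x)).length : ZMod 2) = (A x * B x).toAdd

/-- The four factors are stacked from bottom to top. The beads of `B` lie on the top arcs, those of
`A` on the bottom arcs, and both are collected by the strands that pass through; `g` only moves the
bottom ends. -/
theorem represents_normalForm (g : Equiv.Perm (Fin r) × Equiv.Perm (Fin s))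
    (A : Fin r ⊕ Fin s → Multiplicative (ZMod 2)) {P : List (Fin r × Fin s)} (hP : ValidArcs P)
    (B : Fin r ⊕ Fin s → Multiplicative (ZMod 2)) :
    ∃ d, Represents ((arcSystem r s).normalForm g A P B) d ∧ Describes g A P B d := by
  obtain ⟨a, ha, ham, hal⟩ := represents_clif A
  obtain ⟨b, hb, hbm, hbl⟩ := represents_clif B
  obtain ⟨t, ht, hrep, h1, h2⟩ := represents_arcs hP
  have hav : a.IsVertical := fun v => by rw [ham]
  have hbv : b.IsVertical := fun v => by rw [hbm]
  have hne : ∀ x y, (label r s (.inl x) : Label r s) ≠ label r s (.inr y) := fun x y h => by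
    simpa using (label r s).injective h
  have hg := fun x => labelPerm_label g x
  have hg' : ∀ x, (labelPerm g).symm (label r s (sideAct g x)) = label r s x := fun x => by
    rw [← hg, Equiv.symm_apply_apply]
  have hgl : ∀ i, (labelPerm g).symm (label r s (.inl (g.1 i))) = label r s (.inl i) :=
    fun i => hg' (.inl i)
  have hgr : ∀ j, labelPerm g (label r s (.inr j)) = label r s (.inr (g.2 j)) :=
    fun j => hg (.inr j)
  refine ⟨below _ (perm_isVertical _ (labelPerm_preservesSides g)) (below a hav
    (above b hbv (matching t ht))), (represents_perm g).mul (ha.mul (hrep.mul hb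
      (DiagramAlgebra.mul_vertical hbv _)) (DiagramAlgebra.vertical_mul hav _))
      (DiagramAlgebra.vertical_mul _ _), ?_⟩
  constructor
  · intro p hp
    simp [below_mate, above_mate, belowIn, belowOut, aboveIn, aboveOut, ham, hbm, matching,
      BeadDiagram.perm, h1 p hp, (hne _ _).symm]
  · intro p hp
    simp [below_mate, above_mate, belowIn, belowOut, aboveIn, aboveOut, ham, hbm, matching,
      BeadDiagram.perm, h1 p hp, (hne _ _).symm, hgl, hgr]
  · intro x hx
    simp [below_mate, above_mate, belowIn, belowOut, aboveIn, aboveOut, ham, hbm, matching,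
      BeadDiagram.perm, h2 x hx, hg]
  · intro p hp
    simp [below_mate, above_mate, below_beads, above_beads, belowIn, belowOut, aboveIn, aboveOut,
      belowHead, belowTail, aboveHead, aboveTail, ham, hbm, matching,
      BeadDiagram.perm, h1 p hp, (hne _ _).symm, hbl]
  · intro p hp
    simp [below_mate, above_mate, below_beads, above_beads, belowIn, belowOut, aboveIn, aboveOut,
      belowHead, belowTail, aboveHead, aboveTail, ham, hbm, matching,
      BeadDiagram.perm, h1 p hp, (hne _ _).symm, hgl, hal]
  · intro x hx
    simp [below_mate, above_mate, below_beads, above_beads, belowIn, belowOut, aboveIn, aboveOut,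
      belowHead, belowTail, aboveHead, aboveTail, ham, hbm, matching,
      BeadDiagram.perm, h2 x hx, hal, hbl, add_comm]

namespace Describes

variable {g g' : Equiv.Perm (Fin r) × Equiv.Perm (Fin s)}
  {A A' B B' : Fin r ⊕ Fin s → Multiplicative (ZMod 2)} {P P' : List (Fin r × Fin s)}
  {d d' : BeadDiagram r s}

/-- The arcs can be recovered from the top row, because strands that do not belong to `P` leave this
row. -/
theorem mem_of_mate (h : Describes g A P B d) {i : Fin r} {j : Fin s}
    (hm : d.mate (true, label r s (.inl i)) = (true, label r s (.inr j))) : (i, j) ∈ P := by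
  by_cases hi : ∃ p ∈ P, p.1 = i
  · obtain ⟨p, hp, rfl⟩ := hi
    have := h.mate_top p hp
    rw [hm, Prod.mk.injEq, (label r s).injective.eq_iff] at this
    rwa [Sum.inr_injective this.2]
  · push Not at hi
    have := h.mate_through (.inl i) fun p hp => ⟨fun e => hi p hp (Sum.inl_injective e).symm,
      by simp⟩
    rw [hm] at this
    simpa using congrArg Prod.fst this

theorem mem_iff (h : Describes g A P B d) (h' : Describes g' A' P' B' d') (hm : d.mate = d'.mate)
    (p : Fin r × Fin s) : p ∈ P ↔ p ∈ P' :=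
  ⟨fun hp => h'.mem_of_mate (hm ▸ h.mate_top p hp),
    fun hp => h.mem_of_mate (hm ▸ h'.mate_top p hp)⟩

theorem mem_of_mate_bottom (h : Describes g A P B d) {i : Fin r} {j : Fin s}
    (hm : d.mate (false, label r s (.inl (g.1 i))) = (false, label r s (.inr (g.2 j)))) :
    (i, j) ∈ P := by
  by_cases hi : ∃ p ∈ P, p.1 = i
  · obtain ⟨p, hp, rfl⟩ := hi
    have := h.mate_bottom p hp
    rw [hm, Prod.mk.injEq, (label r s).injective.eq_iff] at this
    rwa [g.2.injective (Sum.inr_injective this.2)]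
  · push Not at hi
    have := h.mate_through (.inl i) fun p hp => ⟨fun e => hi p hp (Sum.inl_injective e).symm,
      by simp⟩
    have h2 := congrArg d.mate this
    rw [d.mate_mate] at h2
    have h3 := h2.trans hm
    simpa using congrArg Prod.fst h3

/-- The bottom row shows the arcs moved by `g` as well as those moved by `g'`, so the quotient of
the two permutations maps arcs to arcs. -/
theorem apply_mem (h : Describes g A P B d) (h' : Describes g' A' P' B' d')
    (hm : d.mate = d'.mate) {p : Fin r × Fin s} (hp : p ∈ P') :
    ((g⁻¹ * g').1 p.1, (g⁻¹ * g').2 p.2) ∈ P := by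
  refine h.mem_of_mate_bottom ?_
  have := h'.mate_bottom p hp
  rw [← hm] at this
  have e1 : g.1 ((g⁻¹ * g').1 p.1) = g'.1 p.1 := by simp
  have e2 : g.2 ((g⁻¹ * g').2 p.2) = g'.2 p.2 := by simp
  rw [e1, e2, this]

/-- The normal form is determined by the shape of its diagram. -/
theorem normalForm_eq (hP : ValidArcs P) (hP' : ValidArcs P') (h : Describes g A P B d)
    (h' : Describes g' A' P' B' d') (hd : d.shape = d'.shape) :
    (arcSystem r s).normalForm g A P B = (arcSystem r s).normalForm g' A' P' B' := by
  have hm : d.mate = d'.mate := congrArg Prod.fst hd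
  have hb : ∀ v, ((d.beads v).length : ZMod 2) = (d'.beads v).length :=
    fun v => congrFun (congrArg Prod.snd hd) v
  have hmem := h.mem_iff h' hm
  -- A strand that passes through has one bottom end, which is computed from either permutation.
  have hthrough : ∀ x, (∀ p ∈ P, x ≠ .inl p.1 ∧ x ≠ .inr p.2) →
      sideAct (g⁻¹ * g') x = x := by
    intro x hx
    have h1 := h.mate_through x hx
    have h2 := h'.mate_through x fun p hp => hx p ((hmem p).2 hp)
    rw [hm, h2, Prod.mk.injEq, (label r s).injective.eq_iff] at h1
    have h3 := congrArg (sideAct g).symm h1.2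
    rw [Equiv.symm_apply_apply] at h3
    refine Eq.trans ?_ h3
    rcases x with x | x <;> rfl
  refine (arcSystem r s).normalForm_eq hP
    ((List.perm_ext_iff_of_nodup hP.nodup hP'.nodup).2 hmem)
    (fun p hp => h.apply_mem h' hm ((hmem p).1 hp))
    (fun i hi => Sum.inl_injective (hthrough (.inl i) fun p hp =>
      ⟨fun e => hi p hp (Sum.inl_injective e).symm, by simp⟩))
    (fun j hj => Sum.inr_injective (hthrough (.inr j) fun p hp =>
      ⟨by simp, fun e => hj p hp (Sum.inr_injective e).symm⟩)) ?_ ?_ ?_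
  · intro p hp
    -- The bottom arc of `p` in the first description is the bottom arc of another member of the
    -- list in the second one, so the bead parities are compared there.
    have hq := h'.apply_mem h hm.symm hp
    have h1 := h.beads_bottom p hp
    have h2 := h'.beads_bottom _ hq
    have e1 : g'.1 ((g'⁻¹ * g).1 p.1) = g.1 p.1 := by simp
    rw [hb] at h1
    simp only [e1] at h2
    have h3 := Multiplicative.toAdd.injective (h1.symm.trans h2)
    rw [h3]
    rfl
  · intro p hp
    have h1 := h.beads_top p hp
    rw [hb, h'.beads_top p ((hmem p).1 hp)] at h1
    exact (Multiplicative.toAdd.injective h1).symm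
  · intro x hx
    have h1 := h.beads_through x hx
    rw [hb, h'.beads_through x fun p hp => hx p ((hmem p).2 hp)] at h1
    have h2 : (sideAct (g⁻¹ * g')).symm x = x := by
      rw [Equiv.symm_apply_eq, hthrough x hx]
    rw [h2]
    exact (Multiplicative.toAdd.injective h1).symm

end Describes

/-! ### Injectivity -/

/-- The image of an element in the space with basis the shapes. -/
noncomputable def toShape (r s : ℕ) : BC r s →ₗ[ℂ] (Shape r s →₀ ℂ) :=
  BD.shapeMap r s ∘ₗ (toBD r s).toLinearMap

/-- An element known up to sign has an image known up to sign, so it is still a nonzero multiple of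
one shape. -/
theorem Represents.toShape {x : BC r s} {d : BeadDiagram r s} (h : Represents (cls r s x) d) :
    ∃ η : ℂ, η ≠ 0 ∧ toShape r s x = Finsupp.single d.shape η := by
  obtain ⟨x', hx, y, hy, hxy⟩ := h
  have h1 : SignQuot.toShape r s x' = Finsupp.single d.shape d.coeff := by
    change BD.shapeMap r s (toBD r s x') = _
    rw [hxy, BD.shapeMap_mk, hy, DiagramAlgebra.shapeMap_ofDiagram]
  rcases cls_eq_iff.1 hx with rfl | rfl
  · exact ⟨d.coeff, d.coeff_ne_zero, h1⟩
  · refine ⟨-d.coeff, neg_ne_zero.2 d.coeff_ne_zero, ?_⟩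
    rw [map_neg] at h1
    rw [Finsupp.single_neg, ← h1, neg_neg]

/-- The words in the generators. -/
def IsWord (x : BC r s) : Prop := ∃ w : List (Gen r s), (w.map BC.gen).prod = x

theorem IsWord.eq_zero_or {x : BC r s} (hx : IsWord x) :
    x = 0 ∨ ∃ g A P B d, ValidArcs P ∧ cls r s x = (arcSystem r s).normalForm g A P B ∧
      Represents (cls r s x) d ∧ Describes g A P B d := by
  obtain ⟨w, rfl⟩ := hx
  rcases isNormal_word w with h | ⟨g, A, P, B, hP, h⟩
  · left
    rw [← cls_zero, cls_eq_iff, neg_zero, or_self] at h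
    exact h
  · right
    obtain ⟨d, hd, hdesc⟩ := represents_normalForm g A hP B
    exact ⟨g, A, P, B, d, hP, h, h ▸ hd, hdesc⟩

/-- A nonzero word is sent to a multiple of a basis vector, which determines it up to sign. -/
theorem exists_basis_vector (r s : ℕ) : ∃ f : Shape r s → BC r s, ∀ x, IsWord x →
    ∃ k, ∃ η : ℂ, SignQuot.toShape r s x = Finsupp.single k η ∧ x = η • f k := by
  classical
  have key : ∀ k, ∃ y : BC r s, ∀ x, IsWord x → ∀ η : ℂ, η ≠ 0 →
      SignQuot.toShape r s x = Finsupp.single k η → x = η • y := by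
    intro k
    by_cases hk : ∃ x, IsWord x ∧ ∃ η : ℂ, η ≠ 0 ∧ SignQuot.toShape r s x = Finsupp.single k η
    · obtain ⟨x₀, hx₀, η₀, hη₀, h₀⟩ := hk
      -- Any word over the shape `k` can serve after normalization. Two of them differ by a sign,
      -- and their coefficients differ by the same sign.
      refine ⟨η₀⁻¹ • x₀, fun x hx η hη h => ?_⟩
      have aux : ∀ z, IsWord z → ∀ ζ : ℂ, ζ ≠ 0 → SignQuot.toShape r s z = Finsupp.single k ζ →
          ∃ g A P B d, ValidArcs P ∧ cls r s z = (arcSystem r s).normalForm g A P B ∧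
            Describes g A P B d ∧ d.shape = k := by
        intro z hz ζ hζ hzk
        rcases hz.eq_zero_or with rfl | ⟨g, A, P, B, d, hP, hn, hd, hd'⟩
        · rw [map_zero, eq_comm, Finsupp.single_eq_zero] at hzk
          exact (hζ hzk).elim
        -- A nonzero coefficient identifies the basis vector, so the diagram of the word has the
        -- shape `k`.
        · obtain ⟨ξ, hξ, h1⟩ := hd.toShape
          rw [hzk] at h1
          refine ⟨g, A, P, B, d, hP, hn, hd', ?_⟩
          rcases Finsupp.single_eq_single_iff _ _ _ _ |>.1 h1 with h2 | h2
          · exact h2.1.symm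
          · exact (hζ h2.1).elim
      obtain ⟨g, A, P, B, d, hP, hn, hd, hk⟩ := aux x hx η hη h
      obtain ⟨g', A', P', B', d', hP', hn', hd', hk'⟩ := aux x₀ hx₀ η₀ hη₀ h₀
      have hcls : cls r s x = cls r s x₀ := by
        rw [hn, hn', hd.normalForm_eq hP hP' hd' (hk.trans hk'.symm)]
      rcases cls_eq_iff.1 hcls with rfl | rfl
      · have : η = η₀ := Finsupp.single_injective k (h.symm.trans h₀)
        rw [this, smul_smul, mul_inv_cancel₀ hη₀, one_smul]
      · rw [map_neg, h₀, ← Finsupp.single_neg] at h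
        have : -η₀ = η := Finsupp.single_injective k h
        rw [← this, smul_smul, neg_mul, mul_inv_cancel₀ hη₀, neg_one_smul]
    · exact ⟨0, fun x hx η hη h => (hk ⟨x, hx, η, hη, h⟩).elim⟩
  choose f hf using key
  refine ⟨f, fun x hx => ?_⟩
  rcases hx.eq_zero_or with rfl | ⟨g, A, P, B, d, hP, hn, hd, hd'⟩
  -- For the zero word the coefficient is zero, and the shape is an arbitrary default.
  · exact ⟨((fun v => v), fun _ => 0), 0, by simp, by simp⟩
  · obtain ⟨η, hη, h⟩ := hd.toShape
    exact ⟨d.shape, η, h, hf _ x hx η hη h⟩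

end SignQuot

/-- The linear extension of `f` is a left inverse of the map to shapes, since this holds for words
and words span. The map to shapes factors through `toBD`. -/
theorem toBD_injective : Function.Injective (toBD r s) := by
  obtain ⟨f, hf⟩ := SignQuot.exists_basis_vector r s
  have key : ∀ x, Finsupp.linearCombination ℂ f (SignQuot.toShape r s x) = x := by
    intro x
    have hx := BC.mem_span_words x
    induction hx using Submodule.span_induction with
    | mem x hx =>
      obtain ⟨k, η, h1, h2⟩ := hf x hx
      rw [h1, Finsupp.linearCombination_single]
      exact h2.symm
    | zero => rw [map_zero, map_zero]
    | add x y _ _ hx hy => rw [map_add, map_add, hx, hy]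
    | smul a x _ hx => rw [map_smul, map_smul, hx]
  intro x y h
  rw [← key x, ← key y]
  exact congrArg (fun z => Finsupp.linearCombination ℂ f (BD.shapeMap r s z)) h

end

end WalledBrauerClifford

theorem mainTheorem5 (r s : ℕ) :
    ∃ φ : WalledBrauerClifford.BC r s ≃ₐ[ℂ] WalledBrauerClifford.BD r s,
      ∀ (i : ZMod 2) (x : WalledBrauerClifford.BC r s),
        x ∈ WalledBrauerClifford.BC.grading r s i ↔
          φ x ∈ WalledBrauerClifford.BD.grading r s i :=
  ⟨AlgEquiv.ofBijective (WalledBrauerClifford.toBD r s)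
    ⟨WalledBrauerClifford.toBD_injective, WalledBrauerClifford.toBD_surjective⟩,
    WalledBrauerClifford.toBD_mem_grading WalledBrauerClifford.toBD_injective⟩
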